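/- For real $R$ and integers $n\ge 1$ let $$\lambda_R(n)=\sum_{r\le R}\frac{\mu^2(r)}{\phi(r)}\sum_{d\mid (r,n)}d\,\mu(d),\qquad \psi_R(x)=\sum_{1\le n\le x}\lambda_R(n),$$ where $\mu$ is the Möbius function and $\phi$ is Euler's function, and for $k\ge 1$ let $$M_k(N,h,\psi_R)=\sum_{n=1}^N\bigl(\psi_R(n+h)-\psi_R(n)\bigr)^k .$$ Let $\lambda=\lambda(N)$ be a bounded real function of the positive integer $N$ (for instance a positive constant), and let $h=h(N)$ be real with $h\to\infty$ and $h\sim\lambda\log N$ as $N\to\infty$. Let $\theta_1,\theta_2,\theta_3$ be fixed real numbers with $0<\theta_k<\frac1k$, and in the $k$-th moment take $R=N^{\theta_k}$. Then, as $N\to\infty$, $$M_1(N,h,\psi_R)\sim\lambda N\log N,\qquad M_2(N,h,\psi_R)\sim(\theta_2\lambda+\lambda^2)N\log^2N,$$ $$M_3(N,h,\psi_R)\sim\Bigl(\tfrac34\theta_3^2\lambda+3\theta_3\lambda^2+\lambda^3\Bigr)N\log^3N .$$ -/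

import Mathlib

/-- The short divisor sum `λ_R(n) = ∑_{r ≤ R} μ²(r)/φ(r) ∑_{d ∣ (r, n)} d μ(d)` for `n ≥ 1`,
with the convention `λ_R(0) = 0`. -/
noncomputable def lambdaR (R : ℝ) (n : ℕ) : ℝ :=
  if n = 0 then 0 else
    ∑ r ∈ Finset.Icc 1 ⌊R⌋₊,
      ((ArithmeticFunction.moebius r : ℝ) ^ 2 / (Nat.totient r : ℝ)) *
        ∑ d ∈ (Nat.gcd r n).divisors, (d : ℝ) * (ArithmeticFunction.moebius d : ℝ)

/-- The summatory function `ψ_R(x) = ∑_{n ≤ x} λ_R(n)`, for real `x`. -/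
noncomputable def psiR (R : ℝ) (x : ℝ) : ℝ :=
  ∑ n ∈ Finset.Icc 1 ⌊x⌋₊, lambdaR R n

/-- The moments `M_k(N, h, f) = ∑_{n = 1}^{N} (f(n + h) - f(n))^k`. -/
noncomputable def shortIntervalMoment (k N : ℕ) (h : ℝ) (f : ℝ → ℝ) : ℝ :=
  ∑ n ∈ Finset.Icc 1 N, (f ((n : ℝ) + h) - f (n : ℝ)) ^ k

/-!
# Moments of short divisor sums in short intervals

With `H = ⌊h⌋` and `R` replaced by its integer part, `ψ_R(n + h) - ψ_R(n)` is the window sum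
`∑_{j ≤ H} λ_R(n + j)`, and `λ_R(n) = ∑_{r ≤ R} sqfMul (localValue n) r`, where `sqfMul u` is the
multiplicative function supported on the squarefree integers with prime values `u`, and
`localValue n p` is `-1` or `1 / (p - 1)` according as `p` divides `n` or not.

**Reduction to a period.** The window sum is a linear combination of the indicators of `d ∣ n + j`
with `d ≤ R` squarefree, hence has the product of the primes up to `R` as a period. Expanding the
`k`-th power, each product of indicators has mean over `n ≤ N` equal to its mean over a period up to
`O(1 / N)`, so that the `k`-th moment over `n ≤ N` is `N` times the mean over a period up to
`(H R log² R)^k` times a constant (`abs_sum_windowSum_pow_sub_le`). This is negligible because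
`θ_k < 1 / k` (`tendsto_moment_sub_div`), and only means over a period remain.

**Local factors.** By the Chinese remainder theorem the mean of a product of
`sqfMul (localValue (n + j i)) (r i)` factors over the primes (`periodMean_prod_sqfMul`). The factor
at `p` depends on the set of the `i` with `p ∣ r i`: it vanishes if this set has one element, is
`O(1 / p²)` if it contains two shifts incongruent modulo `p`, and is `O(1 / p)` otherwise, which for
distinct shifts forces `p` to divide a difference of shifts.

**Off-diagonal terms.** Write the window sum as the part with `r ≤ V` plus the part with `r > V`, for
a constant `V`. The first part is `H + O_V(1)`, as only `r = 1` does not cancel over a window. In the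
second, each product of distinct shifts has mean `O(V^{-1/4})` on average over the shifts: weighting
one of the moduli by its fourth root leaves the sum over all moduli convergent
(`exists_sum_abs_periodMean_le`, an instance of Rankin's trick); if one of three shifts is repeated,
this holds up to a factor `log R`, which is admissible as there are only `H²` such terms. Letting `V`
be large shows that the off-diagonal terms do not contribute to the asymptotics.

**Diagonal terms.** The mean of `λ_R` over a period is `1`. That of `λ_R²` is
`∑_{r ≤ R} μ²(r) / φ(r) = log R + O(1)`, as distinct moduli are orthogonal. That of `λ_R³` is a sum
over triples of moduli in which no prime divides exactly one modulus; these are the triples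
`(x y e, x z e, y z e)` with `x, y, z, e` pairwise coprime and squarefree
(`periodMean_truncSum_cube`). By symmetry it is six times the part `z < y < x`, where the only
constraint is `x y e ≤ R`, up to `O(log R)`. The variables are summed one at a time,
`x`, then `y`, then `e`, then `z`, with weights which are `1 / p` at the primes for `x, y, z` and
`-1 / p` for `e`, up to `O(p^{-2})`: each sum is a convolution of `1 / n` or `μ(n) / n` with an absolutely convergent factor. The
sums over `x, y, z` gain a logarithm each and the sum over `e` loses one, the Euler products multiply
to `1` (`posConst_mul_negConst_mul_posConst`), and the result is asymptotic to `(3 / 4) log² R`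
(`exists_abs_quadSum_sub_le`).

Altogether the second and third means of the window sum are `H² + H log R` and
`H³ + 3 H² log R + (3 / 4) H log² R` up to `o(H log^{k-1} R)`, and the substitution of
`log R ~ θ log N` and `H ~ λ log N` is made in `isEquivalent_shortIntervalMoment`.
-/

section

open Finset ArithmeticFunction

/-! ### Multiplicative functions supported on squarefree integers -/

/-- The multiplicative function supported on squarefree integers whose value at a prime `p`
is `u p`. -/
noncomputable def sqfMul (u : ℕ → ℝ) : ArithmeticFunction ℝ :=
  ⟨fun n => if Squarefree n then ∏ p ∈ n.primeFactors, u p else 0, by simp⟩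

/-- The values `u` at the primes, replaced by `0` at the primes dividing `q`. -/
def awayFrom (q : ℕ) (u : ℕ → ℝ) (p : ℕ) : ℝ := if p ∣ q then 0 else u p

/-- The arithmetic function `n ↦ μ(n) / n`. -/
noncomputable def moebiusDivId : ArithmeticFunction ℝ :=
  ⟨fun n => (moebius n : ℝ) / n, by simp⟩

/-- The arithmetic function `n ↦ 1 / n`. -/
noncomputable def invId : ArithmeticFunction ℝ :=
  ⟨fun n => 1 / (n : ℝ), by simp⟩

theorem sqfMul_apply (u : ℕ → ℝ) (n : ℕ) :
    sqfMul u n = if Squarefree n then ∏ p ∈ n.primeFactors, u p else 0 := rfl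

theorem moebiusDivId_apply (n : ℕ) : moebiusDivId n = (moebius n : ℝ) / n := rfl

theorem invId_apply (n : ℕ) : invId n = 1 / (n : ℝ) := rfl

theorem sqfMul_isMultiplicative (u : ℕ → ℝ) : (sqfMul u).IsMultiplicative := by
  refine ⟨by simp [sqfMul_apply], fun {m n} h => ?_⟩
  simp only [sqfMul_apply, Nat.squarefree_mul h]
  by_cases hm : Squarefree m <;> by_cases hn : Squarefree n <;> simp [hm, hn]
  rw [h.primeFactors_mul, prod_union h.disjoint_primeFactors]

theorem sqfMul_one (u : ℕ → ℝ) : sqfMul u 1 = 1 := (sqfMul_isMultiplicative u).1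

theorem sqfMul_mul (u : ℕ → ℝ) {m n : ℕ} (h : m.Coprime n) :
    sqfMul u (m * n) = sqfMul u m * sqfMul u n := (sqfMul_isMultiplicative u).2 h

theorem sqfMul_prime (u : ℕ → ℝ) {p : ℕ} (hp : p.Prime) : sqfMul u p = u p := by
  simp [sqfMul_apply, hp.prime.squarefree, hp.primeFactors]

theorem sqfMul_of_not_squarefree (u : ℕ → ℝ) {n : ℕ} (h : ¬ Squarefree n) : sqfMul u n = 0 := by
  simp [sqfMul_apply, h]

theorem sqfMul_prime_pow_eq_zero (u : ℕ → ℝ) {p k : ℕ} (hp : p.Prime) (hk : 2 ≤ k) :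
    sqfMul u (p ^ k) = 0 := by
  apply sqfMul_of_not_squarefree
  rw [Nat.squarefree_pow_iff hp.ne_one (by omega)]
  omega

theorem sqfMul_mul_fun (u v : ℕ → ℝ) (n : ℕ) :
    sqfMul (fun p => u p * v p) n = sqfMul u n * sqfMul v n := by
  simp only [sqfMul_apply]
  split_ifs <;> simp [prod_mul_distrib]

theorem sqfMul_congr {u v : ℕ → ℝ} (n : ℕ) (h : ∀ p, p.Prime → p ∣ n → u p = v p) :
    sqfMul u n = sqfMul v n := by
  simp only [sqfMul_apply]
  split_ifs
  · exact prod_congr rfl fun p hp =>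
      h p (Nat.prime_of_mem_primeFactors hp) (Nat.dvd_of_mem_primeFactors hp)
  · rfl

theorem abs_sqfMul (u : ℕ → ℝ) (n : ℕ) : |sqfMul u n| = sqfMul (fun p => |u p|) n := by
  simp only [sqfMul_apply]
  split_ifs <;> simp [abs_prod]

theorem sqfMul_nonneg {u : ℕ → ℝ} (n : ℕ) (h : ∀ p, p.Prime → 0 ≤ u p) : 0 ≤ sqfMul u n := by
  simp only [sqfMul_apply]
  split_ifs
  · exact prod_nonneg fun p hp => h p (Nat.prime_of_mem_primeFactors hp)
  · rfl

theorem sqfMul_mono {u v : ℕ → ℝ} (n : ℕ) (h0 : ∀ p, p.Prime → 0 ≤ u p)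
    (h : ∀ p, p.Prime → u p ≤ v p) : sqfMul u n ≤ sqfMul v n := by
  simp only [sqfMul_apply]
  split_ifs
  · exact prod_le_prod (fun p hp => h0 p (Nat.prime_of_mem_primeFactors hp))
      fun p hp => h p (Nat.prime_of_mem_primeFactors hp)
  · rfl

/-- Discarding the primes dividing `q` restricts `sqfMul u` to the integers coprime to `q`. -/
theorem sqfMul_awayFrom (q : ℕ) (u : ℕ → ℝ) (n : ℕ) :
    sqfMul (awayFrom q u) n = if n.Coprime q then sqfMul u n else 0 := by
  rcases eq_or_ne n 0 with rfl | hn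
  · simp
  split_ifs with h
  · refine sqfMul_congr n fun p hp hpn => ?_
    rw [awayFrom, if_neg]
    intro hpq
    exact hp.one_lt.ne' (Nat.dvd_one.mp (h ▸ Nat.dvd_gcd hpn hpq))
  · obtain ⟨p, hp, hpn, hpq⟩ := Nat.Prime.not_coprime_iff_dvd.mp h
    rw [sqfMul_apply]
    split_ifs
    · exact prod_eq_zero (Nat.mem_primeFactors.mpr ⟨hp, hpn, hn⟩) (by simp [awayFrom, hpq])
    · rfl

theorem invId_isMultiplicative : invId.IsMultiplicative :=
  ⟨by simp [invId_apply], fun {m n} _ => by simp [invId_apply, mul_comm]⟩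

theorem moebiusDivId_isMultiplicative : moebiusDivId.IsMultiplicative := by
  refine ⟨by simp [moebiusDivId_apply], fun {m n} h => ?_⟩
  simp only [moebiusDivId_apply, isMultiplicative_moebius.map_mul_of_coprime h]
  push_cast
  ring

/-- `μ(n) / n` and `1 / n` are inverse to each other for the Dirichlet convolution. -/
theorem moebiusDivId_mul_invId : moebiusDivId * invId = 1 := by
  ext n
  rcases eq_or_ne n 0 with rfl | hn
  · simp
  rw [mul_apply]
  have h : ∀ x ∈ n.divisorsAntidiagonal,
      moebiusDivId x.1 * invId x.2 = (moebius x.1 : ℝ) * (1 / n) := by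
    intro x hx
    obtain ⟨hx1, -⟩ := Nat.mem_divisorsAntidiagonal.mp hx
    simp only [moebiusDivId_apply, invId_apply, ← hx1]
    push_cast
    rw [div_mul_div_comm, mul_one, mul_one_div]
  rw [sum_congr rfl h, ← sum_mul]
  have h2 : ∑ x ∈ n.divisorsAntidiagonal, (moebius x.1 : ℝ) = if n = 1 then 1 else 0 := by
    rw [Nat.sum_divisorsAntidiagonal (f := fun a _ => (moebius a : ℝ))]
    have h3 := congrArg (fun f : ArithmeticFunction ℝ => f n) (coe_moebius_mul_coe_zeta (R := ℝ))
    simpa only [coe_mul_zeta_apply, intCoe_apply, one_apply] using h3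
  rw [h2, one_apply]
  split_ifs with h1
  · simp [h1]
  · simp

/-- Dirichlet's rearrangement: a sum over factorizations of the integers up to `N`. -/
theorem sum_Ioc_sum_divisorsAntidiagonal (F : ℕ → ℕ → ℝ) (N : ℕ) :
    ∑ n ∈ Ioc 0 N, ∑ x ∈ n.divisorsAntidiagonal, F x.1 x.2 =
      ∑ d ∈ Ioc 0 N, ∑ k ∈ Ioc 0 (N / d), F d k := by
  trans ∑ n ∈ Ioc 0 N, ∑ x ∈ Ioc 0 N ×ˢ Ioc 0 N with x.1 * x.2 = n, F x.1 x.2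
  · refine sum_congr rfl fun n hn ↦ ?_
    simp only [mem_Ioc] at hn
    rw [Nat.divisorsAntidiagonal_eq_prod_filter_of_le hn.1.ne' hn.2]
  trans ∑ x ∈ Ioc 0 N ×ˢ Ioc 0 N with x.1 * x.2 ≤ N, F x.1 x.2
  · simp_rw [sum_filter]
    rw [sum_comm]
    exact sum_congr rfl fun _ _ ↦ (by simp_all)
  rw [sum_filter, sum_product]
  refine sum_congr rfl fun n hn ↦ ?_
  rw [← sum_filter]
  refine sum_congr ?_ fun _ _ => rfl
  ext k
  simp only [mem_filter, mem_Ioc] at hn ⊢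
  rw [Nat.le_div_iff_mul_le hn.1, mul_comm k n]
  constructor
  · rintro ⟨⟨h1, -⟩, h2⟩
    exact ⟨h1, h2⟩
  · rintro ⟨h1, h2⟩
    exact ⟨⟨h1, (Nat.le_mul_of_pos_left k hn.1).trans h2⟩, h2⟩

/-- At a prime power, convolution with `sqfMul u` has only two terms. -/
theorem sqfMul_mul_prime_pow_succ (u : ℕ → ℝ) (c : ArithmeticFunction ℝ) {p : ℕ} (hp : p.Prime)
    (k : ℕ) : (sqfMul u * c) (p ^ (k + 1)) = c (p ^ (k + 1)) + u p * c (p ^ k) := by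
  rw [mul_apply, Nat.sum_divisorsAntidiagonal (f := fun a b => sqfMul u a * c b),
    Nat.sum_divisors_prime_pow hp, sum_range_succ', sum_range_succ']
  rw [sum_eq_zero]
  · simp only [pow_zero, sqfMul_one, Nat.div_one, zero_add, pow_one, sqfMul_prime u hp]
    rw [pow_succ, Nat.mul_div_cancel _ hp.pos]
    ring
  · intro i _
    rw [sqfMul_prime_pow_eq_zero u hp (by omega), zero_mul]

/-! ### Euler products and convolutions with absolutely convergent factors -/

/-- A nonnegative multiplicative function is summable as soon as its sums over the powers of the
primes have a convergent product; the product bounds the sum. -/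
theorem summable_of_sum_prime_pow_le {f : ℕ → ℝ} (hf : ∀ n, 0 ≤ f n) (h0 : f 0 = 0) (h1 : f 1 = 1)
    (hmul : ∀ {m n : ℕ}, m.Coprime n → f (m * n) = f m * f n) {δ : ℕ → ℝ} (hδ : ∀ n, 0 ≤ δ n)
    (hδs : Summable δ) (T : Finset ℕ) {h : ℕ → ℝ} (hh : ∀ p, 1 ≤ h p)
    (hs : ∀ p, p.Prime → Summable fun k => f (p ^ k))
    (hb : ∀ p, p.Prime → ∑' k, f (p ^ k) ≤ (1 + δ p) * (if p ∈ T then h p else 1)) :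
    Summable f ∧ ∑' n, f n ≤ Real.exp (∑' n, δ n) * ∏ p ∈ T, h p := by
  have key : ∀ N, ∑ n ∈ range N, f n ≤ Real.exp (∑' n, δ n) * ∏ p ∈ T, h p := by
    intro N
    have hE := (EulerProduct.summable_and_hasSum_smoothNumbers_prod_primesBelow_tsum (f := f) h1
      hmul (fun {p} hp => by simpa [abs_of_nonneg (hf _)] using hs p hp) N).2
    have hsub : ∑ n ∈ range N, f n ≤ ∏ p ∈ N.primesBelow, ∑' k, f (p ^ k) := by
      have hmem : ∀ n ∈ (range N).filter (· ≠ 0), n ∈ N.smoothNumbers := by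
        intro n hn
        rw [mem_filter, mem_range] at hn
        exact Nat.mem_smoothNumbers_of_lt (Nat.pos_of_ne_zero hn.2) hn.1
      have e1 : ∑ n ∈ range N, f n = ∑ n ∈ (range N).filter (· ≠ 0), f n := by
        rw [sum_filter]
        refine sum_congr rfl fun n _ => ?_
        split_ifs with hn
        · rfl
        · push Not at hn; rw [hn, h0]
      rw [e1, ← sum_attach]
      let g : {x // x ∈ (range N).filter (· ≠ 0)} ↪ N.smoothNumbers :=
        ⟨fun x => ⟨x.1, hmem x.1 x.2⟩, fun x y hxy => by
          exact Subtype.ext (congrArg (fun z : N.smoothNumbers => (z : ℕ)) hxy)⟩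
      have := sum_le_hasSum (((range N).filter (· ≠ 0)).attach.map g)
        (fun m _ => hf (m : ℕ)) hE
      rwa [sum_map] at this
    refine hsub.trans ?_
    calc ∏ p ∈ N.primesBelow, ∑' k, f (p ^ k)
        ≤ ∏ p ∈ N.primesBelow, ((1 + δ p) * (if p ∈ T then h p else 1)) :=
          prod_le_prod (fun p _ => tsum_nonneg fun k => hf _)
            fun p hp => hb p (Nat.prime_of_mem_primesBelow hp)
      _ = (∏ p ∈ N.primesBelow, (1 + δ p)) * ∏ p ∈ N.primesBelow, (if p ∈ T then h p else 1) :=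
          prod_mul_distrib
      _ ≤ Real.exp (∑' n, δ n) * ∏ p ∈ T, h p := by
          have hexp : ∏ p ∈ N.primesBelow, (1 + δ p) ≤ Real.exp (∑' n, δ n) := by
            calc ∏ p ∈ N.primesBelow, (1 + δ p) ≤ ∏ p ∈ N.primesBelow, Real.exp (δ p) :=
                  prod_le_prod (fun p _ => by linarith [hδ p])
                    fun p _ => by linarith [Real.add_one_le_exp (δ p)]
              _ = Real.exp (∑ p ∈ N.primesBelow, δ p) := (Real.exp_sum _ _).symm
              _ ≤ _ := Real.exp_le_exp.mpr (hδs.sum_le_tsum _ fun i _ => hδ i)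
          refine mul_le_mul hexp ?_ (prod_nonneg fun p _ => ?_) (Real.exp_pos _).le
          · rw [← prod_filter, filter_mem_eq_inter]
            exact prod_le_prod_of_subset_of_one_le inter_subset_right
              (fun p _ => zero_le_one.trans (hh p)) (fun p _ _ => hh p)
          · split_ifs
            · exact zero_le_one.trans (hh p)
            · exact zero_le_one
  exact ⟨summable_of_sum_range_le hf key, Real.tsum_le_of_sum_range_le hf key⟩

/-- The product `∏_{p ∣ q} (1 + c p^{-3/4})`, which measures how strongly error terms depend on a
coprimality condition modulo `q`. -/
noncomputable def sigmaBound (c : ℝ) (q : ℕ) : ℝ :=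
  ∏ p ∈ q.primeFactors, (1 + c * (p : ℝ) ^ (-(3 / 4) : ℝ))

theorem one_le_sigmaBound {c : ℝ} (hc : 0 ≤ c) (q : ℕ) : 1 ≤ sigmaBound c q :=
  Finset.one_le_prod fun p _ => by
    have : 0 ≤ c * (p : ℝ) ^ (-(3 / 4) : ℝ) := by positivity
    linarith

theorem sigmaBound_mul (c : ℝ) {m n : ℕ} (h : m.Coprime n) :
    sigmaBound c (m * n) = sigmaBound c m * sigmaBound c n := by
  rw [sigmaBound, h.primeFactors_mul, prod_union h.disjoint_primeFactors]; rfl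

/-- The values `u p` are close to `s / p`: the error `C p^{-7/4}` is small enough for the convolutions
below to converge absolutely with a weight `n^{1/4}`. -/
def NearInv (s C : ℝ) (u : ℕ → ℝ) : Prop :=
  ∀ p : ℕ, p.Prime → |u p - s / p| ≤ C * (p : ℝ) ^ (-(7 / 4) : ℝ)

theorem summable_natCast_rpow_neg {a : ℝ} (ha : 1 < a) : Summable fun n : ℕ => (n : ℝ) ^ (-a) :=
  Real.summable_nat_rpow.mpr (by linarith)

theorem mul_rpow_quarter_isMultiplicative {b : ArithmeticFunction ℝ} (hb : b.IsMultiplicative)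
    {m n : ℕ} (h : m.Coprime n) :
    |b (m * n)| * ((m * n : ℕ) : ℝ) ^ (1 / 4 : ℝ) =
      (|b m| * (m : ℝ) ^ (1 / 4 : ℝ)) * (|b n| * (n : ℝ) ^ (1 / 4 : ℝ)) := by
  rw [hb.2 h, abs_mul]
  push_cast
  rw [Real.mul_rpow (by positivity) (by positivity)]
  ring

theorem moebiusDivId_prime {p : ℕ} (hp : p.Prime) : moebiusDivId p = -1 / p := by
  simp [moebiusDivId_apply, moebius_apply_prime hp]

theorem moebiusDivId_prime_pow_eq_zero {p k : ℕ} (hp : p.Prime) (hk : 2 ≤ k) :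
    moebiusDivId (p ^ k) = 0 := by
  rw [moebiusDivId_apply, moebius_apply_prime_pow hp (by omega), if_neg (by omega)]
  simp

theorem sqfMul_mul_moebiusDivId_prime (u : ℕ → ℝ) {p : ℕ} (hp : p.Prime) :
    (sqfMul u * moebiusDivId) (p ^ 1) = u p - 1 / p := by
  rw [sqfMul_mul_prime_pow_succ u _ hp 0]
  simp [moebiusDivId_prime hp, moebiusDivId_isMultiplicative.1]
  ring

theorem sqfMul_mul_moebiusDivId_prime_sq (u : ℕ → ℝ) {p : ℕ} (hp : p.Prime) :
    (sqfMul u * moebiusDivId) (p ^ 2) = -u p / p := by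
  rw [sqfMul_mul_prime_pow_succ u _ hp 1, moebiusDivId_prime_pow_eq_zero hp le_rfl, pow_one,
    moebiusDivId_prime hp]
  ring

theorem sqfMul_mul_moebiusDivId_prime_pow_eq_zero (u : ℕ → ℝ) {p k : ℕ} (hp : p.Prime)
    (hk : 3 ≤ k) : (sqfMul u * moebiusDivId) (p ^ k) = 0 := by
  obtain ⟨j, rfl⟩ := Nat.exists_eq_add_of_le' hk
  rw [show j + 3 = (j + 2) + 1 by ring, sqfMul_mul_prime_pow_succ u _ hp (j + 2),
    moebiusDivId_prime_pow_eq_zero hp (by omega), moebiusDivId_prime_pow_eq_zero hp (by omega)]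
  simp

theorem sqfMul_mul_invId_prime_pow_succ (u : ℕ → ℝ) {p : ℕ} (hp : p.Prime) (k : ℕ) :
    (sqfMul u * invId) (p ^ (k + 1)) = (u p + 1 / p) * (1 / (p : ℝ)) ^ k := by
  rw [sqfMul_mul_prime_pow_succ u _ hp k]
  simp only [invId_apply]
  push_cast
  rw [pow_succ]
  field_simp
  ring

theorem prime_rpow_facts {p : ℕ} (hp : p.Prime) :
    0 < (p : ℝ) ∧ (2 : ℝ) ≤ p := ⟨by exact_mod_cast hp.pos, by exact_mod_cast hp.two_le⟩

theorem nearInv_abs_le {s C : ℝ} {u : ℕ → ℝ} (hu : NearInv s C u) {p : ℕ} (hp : p.Prime) :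
    |u p| ≤ |s| / p + C * (p : ℝ) ^ (-(7 / 4) : ℝ) := by
  obtain ⟨hp0, -⟩ := prime_rpow_facts hp
  calc |u p| = |s / p + (u p - s / p)| := by ring_nf
    _ ≤ |s / p| + |u p - s / p| := abs_add_le _ _
    _ ≤ _ := by rw [abs_div, abs_of_pos hp0]; linarith [hu p hp]

/-- If `u p` is close to `1 / p`, the factor `b` in `sqfMul u = b * (1 / n)` converges absolutely,
even with the weight `n^{1/4}`; restricting to integers coprime to `q` costs a factor `sigmaBound 3
q`. -/
theorem summable_moebius_convolution {C : ℝ} (hC : 0 ≤ C) {u : ℕ → ℝ} (hu : NearInv 1 C u)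
    {q : ℕ} (hq : q ≠ 0) :
    Summable (fun n : ℕ => |(sqfMul (awayFrom q u) * moebiusDivId) n| * (n : ℝ) ^ (1 / 4 : ℝ)) ∧
      ∑' n : ℕ, |(sqfMul (awayFrom q u) * moebiusDivId) n| * (n : ℝ) ^ (1 / 4 : ℝ) ≤
        Real.exp (∑' n : ℕ, (2 * C + 1) * (n : ℝ) ^ (-(3 / 2) : ℝ)) * sigmaBound 3 q := by
  set b := sqfMul (awayFrom q u) * moebiusDivId with hb
  have hbm : b.IsMultiplicative := (sqfMul_isMultiplicative _).mul moebiusDivId_isMultiplicative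
  have hval : ∀ p, p.Prime → ∀ k ∉ range 3, |b (p ^ k)| * ((p ^ k : ℕ) : ℝ) ^ (1 / 4 : ℝ) = 0 := by
    intro p hp k hk
    rw [hb, sqfMul_mul_moebiusDivId_prime_pow_eq_zero _ hp (by simpa using hk)]
    simp
  refine summable_of_sum_prime_pow_le (f := fun n : ℕ => |b n| * (n : ℝ) ^ (1 / 4 : ℝ))
    (fun n => by positivity) (by simp) (by simp [hbm.1])
    (fun {m n} h => mul_rpow_quarter_isMultiplicative hbm h)
    (δ := fun n : ℕ => (2 * C + 1) * (n : ℝ) ^ (-(3 / 2) : ℝ)) (fun n => by positivity)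
    ((summable_natCast_rpow_neg (by norm_num)).mul_left _) q.primeFactors
    (h := fun p => 1 + 3 * (p : ℝ) ^ (-(3 / 4) : ℝ)) (fun p => by
      have : 0 ≤ 3 * (p : ℝ) ^ (-(3 / 4) : ℝ) := by positivity
      linarith) (fun p hp => summable_of_ne_finset_zero (hval p hp)) fun p hp => ?_
  obtain ⟨hp0, hp2⟩ := prime_rpow_facts hp
  rw [tsum_eq_sum (hval p hp), sum_range_succ, sum_range_succ, sum_range_one, pow_zero, hbm.1, hb,
    sqfMul_mul_moebiusDivId_prime _ hp, sqfMul_mul_moebiusDivId_prime_sq _ hp]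
  have r1 : (p : ℝ) ^ (-(7 / 4) : ℝ) * (p : ℝ) ^ (1 / 4 : ℝ) = (p : ℝ) ^ (-(3 / 2) : ℝ) := by
    rw [← Real.rpow_add hp0]; norm_num
  have r2 : ((p ^ 2 : ℕ) : ℝ) ^ (1 / 4 : ℝ) = (p : ℝ) ^ (1 / 2 : ℝ) := by
    push_cast
    rw [← Real.rpow_natCast, ← Real.rpow_mul hp0.le]; norm_num
  have r3 : 1 / (p : ℝ) * (p : ℝ) ^ (1 / 4 : ℝ) = (p : ℝ) ^ (-(3 / 4) : ℝ) := by
    rw [one_div, ← Real.rpow_neg_one, ← Real.rpow_add hp0]; norm_num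
  have r4 : 1 / (p : ℝ) * (1 / p) * (p : ℝ) ^ (1 / 2 : ℝ) = (p : ℝ) ^ (-(3 / 2) : ℝ) := by
    rw [one_div, ← Real.rpow_neg_one, ← Real.rpow_add hp0, ← Real.rpow_add hp0]; norm_num
  have r5 : (p : ℝ) ^ (-(7 / 4) : ℝ) * (1 / p) * (p : ℝ) ^ (1 / 2 : ℝ) ≤
      (p : ℝ) ^ (-(3 / 2) : ℝ) := by
    rw [one_div, ← Real.rpow_neg_one, ← Real.rpow_add hp0, ← Real.rpow_add hp0]
    exact Real.rpow_le_rpow_of_exponent_le (by linarith) (by norm_num)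
  have hx : 0 ≤ (p : ℝ) ^ (-(3 / 2) : ℝ) := by positivity
  by_cases hpq : p ∣ q
  · have hmem : p ∈ q.primeFactors := Nat.mem_primeFactors.mpr ⟨hp, hpq, hq⟩
    rw [if_pos hmem]
    simp only [awayFrom, if_pos hpq, pow_one, neg_zero, zero_div, abs_zero, zero_mul, add_zero,
      zero_sub, abs_neg]
    rw [abs_of_pos (a := 1 / (p : ℝ)) (by positivity), r3]
    have hy : 0 ≤ (p : ℝ) ^ (-(3 / 4) : ℝ) := by positivity
    have : 0 ≤ (2 * C + 1) * (p : ℝ) ^ (-(3 / 2) : ℝ) * (1 + 3 * (p : ℝ) ^ (-(3 / 4) : ℝ)) := by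
      positivity
    simp only [Nat.cast_one, Real.one_rpow, abs_one]
    linarith
  · have hmem : p ∉ q.primeFactors := fun h => hpq (Nat.dvd_of_mem_primeFactors h)
    rw [if_neg hmem]
    simp only [awayFrom, if_neg hpq, pow_one, Nat.cast_one, Real.one_rpow, abs_one, mul_one]
    rw [r2, abs_div, abs_neg, abs_of_pos hp0]
    have h1 := mul_le_mul_of_nonneg_right (hu p hp) (by positivity : 0 ≤ (p : ℝ) ^ (1 / 4 : ℝ))
    rw [mul_assoc, r1] at h1
    have h2 := mul_le_mul_of_nonneg_right (nearInv_abs_le hu hp)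
      (by positivity : 0 ≤ (1 / (p : ℝ)) * (p : ℝ) ^ (1 / 2 : ℝ))
    rw [abs_one] at h2
    have h3 : |u p| / p * (p : ℝ) ^ (1 / 2 : ℝ) = |u p| * (1 / p * (p : ℝ) ^ (1 / 2 : ℝ)) := by ring
    have h4 := mul_le_mul_of_nonneg_left r5 hC
    nlinarith

/-- If `u p` is close to `-1 / p`, the factor `b` in `sqfMul u = b * (μ(n) / n)` converges
absolutely, even with the weight `n^{1/4}`; restricting to integers coprime to `q` costs a factor
`sigmaBound 3 q`. -/
theorem summable_inv_convolution {C : ℝ} (hC : 0 ≤ C) {u : ℕ → ℝ} (hu : NearInv (-1) C u)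
    {q : ℕ} (hq : q ≠ 0) :
    Summable (fun n : ℕ => |(sqfMul (awayFrom q u) * invId) n| * (n : ℝ) ^ (1 / 4 : ℝ)) ∧
      ∑' n : ℕ, |(sqfMul (awayFrom q u) * invId) n| * (n : ℝ) ^ (1 / 4 : ℝ) ≤
        Real.exp (∑' n : ℕ, 3 * C * (n : ℝ) ^ (-(3 / 2) : ℝ)) * sigmaBound 3 q := by
  set b := sqfMul (awayFrom q u) * invId with hb
  have hbm : b.IsMultiplicative := (sqfMul_isMultiplicative _).mul invId_isMultiplicative
  have hgeo : ∀ p : ℕ, p.Prime → (p : ℝ) ^ (-(3 / 4) : ℝ) ≤ 2 / 3 := by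
    intro p hp
    obtain ⟨hp0, hp2⟩ := prime_rpow_facts hp
    calc (p : ℝ) ^ (-(3 / 4) : ℝ) ≤ (2 : ℝ) ^ (-(3 / 4) : ℝ) :=
          Real.rpow_le_rpow_of_nonpos (by norm_num) hp2 (by norm_num)
      _ ≤ 2 / 3 := by
          have h4 : ((2 : ℝ) ^ (-(3 / 4) : ℝ)) ^ 4 ≤ (2 / 3) ^ 4 := by
            rw [← Real.rpow_natCast, ← Real.rpow_mul (by norm_num)]
            norm_num [Real.rpow_neg]
          exact le_of_pow_le_pow_left₀ (by norm_num) (by norm_num) h4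
  have hterm : ∀ p, p.Prime → ∀ k, |b (p ^ (k + 1))| * ((p ^ (k + 1) : ℕ) : ℝ) ^ (1 / 4 : ℝ) =
      |awayFrom q u p + 1 / p| * (p : ℝ) ^ (1 / 4 : ℝ) * ((p : ℝ) ^ (-(3 / 4) : ℝ)) ^ k := by
    intro p hp k
    obtain ⟨hp0, hp2⟩ := prime_rpow_facts hp
    rw [hb, sqfMul_mul_invId_prime_pow_succ _ hp, abs_mul, abs_of_pos (a := (1 / (p : ℝ)) ^ k)
      (by positivity)]
    have e1 : ((p ^ (k + 1) : ℕ) : ℝ) ^ (1 / 4 : ℝ) =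
        ((p : ℝ) ^ (1 / 4 : ℝ)) * ((p : ℝ) ^ (1 / 4 : ℝ)) ^ k := by
      push_cast
      rw [← Real.rpow_natCast, ← Real.rpow_mul hp0.le, mul_comm, Real.rpow_mul hp0.le,
        Real.rpow_natCast, pow_succ, mul_comm]
    have e2 : (p : ℝ) ^ (-(3 / 4) : ℝ) = 1 / p * (p : ℝ) ^ (1 / 4 : ℝ) := by
      rw [one_div, ← Real.rpow_neg_one, ← Real.rpow_add hp0]; norm_num
    rw [e1, e2, mul_pow]
    ring
  have hsum : ∀ p, p.Prime → Summable
      (fun k => |b (p ^ k)| * ((p ^ k : ℕ) : ℝ) ^ (1 / 4 : ℝ)) := by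
    intro p hp
    rw [← summable_nat_add_iff 1]
    simp only [hterm p hp]
    exact (summable_geometric_of_lt_one (by positivity)
      ((hgeo p hp).trans_lt (by norm_num))).mul_left _
  refine summable_of_sum_prime_pow_le (f := fun n : ℕ => |b n| * (n : ℝ) ^ (1 / 4 : ℝ))
    (fun n => by positivity) (by simp) (by simp [hbm.1])
    (fun {m n} h => mul_rpow_quarter_isMultiplicative hbm h)
    (δ := fun n : ℕ => 3 * C * (n : ℝ) ^ (-(3 / 2) : ℝ)) (fun n => by positivity)
    ((summable_natCast_rpow_neg (by norm_num)).mul_left _) q.primeFactors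
    (h := fun p => 1 + 3 * (p : ℝ) ^ (-(3 / 4) : ℝ)) (fun p => by
      have : 0 ≤ 3 * (p : ℝ) ^ (-(3 / 4) : ℝ) := by positivity
      linarith) hsum fun p hp => ?_
  obtain ⟨hp0, hp2⟩ := prime_rpow_facts hp
  have hg := hgeo p hp
  have hg0 : 0 ≤ (p : ℝ) ^ (-(3 / 4) : ℝ) := by positivity
  rw [(hsum p hp).tsum_eq_zero_add]
  simp only [hterm p hp]
  rw [tsum_mul_left, tsum_geometric_of_lt_one hg0 (by linarith), pow_zero, hbm.1]
  simp only [Nat.cast_one, Real.one_rpow, abs_one, mul_one]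
  have hinv : (1 - (p : ℝ) ^ (-(3 / 4) : ℝ))⁻¹ ≤ 3 := by
    rw [inv_le_comm₀ (by linarith) (by norm_num)]; linarith
  have r1 : (p : ℝ) ^ (-(7 / 4) : ℝ) * (p : ℝ) ^ (1 / 4 : ℝ) = (p : ℝ) ^ (-(3 / 2) : ℝ) := by
    rw [← Real.rpow_add hp0]; norm_num
  have r3 : 1 / (p : ℝ) * (p : ℝ) ^ (1 / 4 : ℝ) = (p : ℝ) ^ (-(3 / 4) : ℝ) := by
    rw [one_div, ← Real.rpow_neg_one, ← Real.rpow_add hp0]; norm_num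
  have hx : 0 ≤ (p : ℝ) ^ (-(3 / 2) : ℝ) := by positivity
  by_cases hpq : p ∣ q
  · have hmem : p ∈ q.primeFactors := Nat.mem_primeFactors.mpr ⟨hp, hpq, hq⟩
    rw [if_pos hmem]
    simp only [awayFrom, if_pos hpq, zero_add]
    rw [abs_of_pos (by positivity), r3]
    have : 0 ≤ 3 * C * (p : ℝ) ^ (-(3 / 2) : ℝ) * (1 + 3 * (p : ℝ) ^ (-(3 / 4) : ℝ)) := by
      positivity
    have := mul_le_mul_of_nonneg_left hinv hg0
    linarith
  · have hmem : p ∉ q.primeFactors := fun h => hpq (Nat.dvd_of_mem_primeFactors h)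
    rw [if_neg hmem]
    simp only [awayFrom, if_neg hpq]
    have h1 := mul_le_mul_of_nonneg_right (hu p hp) (by positivity : 0 ≤ (p : ℝ) ^ (1 / 4 : ℝ))
    rw [mul_assoc, r1, show u p - -1 / p = u p + 1 / p by ring] at h1
    have h2 : |u p + 1 / p| * (p : ℝ) ^ (1 / 4 : ℝ) * (1 - (p : ℝ) ^ (-(3 / 4) : ℝ))⁻¹ ≤
        C * (p : ℝ) ^ (-(3 / 2) : ℝ) * 3 :=
      mul_le_mul h1 hinv (inv_nonneg.mpr (by linarith)) (by positivity)
    linarith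

/-! ### Harmonic sums -/

/-- Weighted form of `sum_Ioc_sum_divisorsAntidiagonal` for a Dirichlet convolution. -/
theorem sum_Ioc_convolution_mul (b c : ArithmeticFunction ℝ) (φ : ℕ → ℝ) (N : ℕ) :
    ∑ n ∈ Ioc 0 N, (b * c) n * φ n =
      ∑ d ∈ Ioc 0 N, b d * ∑ k ∈ Ioc 0 (N / d), c k * φ (d * k) := by
  simp_rw [mul_sum]
  rw [← sum_Ioc_sum_divisorsAntidiagonal (fun d k => b d * (c k * φ (d * k)))]
  refine sum_congr rfl fun n _ => ?_
  rw [mul_apply, sum_mul]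
  refine sum_congr rfl fun x hx => ?_
  rw [(Nat.mem_divisorsAntidiagonal.mp hx).1, mul_assoc]

/-- Partial sums of the harmonic series up to a real bound. -/
noncomputable def harmonicSum (t : ℝ) : ℝ := ∑ k ∈ Ioc 0 ⌊t⌋₊, invId k

theorem harmonicSum_eq (t : ℝ) : harmonicSum t = (harmonic ⌊t⌋₊ : ℝ) := by
  rw [harmonicSum, harmonic_eq_sum_Icc, ← Icc_add_one_left_eq_Ioc]
  push_cast
  simp [invId_apply]

theorem abs_harmonicSum_sub_le {t : ℝ} (ht : 1 ≤ t) :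
    |harmonicSum t - Real.log t - Real.eulerMascheroniConstant| ≤ 2 / t := by
  set n := ⌊t⌋₊ with hn
  have hn1 : 1 ≤ n := Nat.one_le_floor_iff t |>.mpr ht
  have hn1' : (1 : ℝ) ≤ n := by exact_mod_cast hn1
  have hnt : (n : ℝ) ≤ t := Nat.floor_le (by linarith)
  have htn : t < n + 1 := Nat.lt_floor_add_one t
  have h1 := Real.eulerMascheroniSeq_lt_eulerMascheroniConstant n
  have h2 := Real.eulerMascheroniConstant_lt_eulerMascheroniSeq' n
  rw [Real.eulerMascheroniSeq] at h1
  rw [Real.eulerMascheroniSeq', if_neg (by omega)] at h2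
  rw [harmonicSum_eq, ← hn]
  have h3 : Real.log (n + 1) - Real.log t ≤ 1 / n := by
    rw [← Real.log_div (by positivity) (by positivity)]
    refine (Real.log_le_sub_one_of_pos (by positivity)).trans ?_
    rw [div_sub_one (by positivity)]
    exact div_le_div₀ (by norm_num) (by linarith) (by positivity) hnt
  have h4 : Real.log t - Real.log n ≤ 1 / n := by
    rw [← Real.log_div (by positivity) (by positivity)]
    refine (Real.log_le_sub_one_of_pos (by positivity)).trans ?_
    rw [div_sub_one (by positivity)]
    gcongr
    linarith
  have h5 : 1 / (n : ℝ) ≤ 2 / t := by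
    rw [div_le_div_iff₀ (by positivity) (by positivity)]; linarith
  rw [abs_le]
  constructor <;> linarith

theorem one_div_le_rpow_quarter {t : ℝ} (ht : 1 ≤ t) : 1 / t ≤ t ^ (-(1 / 4) : ℝ) := by
  rw [one_div, ← Real.rpow_neg_one]
  exact Real.rpow_le_rpow_of_exponent_le ht (by norm_num)

theorem abs_log_le_rpow_quarter {t : ℝ} (h0 : 0 < t) (ht : t < 1) :
    |Real.log t| ≤ 4 * t ^ (-(1 / 4) : ℝ) := by
  rw [abs_of_neg (Real.log_neg h0 ht), ← Real.log_inv]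
  have := Real.log_le_rpow_div (inv_pos.mpr h0).le (show (0 : ℝ) < 1 / 4 by norm_num)
  rw [Real.inv_rpow h0.le, ← Real.rpow_neg h0.le] at this
  linarith

theorem one_le_rpow_quarter {t : ℝ} (h0 : 0 < t) (ht : t < 1) : 1 ≤ t ^ (-(1 / 4) : ℝ) :=
  Real.one_le_rpow_of_pos_of_le_one_of_nonpos h0 ht.le (by norm_num)

theorem harmonicSum_of_lt_one {t : ℝ} (ht : t < 1) : harmonicSum t = 0 := by
  rw [harmonicSum, Nat.floor_eq_zero.mpr ht]; simp

/-- A weaker error term which holds for all `t > 0`: it can be summed over `t = X / d` for all `d`,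
without the constraint `d ≤ X`. -/
theorem abs_harmonicSum_sub_le_rpow {t : ℝ} (h0 : 0 < t) :
    |harmonicSum t - Real.log t - Real.eulerMascheroniConstant| ≤ 5 * t ^ (-(1 / 4) : ℝ) := by
  rcases lt_or_ge t 1 with ht | ht
  · rw [harmonicSum_of_lt_one ht]
    have h1 := abs_log_le_rpow_quarter h0 ht
    have h2 := one_le_rpow_quarter h0 ht
    have h3 := Real.eulerMascheroniConstant_lt_two_thirds
    have h4 := Real.one_half_lt_eulerMascheroniConstant
    rw [abs_le] at h1 ⊢
    constructor <;> linarith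
  · have h1 := abs_harmonicSum_sub_le ht
    have h2 := one_div_le_rpow_quarter ht
    have h3 : 2 / t = 2 * (1 / t) := by ring
    have h4 : 0 ≤ t ^ (-(1 / 4) : ℝ) := by positivity
    linarith

theorem integral_log_div_div {a Y : ℝ} (ha : 0 < a) (haY : a ≤ Y) :
    ∫ s in a..Y, Real.log (s / a) / s = Real.log (Y / a) ^ 2 / 2 := by
  have hpos : ∀ s ∈ Set.uIcc a Y, 0 < s := by
    intro s hs
    rw [Set.uIcc_of_le haY] at hs
    exact ha.trans_le hs.1
  rw [intervalIntegral.integral_eq_sub_of_hasDerivAt (f := fun s => Real.log (s / a) ^ 2 / 2)]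
  · simp [ha.ne']
  · intro s hs
    have hs0 := hpos s hs
    have h1 : HasDerivAt (fun s : ℝ => Real.log (s / a)) ((1 / a) / (s / a)) s :=
      ((hasDerivAt_id s).div_const a).log (by simp; exact ⟨hs0.ne', ha.ne'⟩)
    have h2 := (h1.pow 2).div_const 2
    refine h2.congr_deriv ?_
    have e : 1 / a / (s / a) = 1 / s := by field_simp
    rw [e]
    simp only [Nat.cast_ofNat]
    ring
  · apply ContinuousOn.intervalIntegrable
    intro s hs
    have hs0 := hpos s hs
    apply ContinuousAt.continuousWithinAt
    have : s / a ≠ 0 := (div_pos hs0 ha).ne'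
    fun_prop (disch := first | assumption | exact hs0.ne')

theorem integral_one_div_eq_log {a Y : ℝ} (ha : 0 < a) (haY : a ≤ Y) :
    ∫ s in a..Y, 1 / s = Real.log (Y / a) := by
  rw [integral_one_div]
  rw [Set.uIcc_of_le haY]
  exact fun h => absurd h.1 (not_le.mpr ha)

theorem intervalIntegrable_one_div {a Y : ℝ} (ha : 0 < a) (haY : a ≤ Y) :
    IntervalIntegrable (fun s : ℝ => 1 / s) MeasureTheory.volume a Y := by
  apply intervalIntegral.intervalIntegrable_one_div
  · intro s hs
    rw [Set.uIcc_of_le haY] at hs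
    exact (ha.trans_le hs.1).ne'
  · fun_prop

theorem sum_Icc_zero_ite (c : ℕ → ℝ) (a n : ℕ) :
    ∑ k ∈ Icc 0 n, (if a < k then c k else 0) = ∑ k ∈ Ioc a n, c k := by
  rw [← sum_filter]
  refine sum_congr ?_ fun _ _ => rfl
  ext k
  simp [and_comm]

theorem intervalIntegrable_sum_div (c : ℕ → ℝ) {a : ℕ} (ha : 1 ≤ a) {Y : ℝ} (haY : (a : ℝ) ≤ Y) :
    IntervalIntegrable (fun s : ℝ => (∑ k ∈ Ioc a ⌊s⌋₊, c k) / s) MeasureTheory.volume a Y := by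
  have ha' : (0 : ℝ) < a := by exact_mod_cast ha
  rw [intervalIntegrable_iff_integrableOn_Icc_of_le haY]
  have h1 : MeasureTheory.IntegrableOn (fun s : ℝ => 1 / s) (Set.Icc (a : ℝ) Y) := by
    rw [← intervalIntegrable_iff_integrableOn_Icc_of_le haY]
    exact intervalIntegrable_one_div ha' haY
  have h2 := integrableOn_mul_sum_Icc c (m := a + 1) (by positivity) h1
  refine h2.congr_fun (fun s _ => ?_) measurableSet_Icc
  simp only [Icc_add_one_left_eq_Ioc]
  ring

/-- Partial summation against `log (Y / n)`. -/
theorem sum_mul_log_div_eq_integral (c : ℕ → ℝ) {a : ℕ} (ha : 1 ≤ a) {Y : ℝ} (haY : (a : ℝ) ≤ Y) :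
    ∑ k ∈ Ioc a ⌊Y⌋₊, c k * Real.log (Y / k) = ∫ s in (a : ℝ)..Y, (∑ k ∈ Ioc a ⌊s⌋₊, c k) / s := by
  have ha' : (0 : ℝ) < a := by exact_mod_cast ha
  have hY : 0 < Y := ha'.trans_le haY
  have hd : ∀ t ∈ Set.Icc (a : ℝ) Y, HasDerivAt (fun s => Real.log Y - Real.log s) (-(1 / t)) t := by
    intro t ht
    have := (Real.hasDerivAt_log (ha'.trans_le ht.1).ne').const_sub (Real.log Y)
    simpa using this
  have hint : MeasureTheory.IntegrableOn (deriv fun s => Real.log Y - Real.log s)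
      (Set.Icc (a : ℝ) Y) := by
    have h1 : MeasureTheory.IntegrableOn (fun s : ℝ => -(1 / s)) (Set.Icc (a : ℝ) Y) := by
      rw [← intervalIntegrable_iff_integrableOn_Icc_of_le haY]
      exact (intervalIntegrable_one_div ha' haY).neg
    exact h1.congr_fun (fun t ht => (hd t ht).deriv.symm) measurableSet_Icc
  have key := sum_mul_eq_sub_sub_integral_mul (fun k => if a < k then c k else 0) ha'.le haY
    (fun t ht => (hd t ht).differentiableAt) hint
  rw [Nat.floor_natCast] at key
  have e0 : ∑ k ∈ Icc 0 a, (if a < k then c k else 0) = 0 :=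
    sum_eq_zero fun k hk => if_neg (by simp at hk; omega)
  rw [e0, sub_self, zero_mul, mul_zero, sub_zero, zero_sub] at key
  rw [intervalIntegral.integral_of_le haY]
  have e1 : ∑ k ∈ Ioc a ⌊Y⌋₊, c k * Real.log (Y / k) =
      ∑ k ∈ Ioc a ⌊Y⌋₊, (Real.log Y - Real.log k) * (if a < k then c k else 0) := by
    refine sum_congr rfl fun k hk => ?_
    rw [mem_Ioc] at hk
    have hk0 : (0 : ℝ) < k := by exact_mod_cast (by omega : 0 < k)
    rw [if_pos hk.1, Real.log_div hY.ne' hk0.ne', mul_comm]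
  rw [e1, key, ← MeasureTheory.integral_neg]
  refine MeasureTheory.setIntegral_congr_fun measurableSet_Ioc fun t ht => ?_
  rw [(hd t ⟨ht.1.le, ht.2⟩).deriv, sum_Icc_zero_ite]
  ring

/-- If the sums of `c` over intervals starting at `a` grow like `m log`, then the sums weighted by a
logarithm grow like `(m / 2) log²`. -/
theorem abs_sum_mul_log_div_sub_le (c : ℕ → ℝ) {a : ℕ} (ha : 1 ≤ a) {Y : ℝ} (haY : (a : ℝ) ≤ Y)
    {m E : ℝ} (h : ∀ s : ℝ, (a : ℝ) ≤ s → |∑ k ∈ Ioc a ⌊s⌋₊, c k - m * Real.log (s / a)| ≤ E) :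
    |∑ k ∈ Ioc a ⌊Y⌋₊, c k * Real.log (Y / k) - m * (Real.log (Y / a) ^ 2 / 2)| ≤
      E * Real.log (Y / a) := by
  have ha' : (0 : ℝ) < a := by exact_mod_cast ha
  have hli : IntervalIntegrable (fun s : ℝ => m * (Real.log (s / a) / s))
      MeasureTheory.volume a Y := by
    apply ContinuousOn.intervalIntegrable
    intro s hs
    rw [Set.uIcc_of_le haY] at hs
    have hs0 : 0 < s := ha'.trans_le hs.1
    apply ContinuousAt.continuousWithinAt
    have : s / a ≠ 0 := (div_pos hs0 ha').ne'
    fun_prop (disch := first | assumption | exact hs0.ne')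
  rw [sum_mul_log_div_eq_integral c ha haY, ← integral_log_div_div ha' haY,
    ← intervalIntegral.integral_const_mul,
    ← intervalIntegral.integral_sub (intervalIntegrable_sum_div c ha haY) hli,
    ← integral_one_div_eq_log ha' haY, ← intervalIntegral.integral_const_mul]
  rw [← Real.norm_eq_abs]
  refine intervalIntegral.norm_integral_le_of_norm_le haY ?_
    ((intervalIntegrable_one_div ha' haY).const_mul E)
  refine Filter.Eventually.of_forall fun s hs => ?_
  have hs0 : 0 < s := ha'.trans hs.1
  have := h s hs.1.le
  rw [Real.norm_eq_abs, ← mul_div_assoc, ← sub_div, abs_div, abs_of_pos hs0, mul_one_div]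
  gcongr

/-- The sum `∑_{k ≤ t} log (t / k) / k`. -/
noncomputable def harmonicLogSum (t : ℝ) : ℝ :=
  ∑ k ∈ Ioc 0 ⌊t⌋₊, invId k * Real.log (t / k)

theorem harmonicLogSum_eq_integral {t : ℝ} (ht : 1 ≤ t) :
    harmonicLogSum t = ∫ s in (1 : ℝ)..t, harmonicSum s / s := by
  have hfl : 1 ≤ ⌊t⌋₊ := (Nat.one_le_floor_iff t).mpr ht
  have hsplit : ∀ s : ℝ, 1 ≤ s → ∀ f : ℕ → ℝ, ∑ k ∈ Ioc 0 ⌊s⌋₊, f k = f 1 + ∑ k ∈ Ioc 1 ⌊s⌋₊, f k := by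
    intro s hs f
    have hfl : 1 ≤ ⌊s⌋₊ := (Nat.one_le_floor_iff s).mpr hs
    rw [← sum_Ioc_consecutive f (Nat.zero_le 1) hfl]
    simp
  rw [harmonicLogSum, hsplit t ht,
    sum_mul_log_div_eq_integral invId le_rfl (by simpa using ht)]
  have h1 : invId 1 * Real.log (t / (1 : ℕ)) = ∫ s in (1 : ℝ)..t, 1 / s := by
    rw [integral_one_div_eq_log one_pos ht]; simp [invId_apply]
  have hi := intervalIntegrable_sum_div invId le_rfl (Y := t) (a := 1) (by simpa using ht)
  rw [h1, Nat.cast_one]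
  rw [Nat.cast_one] at hi
  rw [← intervalIntegral.integral_add (intervalIntegrable_one_div one_pos ht) hi]
  refine intervalIntegral.integral_congr fun s hs => ?_
  rw [Set.uIcc_of_le ht] at hs
  rw [harmonicSum, hsplit s hs.1]
  simp [invId_apply, add_div]

/-- The asymptotics of `harmonicLogSum`, with an error that may be summed against `μ(e) / e`. -/
theorem exists_abs_harmonicLogSum_sub_le : ∃ c : ℝ, ∀ t : ℝ, 1 ≤ t →
    |harmonicLogSum t - (Real.log t ^ 2 / 2 + Real.eulerMascheroniConstant * Real.log t + c)| ≤
      2 / t := by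
  set g : ℝ → ℝ := fun s =>
    (harmonicSum s - Real.log s - Real.eulerMascheroniConstant) / s with hg
  have hgb : ∀ s : ℝ, 1 ≤ s → ‖g s‖ ≤ 2 * s ^ (-2 : ℝ) := by
    intro s hs
    have hs0 : 0 < s := by linarith
    rw [hg, Real.norm_eq_abs, abs_div, abs_of_pos hs0, Real.rpow_neg hs0.le]
    have := abs_harmonicSum_sub_le hs
    calc _ ≤ (2 / s) / s := by gcongr
      _ = _ := by norm_num; field_simp
  have hmeas : Measurable g := by
    have h1 : Measurable harmonicSum := by
      have : harmonicSum = (fun n : ℕ => ∑ k ∈ Ioc 0 n, invId k) ∘ (fun s : ℝ => ⌊s⌋₊) := rfl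
      rw [this]
      exact (measurable_from_top).comp Nat.measurable_floor
    exact ((h1.sub Real.measurable_log).sub_const _).div measurable_id
  have hbound : ∀ t : ℝ, 1 ≤ t →
      MeasureTheory.IntegrableOn (fun s : ℝ => 2 * s ^ (-2 : ℝ)) (Set.Ioi t) := fun t ht =>
    (integrableOn_Ioi_rpow_of_lt (by norm_num) (by linarith)).const_mul 2
  have hint : ∀ t : ℝ, 1 ≤ t → MeasureTheory.IntegrableOn g (Set.Ioi t) := by
    intro t ht
    refine (hbound t ht).mono' hmeas.aestronglyMeasurable ?_
    filter_upwards [MeasureTheory.ae_restrict_mem measurableSet_Ioi] with s hs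
    exact hgb s (ht.trans (le_of_lt hs))
  refine ⟨∫ s in Set.Ioi (1 : ℝ), g s, fun t ht => ?_⟩
  have hsum : harmonicLogSum t = (∫ s in (1 : ℝ)..t, g s) + (Real.log t ^ 2 / 2 +
      Real.eulerMascheroniConstant * Real.log t) := by
    have i1 : IntervalIntegrable g MeasureTheory.volume 1 t := by
      rw [intervalIntegrable_iff_integrableOn_Ioc_of_le ht]
      exact (hint 1 le_rfl).mono_set Set.Ioc_subset_Ioi_self
    have i2 : IntervalIntegrable (fun s : ℝ => Real.log (s / 1) / s) MeasureTheory.volume 1 t := by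
      apply ContinuousOn.intervalIntegrable
      intro s hs
      rw [Set.uIcc_of_le ht] at hs
      have hs0 : 0 < s := by linarith [hs.1]
      apply ContinuousAt.continuousWithinAt
      have : s / 1 ≠ 0 := by simpa using hs0.ne'
      fun_prop (disch := first | assumption | exact hs0.ne')
    have i3 := (intervalIntegrable_one_div one_pos ht).const_mul Real.eulerMascheroniConstant
    rw [harmonicLogSum_eq_integral ht]
    have e2 := integral_log_div_div one_pos ht
    have e3 := integral_one_div_eq_log one_pos ht
    rw [div_one] at e2 e3
    rw [← e2, ← e3, ← intervalIntegral.integral_const_mul,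
      ← intervalIntegral.integral_add i2 i3, ← intervalIntegral.integral_add i1 (i2.add i3)]
    refine intervalIntegral.integral_congr fun s hs => ?_
    simp only [hg, div_one]
    ring
  have htail : (∫ s in (1 : ℝ)..t, g s) - ∫ s in Set.Ioi (1 : ℝ), g s = -∫ s in Set.Ioi t, g s := by
    rw [intervalIntegral.integral_of_le ht, ← Set.Ioc_union_Ioi_eq_Ioi ht,
      MeasureTheory.setIntegral_union Set.Ioc_disjoint_Ioi_same measurableSet_Ioi
        ((hint 1 le_rfl).mono_set Set.Ioc_subset_Ioi_self) (hint t ht)]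
    ring
  have : harmonicLogSum t - (Real.log t ^ 2 / 2 + Real.eulerMascheroniConstant * Real.log t +
      ∫ s in Set.Ioi (1 : ℝ), g s) = -∫ s in Set.Ioi t, g s := by
    rw [← htail, hsum]; ring
  rw [this, abs_neg, ← Real.norm_eq_abs]
  refine (MeasureTheory.norm_integral_le_of_norm_le (hbound t ht) ?_).trans ?_
  · filter_upwards [MeasureTheory.ae_restrict_mem measurableSet_Ioi] with s hs
    exact hgb s (ht.trans (le_of_lt hs))
  · rw [MeasureTheory.integral_const_mul, integral_Ioi_rpow_of_lt (by norm_num) (by linarith)]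
    norm_num
    rw [Real.rpow_neg_one]
    field_simp
    exact le_rfl

/-! ### Sums of the Möbius function and of convolutions -/

/-- Möbius inversion for sums weighted by an arbitrary function `φ`. -/
theorem sum_moebiusDivId_mul_sum_invId (φ : ℕ → ℝ) {N : ℕ} (hN : 1 ≤ N) :
    ∑ d ∈ Ioc 0 N, moebiusDivId d * ∑ k ∈ Ioc 0 (N / d), invId k * φ (d * k) = φ 1 := by
  rw [← sum_Ioc_convolution_mul, moebiusDivId_mul_invId, sum_eq_single 1]
  · simp
  · intro n _ hn
    rw [one_apply, if_neg hn, zero_mul]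
  · intro h
    simp at h
    omega

theorem abs_moebiusDivId_le (n : ℕ) : |moebiusDivId n| ≤ 1 / n := by
  rw [moebiusDivId_apply, abs_div, Nat.abs_cast]
  gcongr
  exact_mod_cast abs_moebius_le_one

/-- The sums of `μ(e) / e` are bounded, by comparing `∑ μ(e) ⌊N / e⌋ = 1` and `N ∑ μ(e) / e`. -/
theorem abs_sum_moebiusDivId_le (N : ℕ) : |∑ e ∈ Ioc 0 N, moebiusDivId e| ≤ 2 := by
  rcases Nat.eq_zero_or_pos N with rfl | hN
  · simp
  have hN' : (0 : ℝ) < N := by exact_mod_cast hN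
  have h1 : ∑ d ∈ Ioc 0 N, (moebius d : ℝ) * ((N / d : ℕ) : ℝ) = 1 := by
    have := sum_moebiusDivId_mul_sum_invId (fun n => (n : ℝ)) hN
    rw [Nat.cast_one] at this
    rw [← this]
    refine sum_congr rfl fun d hd => ?_
    rw [mem_Ioc] at hd
    have hd0 : (d : ℝ) ≠ 0 := by exact_mod_cast hd.1.ne'
    have : ∀ k ∈ Ioc 0 (N / d), invId k * ((d * k : ℕ) : ℝ) = d := by
      intro k hk
      rw [mem_Ioc] at hk
      have hk0 : (k : ℝ) ≠ 0 := by exact_mod_cast hk.1.ne'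
      rw [invId_apply]
      push_cast
      field_simp
    rw [sum_congr rfl this, moebiusDivId_apply]
    simp only [sum_const, Nat.card_Ioc, tsub_zero, nsmul_eq_mul]
    field_simp
  have h2 : |∑ e ∈ Ioc 0 N, moebiusDivId e * N - 1| ≤ N := by
    rw [← h1, ← sum_sub_distrib]
    refine (abs_sum_le_sum_abs _ _).trans ?_
    have : ∀ d ∈ Ioc 0 N, |moebiusDivId d * N - (moebius d : ℝ) * ((N / d : ℕ) : ℝ)| ≤ 1 := by
      intro d hd
      rw [mem_Ioc] at hd
      have hd0 : (0 : ℝ) < d := by exact_mod_cast hd.1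
      have e : moebiusDivId d * N - (moebius d : ℝ) * ((N / d : ℕ) : ℝ) =
          moebius d * ((N : ℝ) / d - ((N / d : ℕ) : ℝ)) := by
        rw [moebiusDivId_apply]; ring
      have h3 : ((N / d : ℕ) : ℝ) ≤ (N : ℝ) / d := Nat.cast_div_le
      have h4 : (N : ℝ) / d < ((N / d : ℕ) : ℝ) + 1 := by
        rw [← Nat.floor_div_eq_div (K := ℝ)]
        exact Nat.lt_floor_add_one _
      have h5 : |(moebius d : ℝ)| ≤ 1 := by exact_mod_cast abs_moebius_le_one
      rw [e, abs_mul]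
      have h6 : |(N : ℝ) / d - ((N / d : ℕ) : ℝ)| ≤ 1 := by
        rw [abs_le]; constructor <;> linarith
      exact mul_le_one₀ h5 (abs_nonneg _) h6
    calc _ ≤ ∑ d ∈ Ioc 0 N, (1 : ℝ) := sum_le_sum this
      _ = N := by simp
  rw [← sum_mul] at h2
  have h3 : |∑ e ∈ Ioc 0 N, moebiusDivId e| * N ≤ 2 * N := by
    rw [← abs_of_pos hN', ← abs_mul, abs_of_pos hN']
    have : (1 : ℝ) ≤ N := by exact_mod_cast hN
    rw [abs_le] at h2 ⊢
    constructor <;> linarith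
  exact le_of_mul_le_mul_right h3 hN'

/-- The sum `∑_{e ≤ t} μ(e) log^j(t / e) / e`. -/
noncomputable def moebiusLogSum (j : ℕ) (t : ℝ) : ℝ :=
  ∑ e ∈ Ioc 0 ⌊t⌋₊, moebiusDivId e * Real.log (t / e) ^ j

theorem moebiusLogSum_of_lt_one (j : ℕ) {t : ℝ} (ht : t < 1) : moebiusLogSum j t = 0 := by
  rw [moebiusLogSum, Nat.floor_eq_zero.mpr ht]; simp

/-- An error term decaying like `1 / s` stays bounded after summation against `μ(e) / e`. -/
theorem sum_moebiusDivId_error_le {t : ℝ} (ht : 1 ≤ t) (ε : ℝ → ℝ)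
    (hε : ∀ s, 1 ≤ s → |ε s| ≤ 2 / s) : |∑ e ∈ Ioc 0 ⌊t⌋₊, moebiusDivId e * ε (t / e)| ≤ 2 := by
  have ht0 : 0 < t := by linarith
  refine (abs_sum_le_sum_abs _ _).trans ?_
  have : ∀ e ∈ Ioc 0 ⌊t⌋₊, |moebiusDivId e * ε (t / e)| ≤ 2 / t := by
    intro e he
    rw [mem_Ioc] at he
    have he0 : (0 : ℝ) < e := by exact_mod_cast he.1
    have het : (e : ℝ) ≤ t := (Nat.le_floor_iff ht0.le).mp he.2
    have h1 := hε (t / e) ((one_le_div he0).mpr het)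
    rw [abs_mul]
    calc _ ≤ 1 / (e : ℝ) * (2 / (t / e)) := by
          gcongr
          exact abs_moebiusDivId_le e
      _ = 2 / t := by field_simp
  calc _ ≤ ∑ e ∈ Ioc 0 ⌊t⌋₊, 2 / t := sum_le_sum this
    _ = ⌊t⌋₊ * (2 / t) := by simp
    _ ≤ t * (2 / t) := by gcongr; exact Nat.floor_le ht0.le
    _ = 2 := by field_simp

/-- Möbius inversion of `∑_{k ≤ t} 1 / k = log t + γ + O(1 / t)`; no form of the prime number
theorem is needed. -/
theorem abs_moebiusLogSum_one_le (t : ℝ) : |moebiusLogSum 1 t| ≤ 6 := by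
  rcases lt_or_ge t 1 with ht | ht
  · rw [moebiusLogSum_of_lt_one 1 ht]; norm_num
  have h1 := sum_moebiusDivId_mul_sum_invId (fun _ => 1) ((Nat.one_le_floor_iff t).mpr ht)
  have h2 := sum_moebiusDivId_error_le ht
    (fun s => harmonicSum s - Real.log s - Real.eulerMascheroniConstant)
    (fun s hs => abs_harmonicSum_sub_le hs)
  have h3 := abs_sum_moebiusDivId_le ⌊t⌋₊
  have h4 : ∑ d ∈ Ioc 0 ⌊t⌋₊, moebiusDivId d * harmonicSum (t / d) = 1 := by
    rw [← h1]
    refine sum_congr rfl fun d _ => ?_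
    rw [harmonicSum, Nat.floor_div_natCast]
    simp
  simp_rw [mul_sub, sum_sub_distrib, h4, ← sum_mul] at h2
  have h5 : moebiusLogSum 1 t = ∑ e ∈ Ioc 0 ⌊t⌋₊, moebiusDivId e * Real.log (t / e) := by
    simp [moebiusLogSum]
  rw [← h5] at h2
  have h6 := Real.eulerMascheroniConstant_lt_two_thirds
  have h7 := Real.one_half_lt_eulerMascheroniConstant
  have h8 : |(∑ e ∈ Ioc 0 ⌊t⌋₊, moebiusDivId e) * Real.eulerMascheroniConstant| ≤ 2 * 1 := by
    rw [abs_mul]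
    gcongr
    rw [abs_le]; constructor <;> linarith
  rw [abs_le] at h2 h8 ⊢
  constructor <;> linarith

/-- Möbius inversion of the asymptotics of `∑_{k ≤ t} log (t / k) / k`, as in Selberg's formula. -/
theorem exists_abs_moebiusLogSum_two_sub_le :
    ∃ A : ℝ, 0 ≤ A ∧ ∀ t : ℝ, 1 ≤ t → |moebiusLogSum 2 t - 2 * Real.log t| ≤ A := by
  obtain ⟨c, hc⟩ := exists_abs_harmonicLogSum_sub_le
  refine ⟨2 * (2 + 6 + 2 * |c|), by positivity, fun t ht => ?_⟩
  have ht0 : 0 < t := by linarith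
  have h1 := sum_moebiusDivId_mul_sum_invId (fun n => Real.log (t / n))
    ((Nat.one_le_floor_iff t).mpr ht)
  have h2 := sum_moebiusDivId_error_le ht
    (fun s => harmonicLogSum s - (Real.log s ^ 2 / 2 + Real.eulerMascheroniConstant * Real.log s +
      c)) hc
  have h3 := abs_sum_moebiusDivId_le ⌊t⌋₊
  have h4 : ∑ d ∈ Ioc 0 ⌊t⌋₊, moebiusDivId d * harmonicLogSum (t / d) = Real.log t := by
    rw [Nat.cast_one, div_one] at h1
    rw [← h1]
    refine sum_congr rfl fun d _ => ?_
    rw [harmonicLogSum, Nat.floor_div_natCast]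
    congr 1
    refine sum_congr rfl fun k _ => ?_
    push_cast
    rw [div_div]
  have h5 := abs_moebiusLogSum_one_le t
  have e1 : ∑ d ∈ Ioc 0 ⌊t⌋₊, moebiusDivId d *
      (harmonicLogSum (t / d) - (Real.log (t / d) ^ 2 / 2 +
        Real.eulerMascheroniConstant * Real.log (t / d) + c)) =
      Real.log t - moebiusLogSum 2 t / 2 - Real.eulerMascheroniConstant * moebiusLogSum 1 t -
        (∑ e ∈ Ioc 0 ⌊t⌋₊, moebiusDivId e) * c := by
    rw [← h4, moebiusLogSum, moebiusLogSum, sum_div, mul_sum, sum_mul, ← sum_sub_distrib,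
      ← sum_sub_distrib, ← sum_sub_distrib]
    refine sum_congr rfl fun d _ => ?_
    ring
  rw [e1] at h2
  have h6 := Real.eulerMascheroniConstant_lt_two_thirds
  have h7 := Real.one_half_lt_eulerMascheroniConstant
  have h8 : |Real.eulerMascheroniConstant * moebiusLogSum 1 t| ≤ 1 * 6 := by
    rw [abs_mul]
    gcongr
    rw [abs_le]; constructor <;> linarith
  have h9 : |(∑ e ∈ Ioc 0 ⌊t⌋₊, moebiusDivId e) * c| ≤ 2 * |c| := by
    rw [abs_mul]; gcongr
  rw [abs_le] at h2 h8 h9 ⊢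
  constructor <;> linarith

/-! ### Convolutions with a rapidly convergent factor -/

theorem natCast_rpow_quarter_ge_one {n : ℕ} (hn : n ≠ 0) : 1 ≤ (n : ℝ) ^ (1 / 4 : ℝ) :=
  Real.one_le_rpow (by exact_mod_cast Nat.one_le_iff_ne_zero.mpr hn) (by norm_num)

theorem abs_le_mul_rpow_quarter (b : ArithmeticFunction ℝ) (n : ℕ) :
    |b n| ≤ |b n| * (n : ℝ) ^ (1 / 4 : ℝ) := by
  rcases eq_or_ne n 0 with rfl | hn
  · simp
  · exact le_mul_of_one_le_right (abs_nonneg _) (natCast_rpow_quarter_ge_one hn)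

theorem abs_mul_log_le (b : ArithmeticFunction ℝ) (n : ℕ) :
    |b n * Real.log n| ≤ 4 * (|b n| * (n : ℝ) ^ (1 / 4 : ℝ)) := by
  have h1 := Real.log_le_rpow_div (Nat.cast_nonneg (α := ℝ) n) (show (0 : ℝ) < 1 / 4 by norm_num)
  have h2 := Real.log_natCast_nonneg n
  rw [abs_mul, abs_of_nonneg h2]
  calc _ ≤ |b n| * ((n : ℝ) ^ (1 / 4 : ℝ) / (1 / 4)) := by gcongr
    _ = _ := by ring

theorem summable_of_summable_mul_rpow {b : ArithmeticFunction ℝ}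
    (hs : Summable fun n : ℕ => |b n| * (n : ℝ) ^ (1 / 4 : ℝ)) :
    Summable (fun n => b n) ∧ Summable fun n : ℕ => b n * Real.log n :=
  ⟨Summable.of_norm_bounded hs fun n => abs_le_mul_rpow_quarter b n,
    Summable.of_norm_bounded (hs.mul_left 4) fun n => abs_mul_log_le b n⟩

/-- A sum of a convolution `b * c` is a series in `b`: `Φ (X / d)` vanishes for `d > X`, so that the
summation over `d` need not be truncated. -/
theorem sum_convolution_eq_tsum (b c : ArithmeticFunction ℝ) (Φ : ℝ → ℝ) (φ : ℝ → ℝ)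
    (hΦ : ∀ t, Φ t = ∑ k ∈ Ioc 0 ⌊t⌋₊, c k * φ (t / k)) (X : ℝ) :
    ∑ n ∈ Ioc 0 ⌊X⌋₊, (b * c) n * φ (X / n) = ∑' d : ℕ, b d * Φ (X / d) := by
  rw [sum_Ioc_convolution_mul, tsum_eq_sum (s := Ioc 0 ⌊X⌋₊)]
  · refine sum_congr rfl fun d _ => ?_
    rw [hΦ, Nat.floor_div_natCast]
    congr 1
    refine sum_congr rfl fun k _ => ?_
    push_cast
    rw [div_div]
  · intro d hd
    rcases Nat.eq_zero_or_pos d with rfl | hd0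
    · simp
    · have : ⌊X⌋₊ < d := by
        by_contra h
        exact hd (mem_Ioc.mpr ⟨hd0, not_lt.mp h⟩)
      rw [hΦ, Nat.floor_div_natCast, Nat.div_eq_of_lt this]
      simp

theorem abs_tsum_le_of_abs_le {f g : ℕ → ℝ} (hg : Summable g) (h : ∀ n, |f n| ≤ g n) :
    |∑' n, f n| ≤ ∑' n, g n := by
  have := tsum_of_norm_bounded (f := f) hg.hasSum fun n => h n
  simpa using this

/-- The sums of `b(n)` convolved with `1 / n` are `(∑ b) log X` plus a constant, with a power
saving. -/
theorem exists_abs_sum_convolution_invId_sub_le {b : ArithmeticFunction ℝ}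
    (hs : Summable fun n : ℕ => |b n| * (n : ℝ) ^ (1 / 4 : ℝ)) :
    ∃ D : ℝ, ∀ X : ℝ, 0 < X →
      |∑ n ∈ Ioc 0 ⌊X⌋₊, (b * invId) n - ((∑' n, b n) * Real.log X + D)| ≤
        5 * (∑' n : ℕ, |b n| * (n : ℝ) ^ (1 / 4 : ℝ)) * X ^ (-(1 / 4) : ℝ) := by
  obtain ⟨h1, h2⟩ := summable_of_summable_mul_rpow hs
  refine ⟨Real.eulerMascheroniConstant * (∑' n, b n) - ∑' n : ℕ, b n * Real.log n, fun X hX => ?_⟩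
  have e0 := sum_convolution_eq_tsum b invId harmonicSum (fun _ => 1)
    (fun t => by simp [harmonicSum]) X
  simp only [mul_one] at e0
  have hbd : ∀ d : ℕ, |b d * harmonicSum (X / d) - (b d * Real.log X +
      (Real.eulerMascheroniConstant * b d - b d * Real.log d))| ≤
      5 * X ^ (-(1 / 4) : ℝ) * (|b d| * (d : ℝ) ^ (1 / 4 : ℝ)) := by
    intro d
    rcases Nat.eq_zero_or_pos d with rfl | hd0
    · simp
    have hd : (0 : ℝ) < d := by exact_mod_cast hd0
    have h3 := abs_harmonicSum_sub_le_rpow (div_pos hX hd)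
    rw [Real.log_div hX.ne' hd.ne', Real.div_rpow hX.le hd.le, Real.rpow_neg hd.le, div_inv_eq_mul]
      at h3
    have e : b d * harmonicSum (X / d) - (b d * Real.log X +
        (Real.eulerMascheroniConstant * b d - b d * Real.log d)) =
        b d * (harmonicSum (X / d) - (Real.log X - Real.log d) - Real.eulerMascheroniConstant) := by
      ring
    rw [e, abs_mul]
    calc _ ≤ |b d| * (5 * (X ^ (-(1 / 4) : ℝ) * (d : ℝ) ^ (1 / 4 : ℝ))) := by gcongr
      _ = _ := by ring
  have hS2 : Summable fun d : ℕ => b d * Real.log X +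
      (Real.eulerMascheroniConstant * b d - b d * Real.log d) :=
    (h1.mul_right _).add ((h1.mul_left _).sub h2)
  have hS1 : Summable fun d : ℕ => b d * harmonicSum (X / d) := by
    have := (Summable.of_norm_bounded (hs.mul_left (5 * X ^ (-(1 / 4) : ℝ))) hbd).add hS2
    refine this.congr fun d => ?_
    ring
  have key := abs_tsum_le_of_abs_le (hs.mul_left (5 * X ^ (-(1 / 4) : ℝ))) hbd
  rw [hS1.tsum_sub hS2, ← e0, (h1.mul_right _).tsum_add ((h1.mul_left _).sub h2),
    (h1.mul_left _).tsum_sub h2, tsum_mul_left, tsum_mul_left, tsum_mul_right] at key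
  refine key.trans (le_of_eq ?_)
  ring

/-- Over an interval `(X, Y]` the constant term cancels, and the error decays in the lower end. -/
theorem abs_sum_convolution_invId_sub_le {b : ArithmeticFunction ℝ}
    (hs : Summable fun n : ℕ => |b n| * (n : ℝ) ^ (1 / 4 : ℝ)) {X Y : ℝ} (hX : 0 < X) (hXY : X ≤ Y) :
    |∑ n ∈ Ioc ⌊X⌋₊ ⌊Y⌋₊, (b * invId) n - (∑' n, b n) * Real.log (Y / X)| ≤
      10 * (∑' n : ℕ, |b n| * (n : ℝ) ^ (1 / 4 : ℝ)) * X ^ (-(1 / 4) : ℝ) := by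
  obtain ⟨D, hD⟩ := exists_abs_sum_convolution_invId_sub_le hs
  have h1 := hD X hX
  have h2 := hD Y (hX.trans_le hXY)
  have hB : 0 ≤ ∑' n : ℕ, |b n| * (n : ℝ) ^ (1 / 4 : ℝ) := tsum_nonneg fun n => by positivity
  have h3 : Y ^ (-(1 / 4) : ℝ) ≤ X ^ (-(1 / 4) : ℝ) :=
    Real.rpow_le_rpow_of_nonpos hX hXY (by norm_num)
  have h4 := mul_le_mul_of_nonneg_left h3 hB
  have h5 := sum_Ioc_consecutive (fun n => (b * invId) n) (Nat.zero_le ⌊X⌋₊) (Nat.floor_le_floor hXY)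
  rw [Real.log_div (hX.trans_le hXY).ne' hX.ne']
  rw [abs_le] at h1 h2 ⊢
  constructor <;> nlinarith

/-- The convolution of `b` with `μ(n) / n` cancels against `log (X / n)`. -/
theorem abs_sum_convolution_moebiusDivId_mul_log_le {b : ArithmeticFunction ℝ}
    (hs : Summable fun n : ℕ => |b n| * (n : ℝ) ^ (1 / 4 : ℝ)) (X : ℝ) :
    |∑ n ∈ Ioc 0 ⌊X⌋₊, (b * moebiusDivId) n * Real.log (X / n)| ≤
      6 * ∑' n : ℕ, |b n| * (n : ℝ) ^ (1 / 4 : ℝ) := by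
  rw [sum_convolution_eq_tsum b moebiusDivId (moebiusLogSum 1) Real.log
    (fun t => by simp [moebiusLogSum]) X, ← tsum_mul_left]
  refine abs_tsum_le_of_abs_le (hs.mul_left 6) fun d => ?_
  rw [abs_mul, mul_comm]
  exact mul_le_mul (abs_moebiusLogSum_one_le _) (abs_le_mul_rpow_quarter b d) (abs_nonneg _)
    (by norm_num)

/-- Against `log² (X / n)`, the convolution of `b` with `μ(n) / n` gives `2 (∑ b) log X + O(1)`. -/
theorem exists_abs_sum_convolution_moebiusDivId_mul_log_sq_sub_le :
    ∃ A : ℝ, 0 ≤ A ∧ ∀ b : ArithmeticFunction ℝ,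
      (Summable fun n : ℕ => |b n| * (n : ℝ) ^ (1 / 4 : ℝ)) → ∀ X : ℝ, 1 ≤ X →
      |∑ n ∈ Ioc 0 ⌊X⌋₊, (b * moebiusDivId) n * Real.log (X / n) ^ 2 -
        2 * (∑' n, b n) * Real.log X| ≤ A * ∑' n : ℕ, |b n| * (n : ℝ) ^ (1 / 4 : ℝ) := by
  obtain ⟨A, hA0, hA⟩ := exists_abs_moebiusLogSum_two_sub_le
  refine ⟨A + 16, by positivity, fun b hs X hX => ?_⟩
  have hX0 : 0 < X := by linarith
  obtain ⟨h1, h2⟩ := summable_of_summable_mul_rpow hs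
  have e0 := sum_convolution_eq_tsum b moebiusDivId (moebiusLogSum 2) (fun t => Real.log t ^ 2)
    (fun t => by simp [moebiusLogSum]) X
  have hbd : ∀ d : ℕ, |b d * moebiusLogSum 2 (X / d) - b d * (2 * Real.log X)| ≤
      (A + 16) * (|b d| * (d : ℝ) ^ (1 / 4 : ℝ)) := by
    intro d
    rcases Nat.eq_zero_or_pos d with rfl | hd0
    · simp
    have hd : (0 : ℝ) < d := by exact_mod_cast hd0
    have h3 : |moebiusLogSum 2 (X / d) - 2 * Real.log (X / d)| ≤
        (A + 8) * (d : ℝ) ^ (1 / 4 : ℝ) := by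
      have hd1 := natCast_rpow_quarter_ge_one hd0.ne'
      rcases lt_or_ge (X / d) 1 with ht | ht
      · rw [moebiusLogSum_of_lt_one 2 ht, zero_sub, abs_neg, abs_mul, abs_two]
        have h4 := abs_log_le_rpow_quarter (div_pos hX0 hd) ht
        rw [Real.div_rpow hX0.le hd.le, Real.rpow_neg hd.le, div_inv_eq_mul] at h4
        have h5 : X ^ (-(1 / 4) : ℝ) ≤ 1 := Real.rpow_le_one_of_one_le_of_nonpos hX (by norm_num)
        have h6 := mul_le_mul_of_nonneg_right h5 (zero_le_one.trans hd1)
        nlinarith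
      · have := hA _ ht
        nlinarith
    have h4 := abs_mul_log_le b d
    have e : b d * moebiusLogSum 2 (X / d) - b d * (2 * Real.log X) =
        b d * (moebiusLogSum 2 (X / d) - 2 * Real.log (X / d)) - 2 * (b d * Real.log d) := by
      rw [Real.log_div hX0.ne' hd.ne']; ring
    rw [e]
    refine (abs_sub _ _).trans ?_
    rw [abs_mul, abs_mul 2, abs_two]
    have h5 := mul_le_mul_of_nonneg_left h3 (abs_nonneg (b d))
    linarith
  have hS2 : Summable fun d : ℕ => b d * (2 * Real.log X) := h1.mul_right _
  have hS1 : Summable fun d : ℕ => b d * moebiusLogSum 2 (X / d) := by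
    refine ((Summable.of_norm_bounded (hs.mul_left (A + 16)) hbd).add hS2).congr fun d => ?_
    ring
  have key := abs_tsum_le_of_abs_le (hs.mul_left (A + 16)) hbd
  rw [hS1.tsum_sub hS2, ← e0, tsum_mul_left, tsum_mul_right] at key
  rwa [show 2 * (∑' n, b n) * Real.log X = (∑' n, b n) * (2 * Real.log X) by ring]

/-! ### Sums of squarefree multiplicative functions in an interval -/

/-- The density constant `∏_{p ∤ q} (1 + u p) (1 - 1/p) ∏_{p ∣ q} (1 - 1/p)` of `sqfMul u` on the
integers coprime to `q`, for `u p` close to `1 / p`. -/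
noncomputable def posConst (u : ℕ → ℝ) (q : ℕ) : ℝ :=
  ∑' n, (sqfMul (awayFrom q u) * moebiusDivId) n

/-- The constant `∏_{p ∤ q} (1 + u p) (1 - 1/p)⁻¹ ∏_{p ∣ q} (1 - 1/p)⁻¹` attached to `sqfMul u` on
the integers coprime to `q`, for `u p` close to `-1 / p`. -/
noncomputable def negConst (u : ℕ → ℝ) (q : ℕ) : ℝ :=
  ∑' n, (sqfMul (awayFrom q u) * invId) n

/-- The factorization used for `u p` close to `1 / p`. -/
theorem sqfMul_awayFrom_eq_mul_invId (u : ℕ → ℝ) (q : ℕ) :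
    sqfMul (awayFrom q u) = (sqfMul (awayFrom q u) * moebiusDivId) * invId := by
  rw [mul_assoc, moebiusDivId_mul_invId, mul_one]

/-- The factorization used for `u p` close to `-1 / p`. -/
theorem sqfMul_awayFrom_eq_mul_moebiusDivId (u : ℕ → ℝ) (q : ℕ) :
    sqfMul (awayFrom q u) = (sqfMul (awayFrom q u) * invId) * moebiusDivId := by
  rw [mul_assoc, mul_comm invId, moebiusDivId_mul_invId, mul_one]

/-- The sum of `sqfMul u` over the integers of `(X, Y]` coprime to `q`, uniformly in `q`, for `u p`
close to `1 / p`. -/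
theorem exists_abs_sum_sqfMul_sub_le {C : ℝ} (hC : 0 ≤ C) {u : ℕ → ℝ} (hu : NearInv 1 C u) :
    ∃ K : ℝ, 0 ≤ K ∧ ∀ q : ℕ, q ≠ 0 → ∀ X Y : ℝ, 0 < X → X ≤ Y →
      |∑ n ∈ Ioc ⌊X⌋₊ ⌊Y⌋₊, sqfMul (awayFrom q u) n - posConst u q * Real.log (Y / X)| ≤
        K * sigmaBound 3 q * X ^ (-(1 / 4) : ℝ) := by
  refine ⟨10 * Real.exp (∑' n : ℕ, (2 * C + 1) * (n : ℝ) ^ (-(3 / 2) : ℝ)), by positivity,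
    fun q hq X Y hX hXY => ?_⟩
  obtain ⟨hs, hb⟩ := summable_moebius_convolution hC hu hq
  have := abs_sum_convolution_invId_sub_le hs hX hXY
  rw [← sqfMul_awayFrom_eq_mul_invId] at this
  exact this.trans (mul_le_mul_of_nonneg_right (by linarith) (by positivity))

/-- For `u p` close to `-1 / p`, the sum of `sqfMul u` against `log (X / n)` is bounded uniformly in
`X`. -/
theorem exists_abs_sum_sqfMul_mul_log_le {C : ℝ} (hC : 0 ≤ C) {u : ℕ → ℝ} (hu : NearInv (-1) C u) :
    ∃ K : ℝ, 0 ≤ K ∧ ∀ q : ℕ, q ≠ 0 → ∀ X : ℝ,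
      |∑ n ∈ Ioc 0 ⌊X⌋₊, sqfMul (awayFrom q u) n * Real.log (X / n)| ≤ K * sigmaBound 3 q := by
  refine ⟨6 * Real.exp (∑' n : ℕ, 3 * C * (n : ℝ) ^ (-(3 / 2) : ℝ)), by positivity,
    fun q hq X => ?_⟩
  obtain ⟨hs, hb⟩ := summable_inv_convolution hC hu hq
  have := abs_sum_convolution_moebiusDivId_mul_log_le hs X
  rw [← sqfMul_awayFrom_eq_mul_moebiusDivId] at this
  linarith

/-- For `u p` close to `-1 / p`, the sum of `sqfMul u` against `log² (X / n)` grows like `log X`. -/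
theorem exists_abs_sum_sqfMul_mul_log_sq_sub_le {C : ℝ} (hC : 0 ≤ C) {u : ℕ → ℝ}
    (hu : NearInv (-1) C u) :
    ∃ K : ℝ, 0 ≤ K ∧ ∀ q : ℕ, q ≠ 0 → ∀ X : ℝ, 1 ≤ X →
      |∑ n ∈ Ioc 0 ⌊X⌋₊, sqfMul (awayFrom q u) n * Real.log (X / n) ^ 2 -
        2 * negConst u q * Real.log X| ≤ K * sigmaBound 3 q := by
  obtain ⟨A, hA0, hA⟩ := exists_abs_sum_convolution_moebiusDivId_mul_log_sq_sub_le
  refine ⟨A * Real.exp (∑' n : ℕ, 3 * C * (n : ℝ) ^ (-(3 / 2) : ℝ)), by positivity,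
    fun q hq X hX => ?_⟩
  obtain ⟨hs, hb⟩ := summable_inv_convolution hC hu hq
  have := hA _ hs X hX
  rw [← sqfMul_awayFrom_eq_mul_moebiusDivId] at this
  refine this.trans ?_
  rw [mul_assoc]
  gcongr

/-- The Euler product of `posConst u q`. -/
theorem hasProd_posConst {C : ℝ} (hC : 0 ≤ C) {u : ℕ → ℝ} (hu : NearInv 1 C u)
    {q : ℕ} (hq : q ≠ 0) :
    HasProd (fun p : Nat.Primes => (1 + awayFrom q u p) * (1 - 1 / (p : ℝ))) (posConst u q) := by
  obtain ⟨hs, -⟩ := summable_moebius_convolution hC hu hq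
  have hb : (sqfMul (awayFrom q u) * moebiusDivId).IsMultiplicative :=
    (sqfMul_isMultiplicative _).mul moebiusDivId_isMultiplicative
  have h := hb.eulerProduct_hasProd (summable_of_summable_mul_rpow hs).1.norm
  refine h.congr_fun ?_
  intro p
  have hp := p.2
  rw [tsum_eq_sum (s := range 3) fun k hk =>
      sqfMul_mul_moebiusDivId_prime_pow_eq_zero _ hp (by simpa using hk),
    sum_range_succ, sum_range_succ, sum_range_one, sqfMul_mul_moebiusDivId_prime _ hp,
    sqfMul_mul_moebiusDivId_prime_sq _ hp, pow_zero, hb.1]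
  ring

/-- The Euler product of `negConst u q`. -/
theorem hasProd_negConst {C : ℝ} (hC : 0 ≤ C) {u : ℕ → ℝ} (hu : NearInv (-1) C u)
    {q : ℕ} (hq : q ≠ 0) :
    HasProd (fun p : Nat.Primes => (1 + awayFrom q u p) * (1 - 1 / (p : ℝ))⁻¹) (negConst u q) := by
  obtain ⟨hs, -⟩ := summable_inv_convolution hC hu hq
  have hb : (sqfMul (awayFrom q u) * invId).IsMultiplicative :=
    (sqfMul_isMultiplicative _).mul invId_isMultiplicative
  have hs1 := (summable_of_summable_mul_rpow hs).1.norm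
  have h := hb.eulerProduct_hasProd hs1
  refine h.congr_fun ?_
  intro p
  have hp := p.2
  obtain ⟨hp0, hp2⟩ := prime_rpow_facts hp
  have hlt : 1 / (p : ℝ) < 1 := by rw [div_lt_one hp0]; linarith
  have hsp : Summable fun k => (sqfMul (awayFrom q u) * invId) ((p : ℕ) ^ k) :=
    (hs1.comp_injective (Nat.pow_right_injective hp.two_le)).of_norm
  rw [hsp.tsum_eq_zero_add]
  simp only [sqfMul_mul_invId_prime_pow_succ _ hp]
  rw [tsum_mul_left, tsum_geometric_of_lt_one (by positivity) hlt, pow_zero, hb.1]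
  have h1 : (p : ℝ) - 1 ≠ 0 := by linarith
  have h2 : 1 - 1 / (p : ℝ) = (p - 1) / p := by field_simp
  rw [h2]
  field_simp
  ring

/-- A finite product over the primes dividing `q`, as an infinite product over all primes. -/
theorem hasProd_ite_dvd (h : ℕ → ℝ) {q : ℕ} (hq : q ≠ 0) :
    HasProd (fun p : Nat.Primes => if (p : ℕ) ∣ q then h p else 1) (∏ p ∈ q.primeFactors, h p) := by
  classical
  have e : ∏ p ∈ q.primeFactors, h p = ∏ p ∈ q.primeFactors.subtype Nat.Prime,
      (fun p : Nat.Primes => if (p : ℕ) ∣ q then h p else 1) p := by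
    rw [prod_subtype_of_mem (s := q.primeFactors) (f := fun p : ℕ => if p ∣ q then h p else 1)]
    · refine prod_congr rfl fun p hp => ?_
      rw [if_pos (Nat.dvd_of_mem_primeFactors hp)]
    · exact fun p hp => Nat.prime_of_mem_primeFactors hp
  rw [e]
  refine hasProd_prod_of_ne_finset_one fun p hp => if_neg fun hpq => hp ?_
  exact mem_subtype.mpr (Nat.mem_primeFactors.mpr ⟨p.2, hpq, hq⟩)

theorem awayFrom_one_prime (u : ℕ → ℝ) {p : ℕ} (hp : p.Prime) : awayFrom 1 u p = u p := by
  rw [awayFrom, if_neg hp.not_dvd_one]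

theorem one_add_awayFrom (u : ℕ → ℝ) {q p : ℕ} (hp : 1 + u p ≠ 0) :
    1 + awayFrom q u p = (1 + u p) * if p ∣ q then (1 + u p)⁻¹ else 1 := by
  rw [awayFrom]
  split_ifs
  · rw [mul_inv_cancel₀ hp, add_zero]
  · rw [mul_one]

/-- The dependence on `q` is a multiplicative factor, which can be absorbed in the weights of the
variables making up `q`. -/
theorem posConst_eq {C : ℝ} (hC : 0 ≤ C) {u : ℕ → ℝ} (hu : NearInv 1 C u)
    (hu0 : ∀ p, p.Prime → 1 + u p ≠ 0) {q : ℕ} (hq : q ≠ 0) :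
    posConst u q = posConst u 1 * ∏ p ∈ q.primeFactors, (1 + u p)⁻¹ := by
  have h1 := (hasProd_posConst hC hu one_ne_zero).mul (hasProd_ite_dvd (fun p => (1 + u p)⁻¹) hq)
  refine (hasProd_posConst hC hu hq).unique (h1.congr_fun fun p => ?_)
  rw [one_add_awayFrom u (hu0 p p.2), awayFrom_one_prime u p.2]
  ring

/-- The dependence on `q` is a multiplicative factor, as in `posConst_eq`. -/
theorem negConst_eq {C : ℝ} (hC : 0 ≤ C) {u : ℕ → ℝ} (hu : NearInv (-1) C u)
    (hu0 : ∀ p, p.Prime → 1 + u p ≠ 0) {q : ℕ} (hq : q ≠ 0) :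
    negConst u q = negConst u 1 * ∏ p ∈ q.primeFactors, (1 + u p)⁻¹ := by
  have h1 := (hasProd_negConst hC hu one_ne_zero).mul (hasProd_ite_dvd (fun p => (1 + u p)⁻¹) hq)
  refine (hasProd_negConst hC hu hq).unique (h1.congr_fun fun p => ?_)
  rw [one_add_awayFrom u (hu0 p p.2), awayFrom_one_prime u p.2]
  ring

/-! ### Majorants of multiplicative functions -/

/-- The majorant `1 / p + C p^{-7/4}` for the values at the primes of the multiplicative functions
under consideration. -/
noncomputable def primeMajorant (C : ℝ) (p : ℕ) : ℝ := 1 / p + C * (p : ℝ) ^ (-(7 / 4) : ℝ)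

theorem primeMajorant_nonneg {C : ℝ} (hC : 0 ≤ C) (p : ℕ) : 0 ≤ primeMajorant C p := by
  rw [primeMajorant]; positivity

theorem nearInv_primeMajorant (C : ℝ) (hC : 0 ≤ C) : NearInv 1 C (primeMajorant C) := by
  intro p _
  rw [primeMajorant, add_sub_cancel_left, abs_of_nonneg (by positivity)]

/-- The factors of `sigmaBound c` are absorbed in the majorant. -/
theorem primeMajorant_mul_le {C c : ℝ} (hC : 0 ≤ C) (hc : 0 ≤ c) {p : ℕ} (hp : p.Prime) :
    primeMajorant C p * (1 + c * (p : ℝ) ^ (-(3 / 4) : ℝ)) ≤ primeMajorant (C + c + c * C) p := by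
  obtain ⟨hp0, hp2⟩ := prime_rpow_facts hp
  have h1 : 1 / (p : ℝ) * (p : ℝ) ^ (-(3 / 4) : ℝ) = (p : ℝ) ^ (-(7 / 4) : ℝ) := by
    rw [one_div, ← Real.rpow_neg_one, ← Real.rpow_add hp0]; norm_num
  have h2 : (p : ℝ) ^ (-(3 / 4) : ℝ) ≤ 1 :=
    Real.rpow_le_one_of_one_le_of_nonpos (by linarith) (by norm_num)
  have h3 : c * C * (p : ℝ) ^ (-(7 / 4) : ℝ) * (p : ℝ) ^ (-(3 / 4) : ℝ) ≤
      c * C * (p : ℝ) ^ (-(7 / 4) : ℝ) := mul_le_of_le_one_right (by positivity) h2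
  have h4 : primeMajorant C p * (1 + c * (p : ℝ) ^ (-(3 / 4) : ℝ)) = 1 / p +
      C * (p : ℝ) ^ (-(7 / 4) : ℝ) + c * (1 / p * (p : ℝ) ^ (-(3 / 4) : ℝ)) +
      c * C * (p : ℝ) ^ (-(7 / 4) : ℝ) * (p : ℝ) ^ (-(3 / 4) : ℝ) := by
    rw [primeMajorant]; ring
  rw [h4, h1, primeMajorant]
  linarith

theorem sqfMul_mul_prod (u h : ℕ → ℝ) (n : ℕ) :
    sqfMul u n * ∏ p ∈ n.primeFactors, h p = sqfMul (fun p => u p * h p) n := by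
  simp only [sqfMul_apply]
  split_ifs
  · rw [prod_mul_distrib]
  · rw [zero_mul]

/-- `|u p| ≤ 1 / p + C p^{-7/4}` at all primes, so that `sqfMul u` is of size at most `1 / n` on
average. -/
def PrimeBounded (C : ℝ) (u : ℕ → ℝ) : Prop := ∀ p, p.Prime → |u p| ≤ primeMajorant C p

theorem NearInv.primeBounded {s C : ℝ} (hs : |s| ≤ 1) {u : ℕ → ℝ} (hu : NearInv s C u) :
    PrimeBounded C u := by
  intro p hp
  refine (nearInv_abs_le hu hp).trans ?_
  rw [primeMajorant]
  gcongr

theorem abs_sqfMul_le {C : ℝ} {u : ℕ → ℝ} (hu : PrimeBounded C u) (n : ℕ) :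
    |sqfMul u n| ≤ sqfMul (primeMajorant C) n := by
  rw [abs_sqfMul]
  exact sqfMul_mono n (fun p _ => abs_nonneg _) hu

theorem abs_sqfMul_mul_sigmaBound_le {C c : ℝ} (hC : 0 ≤ C) (hc : 0 ≤ c) {u : ℕ → ℝ}
    (hu : PrimeBounded C u) (n : ℕ) :
    |sqfMul u n| * sigmaBound c n ≤ sqfMul (primeMajorant (C + c + c * C)) n := by
  refine (mul_le_mul_of_nonneg_right (abs_sqfMul_le hu n)
    (zero_le_one.trans (one_le_sigmaBound hc n))).trans ?_
  rw [sigmaBound, sqfMul_mul_prod]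
  exact sqfMul_mono n
    (fun p _ => mul_nonneg (primeMajorant_nonneg hC p) (by positivity))
    fun p hp => primeMajorant_mul_le hC hc hp

theorem exists_sum_sqfMul_primeMajorant_le {C : ℝ} (hC : 0 ≤ C) :
    ∃ K : ℝ, 0 ≤ K ∧ ∀ N : ℕ, 1 ≤ N →
      ∑ n ∈ Ioc 0 N, sqfMul (primeMajorant C) n ≤ K * (1 + Real.log N) := by
  obtain ⟨K, hK0, hK⟩ := exists_abs_sum_sqfMul_sub_le hC (nearInv_primeMajorant C hC)
  refine ⟨1 + K * sigmaBound 3 1 + |posConst (primeMajorant C) 1|, ?_, fun N hN => ?_⟩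
  · have := one_le_sigmaBound (c := 3) (by norm_num) 1
    positivity
  have h := hK 1 one_ne_zero 1 N one_pos (by exact_mod_cast hN)
  rw [Nat.floor_one, Nat.floor_natCast, Real.one_rpow, mul_one, div_one] at h
  have hsplit := sum_Ioc_consecutive (fun n => sqfMul (primeMajorant C) n) (Nat.zero_le 1) hN
  have h1 : ∑ n ∈ Ioc 0 1, sqfMul (primeMajorant C) n = 1 := by simp [sqfMul_one]
  have h2 : ∑ n ∈ Ioc 1 N, sqfMul (awayFrom 1 (primeMajorant C)) n =
      ∑ n ∈ Ioc 1 N, sqfMul (primeMajorant C) n :=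
    sum_congr rfl fun n _ => by rw [sqfMul_awayFrom, if_pos (Nat.coprime_one_right n)]
  rw [h2] at h
  have hl : 0 ≤ Real.log N := Real.log_natCast_nonneg N
  have h3 := le_abs_self (posConst (primeMajorant C) 1)
  have h4 : 0 ≤ |posConst (primeMajorant C) 1| := abs_nonneg _
  have h5 : 0 ≤ K * sigmaBound 3 1 :=
    mul_nonneg hK0 (zero_le_one.trans (one_le_sigmaBound (by norm_num) 1))
  rw [abs_le] at h
  nlinarith [mul_nonneg h5 hl, mul_le_mul_of_nonneg_right h3 hl]

/-- Any negative power of `n` makes the sum of the majorants converge. -/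
theorem exists_sum_sqfMul_primeMajorant_mul_rpow_le {C : ℝ} (hC : 0 ≤ C) :
    ∃ K : ℝ, 0 ≤ K ∧ ∀ N : ℕ,
      ∑ n ∈ Ioc 0 N, sqfMul (primeMajorant C) n * (n : ℝ) ^ (-(1 / 8) : ℝ) ≤ K := by
  have hz : ∀ p : ℕ, p.Prime → ∀ k ∉ range 2,
      sqfMul (primeMajorant C) (p ^ k) * ((p ^ k : ℕ) : ℝ) ^ (-(1 / 8) : ℝ) = 0 := by
    intro p hp k hk
    rw [sqfMul_prime_pow_eq_zero _ hp (Nat.succ_le_of_lt (by simpa using hk)), zero_mul]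
  have hnn : ∀ n : ℕ, 0 ≤ sqfMul (primeMajorant C) n * (n : ℝ) ^ (-(1 / 8) : ℝ) := fun n =>
    mul_nonneg (sqfMul_nonneg n fun p _ => primeMajorant_nonneg hC p) (by positivity)
  obtain ⟨h1, -⟩ := summable_of_sum_prime_pow_le
    (f := fun n : ℕ => sqfMul (primeMajorant C) n * (n : ℝ) ^ (-(1 / 8) : ℝ)) hnn (by simp)
    (by simp [sqfMul_one])
    (fun {m n} h => by
      rw [sqfMul_mul _ h, Nat.cast_mul, Real.mul_rpow (by positivity) (by positivity)]; ring)
    (δ := fun n : ℕ => (1 + C) * (n : ℝ) ^ (-(9 / 8) : ℝ)) (fun n => by positivity)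
    ((summable_natCast_rpow_neg (by norm_num)).mul_left _) ∅ (h := fun _ => 1) (fun _ => le_rfl)
    (fun p hp => summable_of_ne_finset_zero (hz p hp)) (fun p hp => by
      obtain ⟨hp0, hp2⟩ := prime_rpow_facts hp
      rw [tsum_eq_sum (hz p hp), sum_range_succ, sum_range_one, pow_zero, pow_one, sqfMul_one,
        sqfMul_prime _ hp, primeMajorant]
      simp only [Nat.cast_one, Real.one_rpow, mul_one, notMem_empty, if_false]
      have e1 : 1 / (p : ℝ) * (p : ℝ) ^ (-(1 / 8) : ℝ) = (p : ℝ) ^ (-(9 / 8) : ℝ) := by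
        rw [one_div, ← Real.rpow_neg_one, ← Real.rpow_add hp0]; norm_num
      have e2 : (p : ℝ) ^ (-(7 / 4) : ℝ) * (p : ℝ) ^ (-(1 / 8) : ℝ) ≤
          (p : ℝ) ^ (-(9 / 8) : ℝ) := by
        rw [← Real.rpow_add hp0]
        exact Real.rpow_le_rpow_of_exponent_le (by linarith) (by norm_num)
      have := mul_le_mul_of_nonneg_left e2 hC
      linarith [add_mul (1 / (p : ℝ)) (C * (p : ℝ) ^ (-(7 / 4) : ℝ)) ((p : ℝ) ^ (-(1 / 8) : ℝ))])
  exact ⟨_, tsum_nonneg hnn, fun N => h1.sum_le_tsum _ fun n _ => hnn n⟩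

theorem exists_sum_abs_sqfMul_mul_sigmaBound_le {C : ℝ} (hC : 0 ≤ C) {u : ℕ → ℝ}
    (hu : PrimeBounded C u) :
    ∃ K : ℝ, 0 ≤ K ∧ ∀ N : ℕ, 1 ≤ N →
      ∑ n ∈ Ioc 0 N, |sqfMul u n| * sigmaBound 3 n ≤ K * (1 + Real.log N) := by
  obtain ⟨K, hK0, hK⟩ := exists_sum_sqfMul_primeMajorant_le (C := C + 3 + 3 * C) (by positivity)
  exact ⟨K, hK0, fun N hN => (sum_le_sum fun n _ =>
    abs_sqfMul_mul_sigmaBound_le hC (by norm_num) hu n).trans (hK N hN)⟩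

theorem exists_sum_abs_sqfMul_mul_sigmaBound_mul_rpow_le {C : ℝ} (hC : 0 ≤ C) {u : ℕ → ℝ}
    (hu : PrimeBounded C u) :
    ∃ K : ℝ, 0 ≤ K ∧ ∀ N : ℕ,
      ∑ n ∈ Ioc 0 N, |sqfMul u n| * sigmaBound 3 n * (n : ℝ) ^ (-(1 / 8) : ℝ) ≤ K := by
  obtain ⟨K, hK0, hK⟩ := exists_sum_sqfMul_primeMajorant_mul_rpow_le (C := C + 3 + 3 * C)
    (by positivity)
  exact ⟨K, hK0, fun N => (sum_le_sum fun n _ => mul_le_mul_of_nonneg_right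
    (abs_sqfMul_mul_sigmaBound_le hC (by norm_num) hu n) (by positivity)).trans (hK N)⟩

/-- The weights below differ from `± 1 / p` by `O(p^{-2})`. -/
theorem nearInv_of_abs_le {s C : ℝ} (hC : 0 ≤ C) {u : ℕ → ℝ}
    (h : ∀ p : ℕ, p.Prime → |u p - s / p| ≤ C / (p : ℝ) ^ 2) : NearInv s C u := by
  intro p hp
  obtain ⟨hp0, hp2⟩ := prime_rpow_facts hp
  refine (h p hp).trans ?_
  rw [div_eq_mul_inv]
  gcongr
  rw [← Real.rpow_natCast, ← Real.rpow_neg hp0.le]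
  exact Real.rpow_le_rpow_of_exponent_le (by linarith) (by norm_num)

/-! ### The multiplicative functions of the third moment -/

/-- Prime values of `μ²(n) / φ(n)`. -/
noncomputable def phiInv (p : ℕ) : ℝ := 1 / ((p : ℝ) - 1)

/-- Prime values of the weight of the common part of three moduli. -/
noncomputable def tripleWeight (p : ℕ) : ℝ := -((p : ℝ) - 2) / ((p : ℝ) - 1) ^ 2

/-- `tripleWeight p * (1 - 1 / p)`. -/
noncomputable def tripleWeight₁ (p : ℕ) : ℝ := tripleWeight p * (1 + phiInv p)⁻¹

/-- `tripleWeight p * (1 - 1 / p) * (1 + 1 / p)⁻¹`. -/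
noncomputable def tripleWeight₂ (p : ℕ) : ℝ := tripleWeight₁ p * (1 + 1 / (p : ℝ))⁻¹

/-- `1 / (p + 1)`. -/
noncomputable def psiInv (p : ℕ) : ℝ := 1 / (p : ℝ) * (1 + 1 / (p : ℝ))⁻¹

/-- The weight of the smallest variable after the summation over the other ones. -/
noncomputable def lastWeight (p : ℕ) : ℝ := psiInv p * (1 + tripleWeight₂ p)⁻¹

theorem one_add_phiInv {p : ℕ} (hp : p.Prime) : (1 + phiInv p)⁻¹ = 1 - 1 / p := by
  obtain ⟨hp0, hp2⟩ := prime_rpow_facts hp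
  have : (p : ℝ) - 1 ≠ 0 := by linarith
  have h : 1 + phiInv p = p / (p - 1) := by rw [phiInv]; field_simp; ring
  rw [h, inv_div]
  field_simp

theorem phiInv_mul {p : ℕ} (hp : p.Prime) : phiInv p * (1 + phiInv p)⁻¹ = 1 / p := by
  obtain ⟨hp0, hp2⟩ := prime_rpow_facts hp
  have : (p : ℝ) - 1 ≠ 0 := by linarith
  rw [one_add_phiInv hp, phiInv]
  field_simp

theorem tripleWeight₁_eq {p : ℕ} (hp : p.Prime) :
    tripleWeight₁ p = -((p : ℝ) - 2) / (p * (p - 1)) := by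
  obtain ⟨hp0, hp2⟩ := prime_rpow_facts hp
  have : (p : ℝ) - 1 ≠ 0 := by linarith
  rw [tripleWeight₁, one_add_phiInv hp, tripleWeight]
  field_simp

theorem tripleWeight₂_eq {p : ℕ} (hp : p.Prime) :
    tripleWeight₂ p = -((p : ℝ) - 2) / ((p - 1) * (p + 1)) := by
  obtain ⟨hp0, hp2⟩ := prime_rpow_facts hp
  have : (p : ℝ) - 1 ≠ 0 := by linarith
  have h1 : 1 + 1 / (p : ℝ) = (p + 1) / p := by field_simp
  rw [tripleWeight₂, tripleWeight₁_eq hp, h1, inv_div]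
  field_simp

theorem psiInv_eq {p : ℕ} (hp : p.Prime) : psiInv p = 1 / ((p : ℝ) + 1) := by
  obtain ⟨hp0, hp2⟩ := prime_rpow_facts hp
  have h1 : 1 + 1 / (p : ℝ) = (p + 1) / p := by field_simp
  rw [psiInv, h1, inv_div]
  field_simp

theorem one_add_tripleWeight₂ {p : ℕ} (hp : p.Prime) :
    1 + tripleWeight₂ p = ((p : ℝ) ^ 2 - p + 1) / ((p - 1) * (p + 1)) := by
  obtain ⟨hp0, hp2⟩ := prime_rpow_facts hp
  have : (p : ℝ) - 1 ≠ 0 := by linarith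
  rw [tripleWeight₂_eq hp]
  field_simp
  ring

theorem sq_sub_add_one_pos {p : ℕ} (hp : p.Prime) : 0 < (p : ℝ) ^ 2 - p + 1 := by
  obtain ⟨hp0, hp2⟩ := prime_rpow_facts hp
  nlinarith

theorem one_add_tripleWeight₂_pos {p : ℕ} (hp : p.Prime) : 0 < 1 + tripleWeight₂ p := by
  obtain ⟨hp0, hp2⟩ := prime_rpow_facts hp
  rw [one_add_tripleWeight₂ hp]
  have := sq_sub_add_one_pos hp
  have : 0 < (p : ℝ) - 1 := by linarith
  positivity

theorem lastWeight_eq {p : ℕ} (hp : p.Prime) :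
    lastWeight p = ((p : ℝ) - 1) / ((p : ℝ) ^ 2 - p + 1) := by
  obtain ⟨hp0, hp2⟩ := prime_rpow_facts hp
  have := (sq_sub_add_one_pos hp).ne'
  have : (p : ℝ) - 1 ≠ 0 := by linarith
  rw [lastWeight, psiInv_eq hp, one_add_tripleWeight₂ hp, inv_div]
  field_simp

theorem nearInv_phiInv : NearInv 1 2 phiInv := by
  refine nearInv_of_abs_le (by norm_num) fun p hp => ?_
  obtain ⟨hp0, hp2⟩ := prime_rpow_facts hp
  have h1 : 0 < (p : ℝ) - 1 := by linarith
  have e : phiInv p - 1 / p = 1 / (p * (p - 1)) := by rw [phiInv]; field_simp; ring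
  rw [e, abs_of_pos (by positivity), div_le_div_iff₀ (by positivity) (by positivity)]
  nlinarith

theorem nearInv_inv : NearInv 1 0 (fun p : ℕ => 1 / (p : ℝ)) := by
  intro p _
  simp

theorem nearInv_tripleWeight : NearInv (-1) 2 tripleWeight := by
  refine nearInv_of_abs_le (by norm_num) fun p hp => ?_
  obtain ⟨hp0, hp2⟩ := prime_rpow_facts hp
  have h1 : 0 < (p : ℝ) - 1 := by linarith
  have e : tripleWeight p - -1 / p = 1 / (p * (p - 1) ^ 2) := by
    rw [tripleWeight]; field_simp; ring
  rw [e, abs_of_pos (by positivity), div_le_div_iff₀ (by positivity) (by positivity)]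
  nlinarith [mul_nonneg hp0.le (sq_nonneg ((p : ℝ) - 2))]

theorem nearInv_tripleWeight₁ : NearInv (-1) 2 tripleWeight₁ := by
  refine nearInv_of_abs_le (by norm_num) fun p hp => ?_
  obtain ⟨hp0, hp2⟩ := prime_rpow_facts hp
  have h1 : 0 < (p : ℝ) - 1 := by linarith
  have e : tripleWeight₁ p - -1 / p = 1 / (p * (p - 1)) := by
    rw [tripleWeight₁_eq hp]; field_simp; ring
  rw [e, abs_of_pos (by positivity), div_le_div_iff₀ (by positivity) (by positivity)]
  nlinarith

theorem nearInv_tripleWeight₂ : NearInv (-1) 3 tripleWeight₂ := by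
  refine nearInv_of_abs_le (by norm_num) fun p hp => ?_
  obtain ⟨hp0, hp2⟩ := prime_rpow_facts hp
  have h1 : 0 < (p : ℝ) - 1 := by linarith
  have h2 : 0 < 2 * (p : ℝ) - 1 := by linarith
  have e : tripleWeight₂ p - -1 / p = (2 * p - 1) / (p * ((p - 1) * (p + 1))) := by
    rw [tripleWeight₂_eq hp]; field_simp; ring
  rw [e, abs_of_pos (by positivity), div_le_div_iff₀ (by positivity) (by positivity)]
  nlinarith [mul_nonneg hp0.le (sq_nonneg ((p : ℝ) - 2)), mul_pos hp0 h1, mul_pos hp0 hp0]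

theorem nearInv_psiInv : NearInv 1 1 psiInv := by
  refine nearInv_of_abs_le (by norm_num) fun p hp => ?_
  obtain ⟨hp0, hp2⟩ := prime_rpow_facts hp
  have e : psiInv p - 1 / p = -(1 / (p * (p + 1))) := by
    rw [psiInv_eq hp]; field_simp; ring
  rw [e, abs_neg, abs_of_pos (by positivity), div_le_div_iff₀ (by positivity) (by positivity)]
  nlinarith

theorem nearInv_lastWeight : NearInv 1 1 lastWeight := by
  refine nearInv_of_abs_le (by norm_num) fun p hp => ?_
  obtain ⟨hp0, hp2⟩ := prime_rpow_facts hp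
  have h0 := sq_sub_add_one_pos hp
  have e : lastWeight p - 1 / p = -(1 / (p * ((p : ℝ) ^ 2 - p + 1))) := by
    rw [lastWeight_eq hp]
    have := h0.ne'
    rw [div_sub_div _ _ this hp0.ne', ← neg_div, div_eq_div_iff (by positivity) (by positivity)]
    ring
  rw [e, abs_neg, abs_of_pos (by positivity), div_le_div_iff₀ (by positivity) (by positivity)]
  nlinarith [mul_pos hp0 hp0]

/-- All Euler factors are `(1 + 1 / (p - 1)) (1 - 1 / p) = 1`. -/
theorem posConst_phiInv_one : posConst phiInv 1 = 1 := by
  have h := hasProd_posConst (by norm_num) nearInv_phiInv one_ne_zero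
  refine h.unique ((hasProd_one (α := ℝ) (β := Nat.Primes)).congr_fun fun p => ?_)
  have hp := p.2
  rw [awayFrom_one_prime _ hp, ← one_add_phiInv hp]
  refine mul_inv_cancel₀ ?_
  obtain ⟨hp0, hp2⟩ := prime_rpow_facts hp
  have : 0 < (p : ℝ) - 1 := by linarith
  rw [phiInv]
  positivity

/-- The three densities produced by the successive summations multiply to `1`. -/
theorem posConst_mul_negConst_mul_posConst :
    posConst (fun p : ℕ => 1 / (p : ℝ)) 1 * negConst tripleWeight₂ 1 * posConst lastWeight 1 = 1 := by
  have h1 := hasProd_posConst le_rfl nearInv_inv one_ne_zero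
  have h2 := hasProd_negConst (by norm_num) nearInv_tripleWeight₂ one_ne_zero
  have h3 := hasProd_posConst (by norm_num) nearInv_lastWeight one_ne_zero
  refine ((h1.mul h2).mul h3).unique ((hasProd_one (α := ℝ) (β := Nat.Primes)).congr_fun fun p => ?_)
  have hp := p.2
  obtain ⟨hp0, hp2⟩ := prime_rpow_facts hp
  have h4 := (sq_sub_add_one_pos hp).ne'
  have h5 : (p : ℝ) - 1 ≠ 0 := by linarith
  have h6 : 1 - 1 / (p : ℝ) = (p - 1) / p := by field_simp
  have h7 : 1 + 1 / (p : ℝ) = (p + 1) / p := by field_simp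
  have h8 : 1 + lastWeight p = p ^ 2 / ((p : ℝ) ^ 2 - p + 1) := by
    rw [lastWeight_eq hp, eq_div_iff h4, add_mul, div_mul_cancel₀ _ h4]
    ring
  rw [awayFrom_one_prime _ hp, awayFrom_one_prime _ hp, awayFrom_one_prime _ hp,
    one_add_tripleWeight₂ hp, h8, h6, h7]
  have h9 : (p : ℝ) * (p - 1) + 1 ≠ 0 := by
    have := mul_pos hp0 (by linarith : (0 : ℝ) < (p : ℝ) - 1)
    linarith
  field_simp

/-! ### Summation over one variable -/

theorem sum_ite_mul_le_eq_sum_Ioc (f : ℕ → ℝ) {a : ℕ} (ha : 1 ≤ a) (R : ℕ) :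
    ∑ e ∈ Ioc 0 R, (if a * e ≤ R then f e else 0) = ∑ e ∈ Ioc 0 (R / a), f e := by
  rw [← sum_filter]
  refine sum_congr ?_ fun _ _ => rfl
  ext e
  rw [mem_filter, mem_Ioc, mem_Ioc, Nat.le_div_iff_mul_le ha, mul_comm e a]
  constructor
  · rintro ⟨⟨h1, -⟩, h2⟩
    exact ⟨h1, h2⟩
  · rintro ⟨h1, h2⟩
    exact ⟨⟨h1, (Nat.le_mul_of_pos_left e ha).trans h2⟩, h2⟩

theorem log_div_natCast_le {R a : ℕ} (hR : 1 ≤ R) (ha : 1 ≤ a) :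
    Real.log ((R : ℝ) / a) ≤ Real.log R := by
  have h1 : (1 : ℝ) ≤ R := by exact_mod_cast hR
  have h2 : (1 : ℝ) ≤ a := by exact_mod_cast ha
  apply Real.log_le_log (by positivity)
  exact div_le_self (by positivity) h2

/-- The sum over the largest variable `x`, subject to `y < x` and `x y e ≤ R`. Its main term is `log
(R / (y² e))`. -/
theorem exists_abs_sum_Ioc_sub_le :
    ∃ K : ℝ, 0 ≤ K ∧ ∀ q y e R : ℕ, q ≠ 0 → 1 ≤ y → 1 ≤ e →
      |∑ x ∈ Ioc y (R / (y * e)), sqfMul (awayFrom q phiInv) x -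
        (if y * y * e ≤ R then posConst phiInv q * Real.log (R / ((y : ℝ) * y * e)) else 0)| ≤
        K * sigmaBound 3 q * (y : ℝ) ^ (-(1 / 4) : ℝ) := by
  obtain ⟨K, hK0, hK⟩ := exists_abs_sum_sqfMul_sub_le (by norm_num) nearInv_phiInv
  refine ⟨K, hK0, fun q y e R hq hy he => ?_⟩
  have hy0 : (0 : ℝ) < y := by exact_mod_cast hy
  have he0 : (0 : ℝ) < e := by exact_mod_cast he
  split_ifs with h
  · have h' : (y : ℝ) * y * e ≤ R := by exact_mod_cast h
    have hle : (y : ℝ) ≤ (R : ℝ) / ((y * e : ℕ) : ℝ) := by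
      push_cast
      rw [le_div_iff₀ (by positivity)]
      linarith
    have := hK q hq y ((R : ℝ) / ((y * e : ℕ) : ℝ)) hy0 hle
    rw [Nat.floor_natCast, Nat.floor_div_eq_div] at this
    have e1 : (R : ℝ) / ((y * e : ℕ) : ℝ) / y = R / ((y : ℝ) * y * e) := by
      push_cast
      rw [div_div]
      congr 1
      ring
    rwa [e1] at this
  · have : R / (y * e) ≤ y := by
      rw [Nat.div_le_iff_le_mul_add_pred (by positivity)]
      push Not at h
      nlinarith
    rw [Ioc_eq_empty_of_le this, sum_empty, sub_zero, abs_zero]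
    have := one_le_sigmaBound (c := 3) (by norm_num) q
    positivity

/-- The sum over `e` cancels against a first power of the logarithm. -/
theorem exists_abs_sum_ite_mul_log_le :
    ∃ K : ℝ, 0 ≤ K ∧ ∀ q a R : ℕ, q ≠ 0 → 1 ≤ a →
      |∑ e ∈ Ioc 0 R, (if a * e ≤ R then
        sqfMul (awayFrom q tripleWeight₁) e * Real.log (R / ((a : ℝ) * e)) else 0)| ≤
        K * sigmaBound 3 q := by
  obtain ⟨K, hK0, hK⟩ := exists_abs_sum_sqfMul_mul_log_le (by norm_num) nearInv_tripleWeight₁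
  refine ⟨K, hK0, fun q a R hq ha => ?_⟩
  rw [sum_ite_mul_le_eq_sum_Ioc (fun e => sqfMul (awayFrom q tripleWeight₁) e *
    Real.log (R / ((a : ℝ) * e))) ha]
  have := hK q hq ((R : ℝ) / a)
  rw [Nat.floor_div_eq_div] at this
  simpa only [div_div] using this

/-- The sum over `e` turns the square of a logarithm into twice its first power. -/
theorem exists_abs_sum_ite_mul_log_sq_sub_le :
    ∃ K : ℝ, 0 ≤ K ∧ ∀ q a R : ℕ, q ≠ 0 → 1 ≤ a →
      |∑ e ∈ Ioc 0 R, (if a * e ≤ R then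
        sqfMul (awayFrom q tripleWeight₂) e * Real.log (R / ((a : ℝ) * e)) ^ 2 else 0) -
        (if a ≤ R then 2 * negConst tripleWeight₂ q * Real.log (R / (a : ℝ)) else 0)| ≤
        K * sigmaBound 3 q := by
  obtain ⟨K, hK0, hK⟩ := exists_abs_sum_sqfMul_mul_log_sq_sub_le (by norm_num) nearInv_tripleWeight₂
  refine ⟨K, hK0, fun q a R hq ha => ?_⟩
  rw [sum_ite_mul_le_eq_sum_Ioc (fun e => sqfMul (awayFrom q tripleWeight₂) e *
    Real.log (R / ((a : ℝ) * e)) ^ 2) ha]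
  have ha0 : (0 : ℝ) < a := by exact_mod_cast ha
  split_ifs with h
  · have := hK q hq ((R : ℝ) / a) ((one_le_div ha0).mpr (by exact_mod_cast h))
    rw [Nat.floor_div_eq_div] at this
    simpa only [div_div] using this
  · rw [Nat.div_eq_of_lt (not_le.mp h)]
    have := one_le_sigmaBound (c := 3) (by norm_num) q
    simp
    positivity

/-- The sum over a variable `y > z` subject to `y² e ≤ R`, by partial summation. With `Y² = R / e`
the logarithm is `2 log (Y / y)`, whence the constant `1 / 4`. -/
theorem exists_abs_sum_ite_sq_mul_log_sub_le {C : ℝ} (hC : 0 ≤ C) {u : ℕ → ℝ}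
    (hu : NearInv 1 C u) :
    ∃ K : ℝ, 0 ≤ K ∧ ∀ q z e R : ℕ, q ≠ 0 → 1 ≤ z → 1 ≤ e → 1 ≤ R →
      |∑ y ∈ Ioc 0 R, (if z < y ∧ y * y * e ≤ R then
        sqfMul (awayFrom q u) y * Real.log (R / ((y : ℝ) * y * e)) else 0) -
        (if z * z * e ≤ R then
          posConst u q / 4 * Real.log (R / ((z : ℝ) * z * e)) ^ 2 else 0)| ≤
        K * sigmaBound 3 q * (z : ℝ) ^ (-(1 / 4) : ℝ) * Real.log R := by
  obtain ⟨K, hK0, hK⟩ := exists_abs_sum_sqfMul_sub_le hC hu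
  refine ⟨K, hK0, fun q z e R hq hz he hR => ?_⟩
  have hz0 : (0 : ℝ) < z := by exact_mod_cast hz
  have he0 : (0 : ℝ) < e := by exact_mod_cast he
  have hR0 : (0 : ℝ) < R := by exact_mod_cast hR
  set Y : ℝ := √((R : ℝ) / e) with hY
  have hY0 : 0 < Y := Real.sqrt_pos.mpr (by positivity)
  have hYsq : Y ^ 2 = R / e := Real.sq_sqrt (by positivity)
  have hmem : ∀ y : ℕ, y * y * e ≤ R ↔ (y : ℝ) ≤ Y := by
    intro y
    rw [hY, Real.le_sqrt (by positivity) (by positivity), le_div_iff₀ he0, sq]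
    exact_mod_cast Iff.rfl
  have hlog : ∀ y : ℕ, 1 ≤ y → Real.log (R / ((y : ℝ) * y * e)) = 2 * Real.log (Y / y) := by
    intro y hy
    have hy0 : (0 : ℝ) < y := by exact_mod_cast hy
    have : (R : ℝ) / ((y : ℝ) * y * e) = (Y / y) ^ 2 := by
      rw [div_pow, hYsq]; field_simp
    rw [this, Real.log_pow]
    norm_num
  have hsum : ∑ y ∈ Ioc 0 R, (if z < y ∧ y * y * e ≤ R then
        sqfMul (awayFrom q u) y * Real.log (R / ((y : ℝ) * y * e)) else 0) =
      2 * ∑ y ∈ Ioc z ⌊Y⌋₊, sqfMul (awayFrom q u) y * Real.log (Y / y) := by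
    rw [← sum_filter, mul_sum]
    have hset : (Ioc 0 R).filter (fun y => z < y ∧ y * y * e ≤ R) = Ioc z ⌊Y⌋₊ := by
      ext y
      rw [mem_filter, mem_Ioc, mem_Ioc, Nat.le_floor_iff hY0.le, hmem]
      constructor
      · rintro ⟨-, h⟩
        exact h
      · rintro ⟨h1, h2⟩
        refine ⟨⟨by omega, ?_⟩, h1, h2⟩
        have h3 := (hmem y).mpr h2
        have h4 : 1 ≤ y := by omega
        calc y ≤ y * y := Nat.le_mul_of_pos_left y h4
          _ ≤ y * y * e := Nat.le_mul_of_pos_right _ he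
          _ ≤ R := h3
    rw [hset]
    refine sum_congr rfl fun y hy => ?_
    rw [mem_Ioc] at hy
    rw [hlog y (by omega)]
    ring
  rw [hsum]
  have hE : 0 ≤ K * sigmaBound 3 q * (z : ℝ) ^ (-(1 / 4) : ℝ) := by
    have := one_le_sigmaBound (c := 3) (by norm_num) q
    positivity
  split_ifs with h
  · have hzY := (hmem z).mp h
    have := abs_sum_mul_log_div_sub_le (sqfMul (awayFrom q u)) hz hzY (m := posConst u q)
      (E := K * sigmaBound 3 q * (z : ℝ) ^ (-(1 / 4) : ℝ)) (fun s hs => by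
        have := hK q hq z s hz0 hs
        rwa [Nat.floor_natCast] at this)
    have hl := hlog z hz
    have hle : Real.log (R / ((z : ℝ) * z * e)) ≤ Real.log R := by
      have := log_div_natCast_le (a := z * z * e) hR
        (Nat.one_le_iff_ne_zero.mpr (by positivity))
      push_cast at this
      exact this
    rw [hl] at hle ⊢
    have e1 : 2 * ∑ y ∈ Ioc z ⌊Y⌋₊, sqfMul (awayFrom q u) y * Real.log (Y / y) -
        posConst u q / 4 * (2 * Real.log (Y / z)) ^ 2 =
        2 * (∑ y ∈ Ioc z ⌊Y⌋₊, sqfMul (awayFrom q u) y * Real.log (Y / y) -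
          posConst u q * (Real.log (Y / z) ^ 2 / 2)) := by ring
    rw [e1, abs_mul, abs_two]
    calc _ ≤ 2 * (K * sigmaBound 3 q * (z : ℝ) ^ (-(1 / 4) : ℝ) * Real.log (Y / z)) := by gcongr
      _ = K * sigmaBound 3 q * (z : ℝ) ^ (-(1 / 4) : ℝ) * (2 * Real.log (Y / z)) := by ring
      _ ≤ _ := by gcongr
  · have : ⌊Y⌋₊ ≤ z := by
      rw [hmem, not_le] at h
      exact Nat.floor_le_of_le h.le
    rw [Ioc_eq_empty_of_le this, sum_empty, mul_zero, sub_zero, abs_zero]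
    have := Real.log_natCast_nonneg R
    positivity

/-! ### The ordered sum over triples -/

/-- The indicator function of pairwise coprime triples. -/
def copInd (y z e : ℕ) : ℝ := if y.Coprime z ∧ y.Coprime e ∧ z.Coprime e then 1 else 0

/-- The part `z < y < x` of the sum over quadruples representing the third moment. -/
noncomputable def orderedSum (R : ℕ) : ℝ :=
  ∑ y ∈ Ioc 0 R, ∑ z ∈ Ioc 0 R, ∑ e ∈ Ioc 0 R, if z < y then
    copInd y z e * sqfMul phiInv y * sqfMul phiInv z * sqfMul tripleWeight e *
      ∑ x ∈ Ioc y (R / (y * e)), sqfMul (awayFrom (y * z * e) phiInv) x else 0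

/-- The multiplicative function `μ²(n) / n`. -/
noncomputable def sqfInv : ArithmeticFunction ℝ := sqfMul (fun p : ℕ => 1 / (p : ℝ))

/-- `orderedSum` after the summation over the largest variable. -/
noncomputable def orderedSum₁ (R : ℕ) : ℝ :=
  ∑ y ∈ Ioc 0 R, ∑ z ∈ Ioc 0 R, ∑ e ∈ Ioc 0 R, if z < y ∧ y * y * e ≤ R then
    copInd y z e * sqfInv y * sqfInv z * sqfMul tripleWeight₁ e *
      Real.log (R / ((y : ℝ) * y * e)) else 0

/-- `orderedSum₁` without the terms with `z ≤ Z`. -/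
noncomputable def orderedSum₂ (Z R : ℕ) : ℝ :=
  ∑ y ∈ Ioc 0 R, ∑ z ∈ Ioc 0 R, ∑ e ∈ Ioc 0 R, if Z < z ∧ z < y ∧ y * y * e ≤ R then
    copInd y z e * sqfInv y * sqfInv z * sqfMul tripleWeight₁ e *
      Real.log (R / ((y : ℝ) * y * e)) else 0

/-- `orderedSum₂` after the summation over `y`. -/
noncomputable def orderedSum₃ (Z R : ℕ) : ℝ :=
  ∑ z ∈ Ioc 0 R, ∑ e ∈ Ioc 0 R, if Z < z ∧ z.Coprime e ∧ z * z * e ≤ R then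
    sqfInv z * sqfMul tripleWeight₁ e * (posConst (fun p : ℕ => 1 / (p : ℝ)) (z * e) / 4 *
      Real.log (R / ((z : ℝ) * z * e)) ^ 2) else 0

theorem abs_sum_sum_sub_le {S T : Finset ℕ} {f g : ℕ → ℕ → ℝ} {a b : ℕ → ℝ} {K : ℝ}
    (h : ∀ y ∈ S, ∀ z ∈ T, |f y z - g y z| ≤ K * (a y * b z)) :
    |∑ y ∈ S, ∑ z ∈ T, f y z - ∑ y ∈ S, ∑ z ∈ T, g y z| ≤
      K * ((∑ y ∈ S, a y) * ∑ z ∈ T, b z) := by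
  simp_rw [← sum_sub_distrib]
  refine (abs_sum_le_sum_abs _ _).trans ?_
  rw [sum_mul_sum, mul_sum]
  refine sum_le_sum fun y hy => (abs_sum_le_sum_abs _ _).trans ?_
  rw [mul_sum]
  exact sum_le_sum fun z hz => h y hy z hz

theorem abs_sum_sum_sum_sub_le {S : Finset ℕ} {f g : ℕ → ℕ → ℕ → ℝ} {a b c : ℕ → ℝ} {K : ℝ}
    (h : ∀ y ∈ S, ∀ z ∈ S, ∀ e ∈ S, |f y z e - g y z e| ≤ K * (a y * (b z * c e))) :
    |∑ y ∈ S, ∑ z ∈ S, ∑ e ∈ S, f y z e - ∑ y ∈ S, ∑ z ∈ S, ∑ e ∈ S, g y z e| ≤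
      K * ((∑ y ∈ S, a y) * ((∑ z ∈ S, b z) * ∑ e ∈ S, c e)) := by
  simp_rw [← sum_sub_distrib]
  refine (abs_sum_le_sum_abs _ _).trans ?_
  rw [sum_mul_sum (s := S) (t := S) (f := b), sum_mul, mul_sum]
  refine sum_le_sum fun y hy => (abs_sum_le_sum_abs _ _).trans ?_
  rw [mul_sum, mul_sum]
  refine sum_le_sum fun z hz => (abs_sum_le_sum_abs _ _).trans ?_
  rw [mul_sum, mul_sum]
  exact sum_le_sum fun e he => h y hy z hz e he

theorem one_add_phiInv_ne_zero {p : ℕ} (hp : p.Prime) : 1 + phiInv p ≠ 0 := by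
  obtain ⟨hp0, hp2⟩ := prime_rpow_facts hp
  have : 0 < (p : ℝ) - 1 := by linarith
  rw [phiInv]
  positivity

theorem prod_primeFactors_mul (h : ℕ → ℝ) {m n : ℕ} (hmn : m.Coprime n) :
    ∏ p ∈ (m * n).primeFactors, h p =
      (∏ p ∈ m.primeFactors, h p) * ∏ p ∈ n.primeFactors, h p := by
  rw [hmn.primeFactors_mul, prod_union hmn.disjoint_primeFactors]

/-- The summation over `x` replaces the weight `1 / φ` of the other variables by `1 / n`. -/
theorem sqfMul_phiInv_mul_prod (n : ℕ) :
    sqfMul phiInv n * ∏ p ∈ n.primeFactors, (1 + phiInv p)⁻¹ = sqfInv n := by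
  rw [sqfMul_mul_prod]
  exact sqfMul_congr n fun p hp _ => phiInv_mul hp

/-- The decay in the larger of two variables is shared between them. -/
theorem rpow_neg_quarter_le {y z : ℕ} (hz : 1 ≤ z) (hzy : z ≤ y) :
    (y : ℝ) ^ (-(1 / 4) : ℝ) ≤ (y : ℝ) ^ (-(1 / 8) : ℝ) * (z : ℝ) ^ (-(1 / 8) : ℝ) := by
  have hz0 : (0 : ℝ) < z := by exact_mod_cast hz
  have hzy' : (z : ℝ) ≤ y := by exact_mod_cast hzy
  have hy0 : (0 : ℝ) < y := hz0.trans_le hzy'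
  rw [show (-(1 / 4) : ℝ) = -(1 / 8) + -(1 / 8) by norm_num, Real.rpow_add hy0]
  gcongr ?_ * ?_
  exact Real.rpow_le_rpow_of_nonpos hz0 hzy' (by norm_num)

/-- The sum over `x`. The error decays in `y > z`, so that the sums over `y` and `z` converge and
only the sum over `e` contributes a logarithm. -/
theorem exists_abs_orderedSum_sub_le :
    ∃ K : ℝ, 0 ≤ K ∧ ∀ R : ℕ, 1 ≤ R →
      |orderedSum R - orderedSum₁ R| ≤ K * (1 + Real.log R) := by
  obtain ⟨K, hK0, hK⟩ := exists_abs_sum_Ioc_sub_le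
  obtain ⟨K1, hK10, hK1⟩ := exists_sum_abs_sqfMul_mul_sigmaBound_mul_rpow_le (by norm_num)
    (nearInv_phiInv.primeBounded (by norm_num))
  obtain ⟨K2, hK20, hK2⟩ := exists_sum_abs_sqfMul_mul_sigmaBound_le (by norm_num)
    (nearInv_tripleWeight.primeBounded (by norm_num))
  have hsb : ∀ n, 0 ≤ sigmaBound 3 n := fun n =>
    zero_le_one.trans (one_le_sigmaBound (by norm_num) n)
  refine ⟨K * (K1 * (K1 * K2)), by positivity, fun R hR => ?_⟩
  have hlog := Real.log_natCast_nonneg R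
  refine (abs_sum_sum_sum_sub_le (K := K)
    (a := fun y => |sqfMul phiInv y| * sigmaBound 3 y * (y : ℝ) ^ (-(1 / 8) : ℝ))
    (b := fun z => |sqfMul phiInv z| * sigmaBound 3 z * (z : ℝ) ^ (-(1 / 8) : ℝ))
    (c := fun e => |sqfMul tripleWeight e| * sigmaBound 3 e) ?_).trans ?_
  · intro y hy z hz e he
    rw [mem_Ioc] at hy hz he
    have hnn : 0 ≤ K * (|sqfMul phiInv y| * sigmaBound 3 y * (y : ℝ) ^ (-(1 / 8) : ℝ) *
        (|sqfMul phiInv z| * sigmaBound 3 z * (z : ℝ) ^ (-(1 / 8) : ℝ) *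
          (|sqfMul tripleWeight e| * sigmaBound 3 e))) := by
      have := hsb y; have := hsb z; have := hsb e
      positivity
    by_cases hzy : z < y
    swap
    · simp only [hzy, false_and, if_false, sub_zero, abs_zero]
      exact hnn
    by_cases hc : y.Coprime z ∧ y.Coprime e ∧ z.Coprime e
    swap
    · simp only [copInd, if_neg hc, zero_mul, ite_self, sub_zero, abs_zero]
      exact hnn
    have hq : y * z * e ≠ 0 := by
      have := hy.1; have := hz.1; have := he.1
      positivity
    have hcop : (y * z).Coprime e := Nat.Coprime.mul_left hc.2.1 hc.2.2
    have h1 := hK (y * z * e) y e R hq hy.1 he.1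
    have h2 : posConst phiInv (y * z * e) = (∏ p ∈ y.primeFactors, (1 + phiInv p)⁻¹) *
        (∏ p ∈ z.primeFactors, (1 + phiInv p)⁻¹) * ∏ p ∈ e.primeFactors, (1 + phiInv p)⁻¹ := by
      rw [posConst_eq (by norm_num) nearInv_phiInv (fun p hp => one_add_phiInv_ne_zero hp) hq,
        posConst_phiInv_one, one_mul, prod_primeFactors_mul _ hcop, prod_primeFactors_mul _ hc.1]
    have h3 : sqfMul tripleWeight e * ∏ p ∈ e.primeFactors, (1 + phiInv p)⁻¹ =
        sqfMul tripleWeight₁ e := sqfMul_mul_prod _ _ _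
    have h4 : (if z < y ∧ y * y * e ≤ R then copInd y z e * sqfInv y * sqfInv z *
        sqfMul tripleWeight₁ e * Real.log (R / ((y : ℝ) * y * e)) else 0) =
        sqfMul phiInv y * sqfMul phiInv z * sqfMul tripleWeight e *
          (if y * y * e ≤ R then posConst phiInv (y * z * e) *
            Real.log (R / ((y : ℝ) * y * e)) else 0) := by
      simp only [hzy, true_and]
      split_ifs
      · rw [copInd, if_pos hc, h2, ← h3, ← sqfMul_phiInv_mul_prod, ← sqfMul_phiInv_mul_prod]
        ring
      · rw [mul_zero]
    rw [h4, if_pos hzy, copInd, if_pos hc, one_mul, ← mul_sub, abs_mul, abs_mul, abs_mul]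
    have h5 : sigmaBound 3 (y * z * e) = sigmaBound 3 y * sigmaBound 3 z * sigmaBound 3 e := by
      rw [sigmaBound_mul _ hcop, sigmaBound_mul _ hc.1]
    have h6 := rpow_neg_quarter_le hz.1 hzy.le
    calc _ ≤ |sqfMul phiInv y| * |sqfMul phiInv z| * |sqfMul tripleWeight e| *
          (K * sigmaBound 3 (y * z * e) *
            ((y : ℝ) ^ (-(1 / 8) : ℝ) * (z : ℝ) ^ (-(1 / 8) : ℝ))) := by
          have := hsb (y * z * e)
          exact mul_le_mul_of_nonneg_left
            (h1.trans (mul_le_mul_of_nonneg_left h6 (by positivity))) (by positivity)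
      _ = _ := by rw [h5]; ring
  · have s1 := hK1 R
    have s2 := hK2 R hR
    have n1 : 0 ≤ ∑ n ∈ Ioc 0 R, |sqfMul phiInv n| * sigmaBound 3 n * (n : ℝ) ^ (-(1 / 8) : ℝ) :=
      sum_nonneg fun n _ => by have := hsb n; positivity
    have n2 : 0 ≤ ∑ n ∈ Ioc 0 R, |sqfMul tripleWeight n| * sigmaBound 3 n :=
      sum_nonneg fun n _ => by have := hsb n; positivity
    calc _ ≤ K * (K1 * (K1 * (K2 * (1 + Real.log R)))) := by gcongr
      _ = _ := by ring

/-- The small values of `z` cost only `log R log Z`, by the cancellation in the sum over `e`. -/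
theorem exists_abs_orderedSum₁_sub_le :
    ∃ K : ℝ, 0 ≤ K ∧ ∀ Z R : ℕ, 1 ≤ Z → Z ≤ R →
      |orderedSum₁ R - orderedSum₂ Z R| ≤ K * ((1 + Real.log R) * (1 + Real.log Z)) := by
  obtain ⟨K, hK0, hK⟩ := exists_abs_sum_ite_mul_log_le
  obtain ⟨K1, hK10, hK1⟩ := exists_sum_abs_sqfMul_mul_sigmaBound_le le_rfl
    (nearInv_inv.primeBounded (by norm_num))
  have hsb : ∀ n, 0 ≤ sigmaBound 3 n := fun n =>
    zero_le_one.trans (one_le_sigmaBound (by norm_num) n)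
  refine ⟨K * (K1 * K1), by positivity, fun Z R hZ hZR => ?_⟩
  have hR : 1 ≤ R := hZ.trans hZR
  have hlog := Real.log_natCast_nonneg R
  have hlogZ := Real.log_natCast_nonneg Z
  refine (abs_sum_sum_sub_le (K := K)
    (a := fun y => |sqfInv y| * sigmaBound 3 y)
    (b := fun z => if z ≤ Z then |sqfInv z| * sigmaBound 3 z else 0) ?_).trans ?_
  · intro y hy z hz
    rw [mem_Ioc] at hy hz
    have hnn : 0 ≤ K * (|sqfInv y| * sigmaBound 3 y *
        if z ≤ Z then |sqfInv z| * sigmaBound 3 z else 0) := by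
      have := hsb y; have := hsb z
      split_ifs
      · positivity
      · simp
    rw [← sum_sub_distrib]
    by_cases hzZ : z ≤ Z
    swap
    · have hZz : Z < z := not_le.mp hzZ
      simp only [hZz, true_and, sub_self, sum_const_zero, abs_zero]
      exact hnn
    by_cases hc : z < y ∧ y.Coprime z
    swap
    · have : ∀ e, ((if z < y ∧ y * y * e ≤ R then copInd y z e * sqfInv y * sqfInv z *
          sqfMul tripleWeight₁ e * Real.log (R / ((y : ℝ) * y * e)) else 0) -
          if Z < z ∧ z < y ∧ y * y * e ≤ R then copInd y z e * sqfInv y * sqfInv z *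
          sqfMul tripleWeight₁ e * Real.log (R / ((y : ℝ) * y * e)) else 0) = 0 := by
        intro e
        rw [if_neg (fun h : Z < z ∧ _ => absurd h.1 (not_lt.mpr hzZ)), sub_zero]
        split_ifs with h1
        · rw [copInd, if_neg fun h2 => hc ⟨h1.1, h2.1⟩]; ring
        · rfl
      simp only [this, sum_const_zero, abs_zero]
      exact hnn
    have hq : y * z ≠ 0 := by
      have := hy.1; have := hz.1
      positivity
    have h1 := hK (y * z) (y * y) R hq (Nat.one_le_iff_ne_zero.mpr (by have := hy.1; positivity))
    have h2 : ∀ e, ((if z < y ∧ y * y * e ≤ R then copInd y z e * sqfInv y * sqfInv z *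
          sqfMul tripleWeight₁ e * Real.log (R / ((y : ℝ) * y * e)) else 0) -
          if Z < z ∧ z < y ∧ y * y * e ≤ R then copInd y z e * sqfInv y * sqfInv z *
          sqfMul tripleWeight₁ e * Real.log (R / ((y : ℝ) * y * e)) else 0) =
        sqfInv y * sqfInv z * if y * y * e ≤ R then
          sqfMul (awayFrom (y * z) tripleWeight₁) e *
            Real.log (R / (((y * y : ℕ) : ℝ) * e)) else 0 := by
      intro e
      rw [if_neg (fun h : Z < z ∧ _ => absurd h.1 (not_lt.mpr hzZ)), sub_zero]
      simp only [hc.1, true_and]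
      split_ifs with h3
      · have h4 : copInd y z e * sqfMul tripleWeight₁ e =
            sqfMul (awayFrom (y * z) tripleWeight₁) e := by
          rw [copInd, sqfMul_awayFrom]
          by_cases h5 : y.Coprime e ∧ z.Coprime e
          · rw [if_pos ⟨hc.2, h5⟩, if_pos (Nat.coprime_mul_iff_right.mpr ⟨h5.1.symm, h5.2.symm⟩),
              one_mul]
          · rw [if_neg fun h => h5 h.2, if_neg fun h => h5
              ⟨(Nat.coprime_mul_iff_right.mp h).1.symm, (Nat.coprime_mul_iff_right.mp h).2.symm⟩,
              zero_mul]
        rw [← h4]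
        push_cast
        ring
      · rw [mul_zero]
    simp only [h2]
    rw [← mul_sum, abs_mul, abs_mul, if_pos hzZ]
    rw [sigmaBound_mul _ hc.2] at h1
    calc _ ≤ |sqfInv y| * |sqfInv z| * (K * (sigmaBound 3 y * sigmaBound 3 z)) := by gcongr
      _ = _ := by ring
  · have s1 := hK1 R hR
    have s2 : (∑ z ∈ Ioc 0 R, if z ≤ Z then |sqfInv z| * sigmaBound 3 z else 0) ≤
        K1 * (1 + Real.log Z) := by
      rw [← sum_filter]
      refine le_trans (le_of_eq (sum_congr ?_ fun _ _ => rfl)) (hK1 Z hZ)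
      ext z
      simp only [mem_filter, mem_Ioc]
      constructor
      · rintro ⟨⟨h1, -⟩, h2⟩
        exact ⟨h1, h2⟩
      · rintro ⟨h1, h2⟩
        exact ⟨⟨h1, h2.trans hZR⟩, h2⟩
    have n2 : 0 ≤ ∑ z ∈ Ioc 0 R, if z ≤ Z then |sqfInv z| * sigmaBound 3 z else 0 :=
      sum_nonneg fun n _ => by
        have := hsb n
        split_ifs
        · positivity
        · rfl
    calc _ ≤ K * ((K1 * (1 + Real.log R)) * (K1 * (1 + Real.log Z))) := by
          gcongr
          exact s1
      _ = _ := by ring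

/-- The sum over `y`. For this sum the error is of the order of the main term, except for a power of
`Z` which is gained from `Z < z < y`. -/
theorem exists_abs_orderedSum₂_sub_le :
    ∃ K : ℝ, 0 ≤ K ∧ ∀ Z R : ℕ, 1 ≤ Z → 1 ≤ R →
      |orderedSum₂ Z R - orderedSum₃ Z R| ≤
        K * ((Z : ℝ) ^ (-(1 / 8) : ℝ) * (1 + Real.log R) ^ 2) := by
  obtain ⟨K, hK0, hK⟩ := exists_abs_sum_ite_sq_mul_log_sub_le le_rfl nearInv_inv
  obtain ⟨K1, hK10, hK1⟩ := exists_sum_abs_sqfMul_mul_sigmaBound_mul_rpow_le le_rfl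
    (nearInv_inv.primeBounded (by norm_num))
  obtain ⟨K2, hK20, hK2⟩ := exists_sum_abs_sqfMul_mul_sigmaBound_le (by norm_num)
    (nearInv_tripleWeight₁.primeBounded (by norm_num))
  have hsb : ∀ n, 0 ≤ sigmaBound 3 n := fun n =>
    zero_le_one.trans (one_le_sigmaBound (by norm_num) n)
  refine ⟨K * (K1 * K2), by positivity, fun Z R hZ hR => ?_⟩
  have hlog := Real.log_natCast_nonneg R
  have hre : orderedSum₂ Z R = ∑ z ∈ Ioc 0 R, ∑ e ∈ Ioc 0 R, ∑ y ∈ Ioc 0 R,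
      if Z < z ∧ z < y ∧ y * y * e ≤ R then
      copInd y z e * sqfInv y * sqfInv z * sqfMul tripleWeight₁ e *
      Real.log (R / ((y : ℝ) * y * e)) else 0 := by
    rw [orderedSum₂, sum_comm]
    exact sum_congr rfl fun z _ => sum_comm
  rw [hre]
  refine (abs_sum_sum_sub_le (K := K * (Z : ℝ) ^ (-(1 / 8) : ℝ) * Real.log R)
    (a := fun z => |sqfInv z| * sigmaBound 3 z * (z : ℝ) ^ (-(1 / 8) : ℝ))
    (b := fun e => |sqfMul tripleWeight₁ e| * sigmaBound 3 e) ?_).trans ?_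
  · intro z hz e he
    rw [mem_Ioc] at hz he
    by_cases hc : Z < z ∧ z.Coprime e
    swap
    · have h1 : ∀ y ∈ Ioc 0 R, (if Z < z ∧ z < y ∧ y * y * e ≤ R then
          copInd y z e * sqfInv y * sqfInv z * sqfMul tripleWeight₁ e *
          Real.log (R / ((y : ℝ) * y * e)) else 0) = 0 := by
        intro y _
        split_ifs with h1
        · rw [copInd, if_neg fun h2 => hc ⟨h1.1, h2.2.2⟩]; ring
        · rfl
      rw [sum_eq_zero h1, if_neg fun h : Z < z ∧ _ => hc ⟨h.1, h.2.1⟩, sub_zero, abs_zero]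
      have := hsb z; have := hsb e
      positivity
    have hq : z * e ≠ 0 := by
      have := hz.1; have := he.1
      positivity
    have h1 := hK (z * e) z e R hq hz.1 he.1 hR
    have h2 : ∀ y ∈ Ioc 0 R, (if Z < z ∧ z < y ∧ y * y * e ≤ R then
          copInd y z e * sqfInv y * sqfInv z * sqfMul tripleWeight₁ e *
          Real.log (R / ((y : ℝ) * y * e)) else 0) =
        sqfInv z * sqfMul tripleWeight₁ e * if z < y ∧ y * y * e ≤ R then
          sqfMul (awayFrom (z * e) fun p : ℕ => 1 / (p : ℝ)) y *
            Real.log (R / ((y : ℝ) * y * e)) else 0 := by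
      intro y _
      simp only [hc.1, true_and]
      split_ifs with h3
      · have h4 : copInd y z e * sqfInv y =
            sqfMul (awayFrom (z * e) fun p : ℕ => 1 / (p : ℝ)) y := by
          rw [copInd, sqfMul_awayFrom]
          by_cases h5 : y.Coprime z ∧ y.Coprime e
          · rw [if_pos ⟨h5.1, h5.2, hc.2⟩, if_pos (Nat.coprime_mul_iff_right.mpr h5), one_mul, sqfInv]
          · rw [if_neg fun h => h5 ⟨h.1, h.2.1⟩, if_neg fun h => h5 (Nat.coprime_mul_iff_right.mp h),
              zero_mul]
        rw [← h4]
        ring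
      · rw [mul_zero]
    have h3 : (if Z < z ∧ z.Coprime e ∧ z * z * e ≤ R then
        sqfInv z * sqfMul tripleWeight₁ e * (posConst (fun p : ℕ => 1 / (p : ℝ)) (z * e) / 4 *
        Real.log (R / ((z : ℝ) * z * e)) ^ 2) else 0) = sqfInv z * sqfMul tripleWeight₁ e *
        if z * z * e ≤ R then posConst (fun p : ℕ => 1 / (p : ℝ)) (z * e) / 4 *
        Real.log (R / ((z : ℝ) * z * e)) ^ 2 else 0 := by
      by_cases hle : z * z * e ≤ R
      · rw [if_pos ⟨hc.1, hc.2, hle⟩, if_pos hle]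
      · rw [if_neg fun h : Z < z ∧ _ => hle h.2.2, if_neg hle, mul_zero]
    rw [sum_congr rfl h2, ← mul_sum, h3, ← mul_sub, abs_mul, abs_mul]
    rw [sigmaBound_mul _ hc.2] at h1
    have h6 := rpow_neg_quarter_le hZ hc.1.le
    calc _ ≤ |sqfInv z| * |sqfMul tripleWeight₁ e| * (K * (sigmaBound 3 z * sigmaBound 3 e) *
          ((z : ℝ) ^ (-(1 / 8) : ℝ) * (Z : ℝ) ^ (-(1 / 8) : ℝ)) * Real.log R) := by
          have := hsb z; have := hsb e
          refine mul_le_mul_of_nonneg_left (h1.trans ?_) (by positivity)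
          gcongr
      _ = _ := by ring
  · have s1 := hK1 R
    have s2 := hK2 R hR
    have n2 : 0 ≤ ∑ n ∈ Ioc 0 R, |sqfMul tripleWeight₁ n| * sigmaBound 3 n :=
      sum_nonneg fun n _ => by have := hsb n; positivity
    have hl : Real.log R ≤ 1 + Real.log R := by linarith
    have n1 : 0 ≤ ∑ n ∈ Ioc 0 R, |sqfInv n| * sigmaBound 3 n * (n : ℝ) ^ (-(1 / 8) : ℝ) :=
      sum_nonneg fun n _ => by have := hsb n; positivity
    calc _ ≤ K * (Z : ℝ) ^ (-(1 / 8) : ℝ) * (1 + Real.log R) * (K1 * (K2 * (1 + Real.log R))) :=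
          mul_le_mul (by gcongr) (mul_le_mul s1 s2 n2 hK10) (mul_nonneg n1 n2) (by positivity)
      _ = _ := by ring

theorem one_add_inv_ne_zero {p : ℕ} (hp : p.Prime) : 1 + 1 / (p : ℝ) ≠ 0 := by
  obtain ⟨hp0, -⟩ := prime_rpow_facts hp
  positivity

/-- The sums over `e` and then over `z`. The factors `1 / 4`, `2` and `1 / 4` from the summations
over `y`, `e` and `z` combine to `1 / 8`. -/
theorem exists_abs_orderedSum₃_sub_le :
    ∃ K : ℝ, 0 ≤ K ∧ ∀ Z R : ℕ, 1 ≤ Z → Z * Z ≤ R →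
      |orderedSum₃ Z R - Real.log (R / ((Z : ℝ) * Z)) ^ 2 / 8| ≤ K * (1 + Real.log R) := by
  obtain ⟨K, hK0, hK⟩ := exists_abs_sum_ite_mul_log_sq_sub_le
  obtain ⟨K1, hK10, hK1⟩ := exists_sum_abs_sqfMul_mul_sigmaBound_le (by norm_num)
    (nearInv_psiInv.primeBounded (by norm_num))
  obtain ⟨K2, hK20, hK2⟩ := exists_abs_sum_ite_sq_mul_log_sub_le (by norm_num) nearInv_lastWeight
  have hsb : ∀ n, 0 ≤ sigmaBound 3 n := fun n =>
    zero_le_one.trans (one_le_sigmaBound (by norm_num) n)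
  set κ := posConst (fun p : ℕ => 1 / (p : ℝ)) 1 with hκ
  set c := negConst tripleWeight₂ 1 with hc
  have hs1 := hsb 1
  refine ⟨|κ / 4| * (K * K1) + |κ * c / 2| * (K2 * sigmaBound 3 1), by positivity,
    fun Z R hZ hZR => ?_⟩
  have hR : 1 ≤ R := (Nat.one_le_iff_ne_zero.mpr (by positivity)).trans hZR
  have hlog := Real.log_natCast_nonneg R
  have hterm : ∀ z ∈ Ioc 0 R, ∀ e ∈ Ioc 0 R, (if Z < z ∧ z.Coprime e ∧ z * z * e ≤ R then
      sqfInv z * sqfMul tripleWeight₁ e * (posConst (fun p : ℕ => 1 / (p : ℝ)) (z * e) / 4 *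
      Real.log (R / ((z : ℝ) * z * e)) ^ 2) else 0) =
      κ / 4 * ((if Z < z then sqfMul psiInv z else 0) * if z * z * e ≤ R then
        sqfMul (awayFrom z tripleWeight₂) e * Real.log (R / (((z * z : ℕ) : ℝ) * e)) ^ 2 else 0) := by
    intro z hz e he
    rw [mem_Ioc] at hz he
    by_cases h1 : Z < z ∧ z * z * e ≤ R
    swap
    · rw [if_neg fun h : Z < z ∧ _ => h1 ⟨h.1, h.2.2⟩]
      split_ifs with h2 h3
      · exact absurd ⟨h2, h3⟩ h1
      · ring
      · ring
      · ring
    rw [if_pos h1.1, if_pos h1.2, sqfMul_awayFrom]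
    by_cases h2 : z.Coprime e
    swap
    · rw [if_neg fun h : Z < z ∧ _ => h2 h.2.1, if_neg fun h => h2 h.symm]
      ring
    have hq : z * e ≠ 0 := by
      have := hz.1; have := he.1
      positivity
    have h3 : sqfInv z * ∏ p ∈ z.primeFactors, (1 + 1 / (p : ℝ))⁻¹ = sqfMul psiInv z :=
      sqfMul_mul_prod _ _ _
    have h4 : sqfMul tripleWeight₁ e * ∏ p ∈ e.primeFactors, (1 + 1 / (p : ℝ))⁻¹ =
        sqfMul tripleWeight₂ e := sqfMul_mul_prod _ _ _
    rw [if_pos ⟨h1.1, h2, h1.2⟩, if_pos h2.symm,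
      posConst_eq le_rfl nearInv_inv (fun p hp => one_add_inv_ne_zero hp) hq,
      prod_primeFactors_mul _ h2, ← h3, ← h4, ← hκ]
    push_cast
    ring
  have e1 : orderedSum₃ Z R = κ / 4 * ∑ z ∈ Ioc 0 R, (if Z < z then sqfMul psiInv z else 0) *
      ∑ e ∈ Ioc 0 R, if z * z * e ≤ R then
        sqfMul (awayFrom z tripleWeight₂) e * Real.log (R / (((z * z : ℕ) : ℝ) * e)) ^ 2 else 0 := by
    rw [orderedSum₃, mul_sum]
    refine sum_congr rfl fun z hz => ?_
    rw [sum_congr rfl (hterm z hz), mul_sum, mul_sum]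
  have e2 : ∀ z ∈ Ioc 0 R, (if Z < z then sqfMul psiInv z else 0) *
      (if z * z ≤ R then 2 * negConst tripleWeight₂ z * Real.log (R / ((z * z : ℕ) : ℝ)) else 0) =
      2 * c * if Z < z ∧ z * z * 1 ≤ R then
        sqfMul (awayFrom 1 lastWeight) z * Real.log (R / ((z : ℝ) * z * (1 : ℕ))) else 0 := by
    intro z hz
    rw [mem_Ioc] at hz
    rw [mul_one]
    by_cases h1 : Z < z ∧ z * z ≤ R
    swap
    · rw [if_neg h1]
      split_ifs with h2 h3
      · exact absurd ⟨h2, h3⟩ h1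
      · ring
      · ring
      · ring
    have h3 : sqfMul psiInv z * ∏ p ∈ z.primeFactors, (1 + tripleWeight₂ p)⁻¹ =
        sqfMul lastWeight z := sqfMul_mul_prod _ _ _
    rw [if_pos h1.1, if_pos h1.2, if_pos h1, sqfMul_awayFrom, if_pos (Nat.coprime_one_right z),
      negConst_eq (by norm_num) nearInv_tripleWeight₂
        (fun p hp => (one_add_tripleWeight₂_pos hp).ne') hz.1.ne', ← h3, ← hc]
    push_cast
    rw [mul_one]
    ring
  have b1 : |∑ z ∈ Ioc 0 R, (if Z < z then sqfMul psiInv z else 0) *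
      (∑ e ∈ Ioc 0 R, if z * z * e ≤ R then
        sqfMul (awayFrom z tripleWeight₂) e * Real.log (R / (((z * z : ℕ) : ℝ) * e)) ^ 2 else 0) -
      ∑ z ∈ Ioc 0 R, (if Z < z then sqfMul psiInv z else 0) *
      (if z * z ≤ R then 2 * negConst tripleWeight₂ z * Real.log (R / ((z * z : ℕ) : ℝ)) else 0)| ≤
      K * (K1 * (1 + Real.log R)) := by
    rw [← sum_sub_distrib]
    refine (abs_sum_le_sum_abs _ _).trans ((sum_le_sum (g := fun z =>
      K * (|sqfMul psiInv z| * sigmaBound 3 z)) fun z hz => ?_).trans ?_)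
    · rw [mem_Ioc] at hz
      have h1 := hK z (z * z) R hz.1.ne' (Nat.one_le_iff_ne_zero.mpr (by have := hz.1; positivity))
      have hz' := hsb z
      rw [← mul_sub, abs_mul]
      have h2 : |if Z < z then sqfMul psiInv z else 0| ≤ |sqfMul psiInv z| := by
        split_ifs
        · rfl
        · simp
      calc _ ≤ |sqfMul psiInv z| * (K * sigmaBound 3 z) := by gcongr
        _ = _ := by ring
    · rw [← mul_sum]
      exact mul_le_mul_of_nonneg_left (hK1 R hR) hK0
  rw [sum_congr rfl e2, ← mul_sum] at b1
  have b2 := hK2 1 Z 1 R one_ne_zero hZ le_rfl hR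
  rw [if_pos (by simpa using hZR)] at b2
  have hZ1 : (Z : ℝ) ^ (-(1 / 4) : ℝ) ≤ 1 :=
    Real.rpow_le_one_of_one_le_of_nonpos (by exact_mod_cast hZ) (by norm_num)
  have b3 : K2 * sigmaBound 3 1 * (Z : ℝ) ^ (-(1 / 4) : ℝ) * Real.log R ≤
      K2 * sigmaBound 3 1 * 1 * (1 + Real.log R) := by
    gcongr
    linarith
  have b4 := b2.trans b3
  set A := ∑ z ∈ Ioc 0 R, (if Z < z then sqfMul psiInv z else 0) *
      ∑ e ∈ Ioc 0 R, if z * z * e ≤ R then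
        sqfMul (awayFrom z tripleWeight₂) e * Real.log (R / (((z * z : ℕ) : ℝ) * e)) ^ 2 else 0
    with hA
  set B := ∑ z ∈ Ioc 0 R, (if Z < z ∧ z * z * 1 ≤ R then
        sqfMul (awayFrom 1 lastWeight) z * Real.log (R / ((z : ℝ) * z * (1 : ℕ))) else 0) with hB
  have hprod := posConst_mul_negConst_mul_posConst
  rw [← hκ, ← hc] at hprod
  have hfin : orderedSum₃ Z R - Real.log (R / ((Z : ℝ) * Z)) ^ 2 / 8 =
      κ / 4 * (A - 2 * c * B) + κ * c / 2 * (B - posConst lastWeight 1 / 4 *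
        Real.log (R / ((Z : ℝ) * Z * (1 : ℕ))) ^ 2) := by
    rw [e1, Nat.cast_one, mul_one]
    linear_combination (Real.log (R / ((Z : ℝ) * Z)) ^ 2 / 8) * hprod
  rw [hfin]
  refine (abs_add_le _ _).trans ?_
  rw [abs_mul, abs_mul]
  calc _ ≤ |κ / 4| * (K * (K1 * (1 + Real.log R))) +
        |κ * c / 2| * (K2 * sigmaBound 3 1 * 1 * (1 + Real.log R)) := by gcongr
    _ = _ := by ring

/-- The asymptotic evaluation of the sum over ordered quadruples. -/
theorem exists_abs_orderedSum_sub_log_sq_le :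
    ∃ K : ℝ, 0 ≤ K ∧ ∀ Z R : ℕ, 1 ≤ Z → Z * Z ≤ R →
      |orderedSum R - Real.log (R / ((Z : ℝ) * Z)) ^ 2 / 8| ≤
        K * ((1 + Real.log R) * (1 + Real.log Z) +
          (Z : ℝ) ^ (-(1 / 8) : ℝ) * (1 + Real.log R) ^ 2) := by
  obtain ⟨K0, hK00, hK0⟩ := exists_abs_orderedSum_sub_le
  obtain ⟨K1, hK10, hK1⟩ := exists_abs_orderedSum₁_sub_le
  obtain ⟨K2, hK20, hK2⟩ := exists_abs_orderedSum₂_sub_le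
  obtain ⟨K3, hK30, hK3⟩ := exists_abs_orderedSum₃_sub_le
  refine ⟨K0 + K1 + K2 + K3, by positivity, fun Z R hZ hZR => ?_⟩
  have hR : 1 ≤ R := (Nat.one_le_iff_ne_zero.mpr (by positivity)).trans hZR
  have h0 := hK0 R hR
  have h1 := hK1 Z R hZ ((Nat.le_mul_of_pos_left Z hZ).trans hZR)
  have h2 := hK2 Z R hZ hR
  have h3 := hK3 Z R hZ hZR
  have hlog := Real.log_natCast_nonneg R
  have hlogZ := Real.log_natCast_nonneg Z
  set a := 1 + Real.log R with ha
  set b := (1 + Real.log R) * (1 + Real.log Z) with hb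
  set d := (Z : ℝ) ^ (-(1 / 8) : ℝ) * a ^ 2 with hd
  have hab : a ≤ b := le_mul_of_one_le_right (by linarith) (by linarith)
  have hd0 : 0 ≤ d := by positivity
  have ha0 : 0 ≤ a := by linarith
  have m0 : K0 * a ≤ K0 * (b + d) := by gcongr; linarith
  have m1 : K1 * b ≤ K1 * (b + d) := by gcongr; linarith
  have m2 : K2 * d ≤ K2 * (b + d) := by gcongr; linarith
  have m3 : K3 * a ≤ K3 * (b + d) := by gcongr; linarith
  rw [abs_le] at h0 h1 h2 h3 ⊢
  constructor <;> linarith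

/-! ### The sum over quadruples -/

/-- A symmetric function of three variables is summed over a cube by summing over the decreasing
triples and the triples with repetitions. -/
theorem sum_symmetric_eq (S : Finset ℕ) (A : ℕ → ℕ → ℕ → ℝ) (h12 : ∀ x y z, A x y z = A y x z)
    (h23 : ∀ x y z, A x y z = A x z y) :
    ∑ x ∈ S, ∑ y ∈ S, ∑ z ∈ S, A x y z =
      6 * (∑ x ∈ S, ∑ y ∈ S, ∑ z ∈ S, if z < y ∧ y < x then A x y z else 0) +
      3 * (∑ x ∈ S, ∑ y ∈ S, if x ≠ y then A x y y else 0) + ∑ x ∈ S, A x x x := by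
  set T : ℕ → ℕ → ℕ → ℝ := fun x y z => if z < y ∧ y < x then A x y z else 0 with hT
  set D : ℕ → ℕ → ℝ := fun x y => if x ≠ y then A x y y else 0 with hD
  have key : ∀ x y z, A x y z = T x y z + T x z y + T y x z + T y z x + T z x y + T z y x +
      ((if y = z then D x y else 0) + (if x = z then D y x else 0) + (if x = y then D z x else 0)) +
      (if x = y then (if y = z then A x x x else 0) else 0) := by
    intro x y z
    have e1 : A x z y = A x y z := (h23 x y z).symm
    have e2 : A y x z = A x y z := (h12 x y z).symm
    have e3 : A y z x = A x y z := by rw [← h23, e2]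
    have e4 : A z x y = A x y z := by rw [← h12, e1]
    have e5 : A z y x = A x y z := by rw [← h23, e4]
    -- by symmetry, only the relative order of `x`, `y`, `z` matters
    rcases lt_trichotomy x y with h1 | h1 | h1 <;> rcases lt_trichotomy y z with h2 | h2 | h2 <;>
      rcases lt_trichotomy x z with h3 | h3 | h3 <;> first
      | (exfalso; omega)
      | (subst_vars; simp [hT, hD]; done)
      | (simp [hT, h1, h2, h3, h1.ne, h2.ne, h3.ne, h1.ne', h2.ne', h3.ne',
          not_lt_of_gt h1, not_lt_of_gt h2, not_lt_of_gt h3, e1, e2, e3, e4, e5])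
      | (subst h1; simp [hT, hD, h2, h2.ne, h2.ne', not_lt_of_gt h2, e4])
      | (subst h2; simp [hT, hD, h1, h1.ne, h1.ne', not_lt_of_gt h1])
      | (subst h3; simp [hT, hD, h1, h1.ne, h1.ne', not_lt_of_gt h1, e2])
  have s1 : ∑ x ∈ S, ∑ y ∈ S, ∑ z ∈ S, T x z y = ∑ x ∈ S, ∑ y ∈ S, ∑ z ∈ S, T x y z :=
    sum_congr rfl fun x _ => sum_comm
  have s2 : ∑ x ∈ S, ∑ y ∈ S, ∑ z ∈ S, T y x z = ∑ x ∈ S, ∑ y ∈ S, ∑ z ∈ S, T x y z := sum_comm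
  have s3 : ∑ x ∈ S, ∑ y ∈ S, ∑ z ∈ S, T y z x = ∑ x ∈ S, ∑ y ∈ S, ∑ z ∈ S, T x y z := by
    rw [sum_comm, ← s1]
  have s4 : ∑ x ∈ S, ∑ y ∈ S, ∑ z ∈ S, T z x y = ∑ x ∈ S, ∑ y ∈ S, ∑ z ∈ S, T x y z := by
    rw [← s2]
    exact sum_congr rfl fun x _ => sum_comm
  have s5 : ∑ x ∈ S, ∑ y ∈ S, ∑ z ∈ S, T z y x = ∑ x ∈ S, ∑ y ∈ S, ∑ z ∈ S, T x y z := by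
    rw [← s4, sum_comm]
  have d1 : ∑ x ∈ S, ∑ y ∈ S, ∑ z ∈ S, (if y = z then D x y else 0) = ∑ x ∈ S, ∑ y ∈ S, D x y := by
    refine sum_congr rfl fun x _ => sum_congr rfl fun y hy => ?_
    rw [sum_ite_eq, if_pos hy]
  have d2 : ∑ x ∈ S, ∑ y ∈ S, ∑ z ∈ S, (if x = z then D y x else 0) = ∑ x ∈ S, ∑ y ∈ S, D x y := by
    rw [sum_comm]
    refine sum_congr rfl fun y _ => sum_congr rfl fun x hx => ?_
    rw [sum_ite_eq, if_pos hx]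
  have d3 : ∑ x ∈ S, ∑ y ∈ S, ∑ z ∈ S, (if x = y then D z x else 0) = ∑ x ∈ S, ∑ y ∈ S, D x y := by
    rw [← d2]
    exact sum_congr rfl fun x _ => sum_comm
  have d4 : ∑ x ∈ S, ∑ y ∈ S, ∑ z ∈ S, (if x = y then (if y = z then A x x x else 0) else 0) =
      ∑ x ∈ S, A x x x := by
    refine sum_congr rfl fun x hx => ?_
    have : ∀ y ∈ S, ∑ z ∈ S, (if x = y then (if y = z then A x x x else 0) else 0) =
        if x = y then A x x x else 0 := by
      intro y hy
      split_ifs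
      · rw [sum_ite_eq, if_pos hy]
      · exact sum_const_zero
    rw [sum_congr rfl this, sum_ite_eq, if_pos hx]
  calc _ = ∑ x ∈ S, ∑ y ∈ S, ∑ z ∈ S, (T x y z + T x z y + T y x z + T y z x + T z x y + T z y x +
        ((if y = z then D x y else 0) + (if x = z then D y x else 0) +
          (if x = y then D z x else 0)) +
        (if x = y then (if y = z then A x x x else 0) else 0)) :=
        sum_congr rfl fun x _ => sum_congr rfl fun y _ => sum_congr rfl fun z _ => key x y z
    _ = _ := ?_
  simp only [sum_add_distrib]
  rw [s1, s2, s3, s4, s5, d1, d2, d3, d4]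
  ring

/-- The summand of the sum over quadruples representing the third moment: the moduli are `x y e`,
`x z e` and `y z e`. -/
noncomputable def quadTerm (R x y z e : ℕ) : ℝ :=
  if (x.Coprime y ∧ x.Coprime z ∧ y.Coprime z) ∧ (x.Coprime e ∧ y.Coprime e ∧ z.Coprime e) ∧
    (x * y * e ≤ R ∧ x * z * e ≤ R ∧ y * z * e ≤ R) then
    sqfMul phiInv x * sqfMul phiInv y * sqfMul phiInv z * sqfMul tripleWeight e else 0

/-- The third moment of the short divisor sum at a random integer, as a sum over quadruples. -/
noncomputable def quadSum (R : ℕ) : ℝ :=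
  ∑ x ∈ Ioc 0 R, ∑ y ∈ Ioc 0 R, ∑ z ∈ Ioc 0 R, ∑ e ∈ Ioc 0 R, quadTerm R x y z e

theorem quadTerm_swap_left (R x y z e : ℕ) : quadTerm R x y z e = quadTerm R y x z e := by
  have h : ((x.Coprime y ∧ x.Coprime z ∧ y.Coprime z) ∧
      (x.Coprime e ∧ y.Coprime e ∧ z.Coprime e) ∧
      (x * y * e ≤ R ∧ x * z * e ≤ R ∧ y * z * e ≤ R)) ↔
      ((y.Coprime x ∧ y.Coprime z ∧ x.Coprime z) ∧
      (y.Coprime e ∧ x.Coprime e ∧ z.Coprime e) ∧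
      (y * x * e ≤ R ∧ y * z * e ≤ R ∧ x * z * e ≤ R)) := by
    rw [Nat.coprime_comm (n := x) (m := y), mul_comm x y]
    tauto
  rw [quadTerm, quadTerm, if_congr h rfl rfl]
  split_ifs
  · ring
  · rfl

theorem quadTerm_swap_right (R x y z e : ℕ) : quadTerm R x y z e = quadTerm R x z y e := by
  have h : ((x.Coprime y ∧ x.Coprime z ∧ y.Coprime z) ∧
      (x.Coprime e ∧ y.Coprime e ∧ z.Coprime e) ∧
      (x * y * e ≤ R ∧ x * z * e ≤ R ∧ y * z * e ≤ R)) ↔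
      ((x.Coprime z ∧ x.Coprime y ∧ z.Coprime y) ∧
      (x.Coprime e ∧ z.Coprime e ∧ y.Coprime e) ∧
      (x * z * e ≤ R ∧ x * y * e ≤ R ∧ z * y * e ≤ R)) := by
    rw [Nat.coprime_comm (n := y) (m := z), mul_comm y z]
    tauto
  rw [quadTerm, quadTerm, if_congr h rfl rfl]
  split_ifs
  · ring
  · rfl

/-- For `z < y < x` the constraint `x y e ≤ R` implies the other two. -/
theorem sum_decreasing_quadTerm (R : ℕ) :
    (∑ x ∈ Ioc 0 R, ∑ y ∈ Ioc 0 R, ∑ z ∈ Ioc 0 R, if z < y ∧ y < x then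
      ∑ e ∈ Ioc 0 R, quadTerm R x y z e else 0) = orderedSum R := by
  rw [sum_comm, orderedSum]
  refine sum_congr rfl fun y hy => ?_
  rw [sum_comm]
  refine sum_congr rfl fun z hz => ?_
  rw [mem_Ioc] at hy hz
  by_cases hzy : z < y
  swap
  · simp [hzy]
  simp only [hzy, true_and, if_true]
  have h1 : ∀ x, (if y < x then ∑ e ∈ Ioc 0 R, quadTerm R x y z e else 0) =
      ∑ e ∈ Ioc 0 R, if y < x then quadTerm R x y z e else 0 := by
    intro x
    split_ifs <;> simp
  simp_rw [h1]
  rw [sum_comm]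
  refine sum_congr rfl fun e he => ?_
  rw [mem_Ioc] at he
  have hye : 0 < y * e := Nat.mul_pos hy.1 he.1
  have h2 : Ioc y (R / (y * e)) = (Ioc 0 R).filter (fun x => y < x ∧ x * y * e ≤ R) := by
    ext x
    rw [mem_filter, mem_Ioc, mem_Ioc, Nat.le_div_iff_mul_le hye, ← mul_assoc]
    constructor
    · rintro ⟨h3, h4⟩
      refine ⟨⟨by omega, le_trans ?_ h4⟩, h3, h4⟩
      rw [mul_assoc]
      exact Nat.le_mul_of_pos_right x hye
    · rintro ⟨-, h⟩
      exact h
  rw [h2, sum_filter, mul_sum]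
  refine sum_congr rfl fun x hx => ?_
  by_cases hyx : y < x
  swap
  · simp [hyx]
  simp only [hyx, true_and, if_true]
  have h3 : x * z * e ≤ x * y * e := by gcongr
  have h4 : y * z * e ≤ x * y * e := by rw [mul_comm x y]; gcongr; omega
  rw [quadTerm, copInd]
  by_cases hle : x * y * e ≤ R
  swap
  · rw [if_neg fun h => hle h.2.2.1, if_neg hle, mul_zero]
  rw [if_pos hle, sqfMul_awayFrom]
  by_cases hc : y.Coprime z ∧ y.Coprime e ∧ z.Coprime e
  swap
  · rw [if_neg fun h => hc ⟨h.1.2.2, h.2.1.2.1, h.2.1.2.2⟩, if_neg hc]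
    ring
  rw [if_pos hc]
  by_cases hx' : x.Coprime (y * z * e)
  · have h5 := Nat.coprime_mul_iff_right.mp hx'
    have h6 := Nat.coprime_mul_iff_right.mp h5.1
    rw [if_pos hx', if_pos ⟨⟨h6.1, h6.2, hc.1⟩, ⟨h5.2, hc.2⟩, hle, h3.trans hle, h4.trans hle⟩]
    ring
  · rw [if_neg hx', if_neg fun h => hx' (Nat.coprime_mul_iff_right.mpr
      ⟨Nat.coprime_mul_iff_right.mpr ⟨h.1.1, h.1.2.1⟩, h.2.1.1⟩)]
    ring

/-- Coprimality forces a repeated variable to be `1`. -/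
theorem quadTerm_eq_zero_of_ne_one (R x e : ℕ) {y : ℕ} (hy : y ≠ 1) : quadTerm R x y y e = 0 := by
  rw [quadTerm, if_neg]
  intro h
  exact hy ((Nat.coprime_self y).mp h.1.2.2)

theorem exists_sum_abs_tripleWeight_le :
    ∃ K : ℝ, 0 ≤ K ∧ ∀ R : ℕ, 1 ≤ R →
      ∑ e ∈ Ioc 0 R, |sqfMul tripleWeight e| * sigmaBound 3 e ≤ K * (1 + Real.log R) :=
  exists_sum_abs_sqfMul_mul_sigmaBound_le (by norm_num)
    (nearInv_tripleWeight.primeBounded (by norm_num))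

/-- The terms with exactly two equal variables: these are equal to `1`, and after the summation over
the third one, the sum over `e` cancels. -/
theorem exists_abs_repeated_quadTerm_le :
    ∃ K : ℝ, 0 ≤ K ∧ ∀ R : ℕ, 1 ≤ R →
      |∑ x ∈ Ioc 0 R, ∑ y ∈ Ioc 0 R, if x ≠ y then ∑ e ∈ Ioc 0 R, quadTerm R x y y e else 0| ≤
        K * (1 + Real.log R) := by
  obtain ⟨K, hK0, hK⟩ := exists_abs_sum_Ioc_sub_le
  obtain ⟨K1, hK10, hK1⟩ := exists_abs_sum_ite_mul_log_le
  obtain ⟨K2, hK20, hK2⟩ := exists_sum_abs_tripleWeight_le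
  have hs1 := one_le_sigmaBound (c := 3) (by norm_num) 1
  refine ⟨K * K2 + K1 * sigmaBound 3 1, by positivity, fun R hR => ?_⟩
  have hlog := Real.log_natCast_nonneg R
  have h1 : ∑ x ∈ Ioc 0 R, ∑ y ∈ Ioc 0 R, (if x ≠ y then ∑ e ∈ Ioc 0 R, quadTerm R x y y e else 0) =
      ∑ e ∈ Ioc 0 R, sqfMul tripleWeight e *
        ∑ x ∈ Ioc 1 (R / (1 * e)), sqfMul (awayFrom e phiInv) x := by
    have h2 : ∀ x ∈ Ioc 0 R, ∑ y ∈ Ioc 0 R,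
        (if x ≠ y then ∑ e ∈ Ioc 0 R, quadTerm R x y y e else 0) =
        ∑ e ∈ Ioc 0 R, if 1 < x then quadTerm R x 1 1 e else 0 := by
      intro x hx
      rw [mem_Ioc] at hx
      rw [sum_eq_single 1]
      · by_cases h : x = 1
        · simp [h]
        · have : 1 < x := by omega
          simp [h, this]
      · intro y _ hy
        rw [sum_eq_zero fun e _ => quadTerm_eq_zero_of_ne_one R x e hy, ite_self]
      · intro h
        simp at h
        omega
    rw [sum_congr rfl h2, sum_comm]
    refine sum_congr rfl fun e he => ?_
    rw [mem_Ioc] at he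
    have h3 : Ioc 1 (R / (1 * e)) = (Ioc 0 R).filter (fun x => 1 < x ∧ x * e ≤ R) := by
      ext x
      rw [mem_filter, mem_Ioc, mem_Ioc, one_mul, Nat.le_div_iff_mul_le he.1]
      constructor
      · rintro ⟨h3, h4⟩
        exact ⟨⟨by omega, le_trans (Nat.le_mul_of_pos_right x he.1) h4⟩, h3, h4⟩
      · rintro ⟨-, h⟩
        exact h
    rw [h3, sum_filter, mul_sum]
    refine sum_congr rfl fun x hx => ?_
    by_cases hx1 : 1 < x
    swap
    · simp [hx1]
    simp only [hx1, true_and, if_true]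
    rw [quadTerm, sqfMul_awayFrom]
    by_cases hle : x * e ≤ R
    swap
    · rw [if_neg fun h => hle (by simpa using h.2.2.1), if_neg hle, mul_zero]
    by_cases hc : x.Coprime e
    swap
    · rw [if_neg fun h => hc h.2.1.1, if_pos hle, if_neg hc, mul_zero]
    rw [if_pos hle, if_pos hc, if_pos]
    · simp [sqfMul_one]
      ring
    · simpa [hc, hle] using (⟨hc, he.2⟩ : x.Coprime e ∧ e ≤ R)
  rw [h1]
  -- the main term `log (R / e)` of the sum over `x`, where `y = z = 1`, is then summed over `e`
  have h2 : ∀ e ∈ Ioc 0 R, |sqfMul tripleWeight e *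
      (∑ x ∈ Ioc 1 (R / (1 * e)), sqfMul (awayFrom e phiInv) x) -
      (if 1 * e ≤ R then sqfMul (awayFrom 1 tripleWeight₁) e * Real.log (R / (((1 : ℕ) : ℝ) * e))
        else 0)| ≤ K * (|sqfMul tripleWeight e| * sigmaBound 3 e) := by
    intro e he
    rw [mem_Ioc] at he
    have h3 := hK e 1 e R he.1.ne' le_rfl he.1
    simp only [one_mul, Nat.cast_one, Real.one_rpow, mul_one] at h3 ⊢
    rw [if_pos he.2] at h3 ⊢
    have h4 : sqfMul tripleWeight e * ∏ p ∈ e.primeFactors, (1 + phiInv p)⁻¹ =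
        sqfMul tripleWeight₁ e := sqfMul_mul_prod _ _ _
    rw [posConst_eq (by norm_num) nearInv_phiInv (fun p hp => one_add_phiInv_ne_zero hp) he.1.ne',
      posConst_phiInv_one, one_mul] at h3
    rw [sqfMul_awayFrom, if_pos (Nat.coprime_one_right e), ← h4, mul_assoc, ← mul_sub, abs_mul]
    calc _ ≤ |sqfMul tripleWeight e| * (K * sigmaBound 3 e) := by gcongr
      _ = _ := by ring
  have h3 : |∑ e ∈ Ioc 0 R, sqfMul tripleWeight e *
      (∑ x ∈ Ioc 1 (R / (1 * e)), sqfMul (awayFrom e phiInv) x) -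
      ∑ e ∈ Ioc 0 R, (if 1 * e ≤ R then
        sqfMul (awayFrom 1 tripleWeight₁) e * Real.log (R / (((1 : ℕ) : ℝ) * e)) else 0)| ≤
      K * (K2 * (1 + Real.log R)) := by
    rw [← sum_sub_distrib]
    refine (abs_sum_le_sum_abs _ _).trans ((sum_le_sum h2).trans ?_)
    rw [← mul_sum]
    exact mul_le_mul_of_nonneg_left (hK2 R hR) hK0
  have h4 := hK1 1 1 R one_ne_zero le_rfl
  have h5 : K1 * sigmaBound 3 1 ≤ K1 * sigmaBound 3 1 * (1 + Real.log R) :=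
    le_mul_of_one_le_right (by positivity) (by linarith)
  rw [abs_le] at h3 h4 ⊢
  constructor <;> linarith

/-- The terms with `x = y = z`, which are all equal to `1`, leave a single sum over `e`. -/
theorem exists_abs_diagonal_quadTerm_le :
    ∃ K : ℝ, 0 ≤ K ∧ ∀ R : ℕ, 1 ≤ R →
      |∑ x ∈ Ioc 0 R, ∑ e ∈ Ioc 0 R, quadTerm R x x x e| ≤ K * (1 + Real.log R) := by
  obtain ⟨K2, hK20, hK2⟩ := exists_sum_abs_tripleWeight_le
  refine ⟨K2, hK20, fun R hR => ?_⟩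
  rw [sum_eq_single 1]
  · refine (abs_sum_le_sum_abs _ _).trans ((sum_le_sum fun e _ => ?_).trans (hK2 R hR))
    have h1 : |quadTerm R 1 1 1 e| ≤ |sqfMul tripleWeight e| := by
      rw [quadTerm]
      split_ifs
      · simp [sqfMul_one]
      · simp
    exact h1.trans (le_mul_of_one_le_right (abs_nonneg _) (one_le_sigmaBound (by norm_num) e))
  · intro x _ hx
    exact sum_eq_zero fun e _ => quadTerm_eq_zero_of_ne_one R x e hx
  · intro h
    simp at h
    omega

/-- The third moment of the short divisor sum at a random integer is `(3 / 4) log² R` up to lower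
order terms. -/
theorem exists_abs_quadSum_sub_le :
    ∃ K : ℝ, 0 ≤ K ∧ ∀ Z R : ℕ, 1 ≤ Z → Z * Z ≤ R →
      |quadSum R - 3 / 4 * Real.log (R / ((Z : ℝ) * Z)) ^ 2| ≤
        K * ((1 + Real.log R) * (1 + Real.log Z) +
          (Z : ℝ) ^ (-(1 / 8) : ℝ) * (1 + Real.log R) ^ 2) := by
  obtain ⟨K0, hK00, hK0⟩ := exists_abs_orderedSum_sub_log_sq_le
  obtain ⟨K1, hK10, hK1⟩ := exists_abs_repeated_quadTerm_le
  obtain ⟨K2, hK20, hK2⟩ := exists_abs_diagonal_quadTerm_le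
  refine ⟨6 * K0 + 3 * K1 + K2, by positivity, fun Z R hZ hZR => ?_⟩
  have hR : 1 ≤ R := (Nat.one_le_iff_ne_zero.mpr (by positivity)).trans hZR
  have h := sum_symmetric_eq (Ioc 0 R) (fun x y z => ∑ e ∈ Ioc 0 R, quadTerm R x y z e)
    (fun x y z => sum_congr rfl fun e _ => quadTerm_swap_left R x y z e)
    (fun x y z => sum_congr rfl fun e _ => quadTerm_swap_right R x y z e)
  simp only [sum_decreasing_quadTerm] at h
  have h0 := hK0 Z R hZ hZR
  have h1 := hK1 R hR
  have h2 := hK2 R hR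
  have hlog := Real.log_natCast_nonneg R
  have hlogZ := Real.log_natCast_nonneg Z
  have hab : 1 + Real.log R ≤ (1 + Real.log R) * (1 + Real.log Z) +
      (Z : ℝ) ^ (-(1 / 8) : ℝ) * (1 + Real.log R) ^ 2 := by
    have h3 : 1 + Real.log R ≤ (1 + Real.log R) * (1 + Real.log Z) :=
      le_mul_of_one_le_right (by linarith) (by linarith)
    have h4 : 0 ≤ (Z : ℝ) ^ (-(1 / 8) : ℝ) * (1 + Real.log R) ^ 2 := by positivity
    linarith
  have m1 := mul_le_mul_of_nonneg_left hab hK10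
  have m2 := mul_le_mul_of_nonneg_left hab hK20
  rw [quadSum, h]
  rw [abs_le] at h0 h1 h2 ⊢
  constructor <;> linarith

/-! ### Periodic means and local factors -/

/-- The mean value of `f` over the residues `0, …, Q - 1`. -/
noncomputable def periodMean (Q : ℕ) (f : ℕ → ℝ) : ℝ := (∑ n ∈ range Q, f n) / Q

theorem periodMean_congr {Q : ℕ} {f g : ℕ → ℝ} (h : ∀ n, f n = g n) :
    periodMean Q f = periodMean Q g := by
  rw [funext h]

theorem periodMean_add (Q : ℕ) (f g : ℕ → ℝ) :
    periodMean Q (fun n => f n + g n) = periodMean Q f + periodMean Q g := by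
  simp only [periodMean, sum_add_distrib, add_div]

theorem periodMean_const_mul (Q : ℕ) (c : ℝ) (f : ℕ → ℝ) :
    periodMean Q (fun n => c * f n) = c * periodMean Q f := by
  simp only [periodMean, ← mul_sum, mul_div_assoc]

theorem periodMean_sum (Q : ℕ) {ι : Type*} (s : Finset ι) (f : ι → ℕ → ℝ) :
    periodMean Q (fun n => ∑ i ∈ s, f i n) = ∑ i ∈ s, periodMean Q (f i) := by
  simp only [periodMean]
  rw [sum_comm, sum_div]

theorem periodMean_const {Q : ℕ} (hQ : Q ≠ 0) (c : ℝ) : periodMean Q (fun _ => c) = c := by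
  have : (Q : ℝ) ≠ 0 := by exact_mod_cast hQ
  simp only [periodMean, sum_const, card_range, nsmul_eq_mul]
  field_simp

theorem abs_periodMean_le {Q : ℕ} {f g : ℕ → ℝ} (h : ∀ n, |f n| ≤ g n) :
    |periodMean Q f| ≤ periodMean Q g := by
  rw [periodMean, abs_div, Nat.abs_cast, periodMean]
  gcongr
  exact (abs_sum_le_sum_abs _ _).trans (sum_le_sum fun n _ => h n)

/-- The Chinese remainder theorem: functions with coprime periods are independent. -/
theorem periodMean_mul {m n : ℕ} (hm : 0 < m) (hn : 0 < n) (h : m.Coprime n) (f g : ℕ → ℝ)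
    (hf : ∀ a, f (a % m) = f a) (hg : ∀ a, g (a % n) = g a) :
    periodMean (m * n) (fun a => f a * g a) = periodMean m f * periodMean n g := by
  have key : ∑ a ∈ range (m * n), f a * g a = ∑ x ∈ range m ×ˢ range n, f x.1 * g x.2 := by
    refine sum_nbij (fun a => (a % m, a % n)) ?_ ?_ ?_ ?_
    · intro a _
      simp only [mem_product, mem_range]
      exact ⟨Nat.mod_lt _ hm, Nat.mod_lt _ hn⟩
    · intro a ha b hb hab
      simp only [coe_range, Set.mem_Iio, Prod.mk.injEq] at ha hb hab
      exact Nat.ModEq.eq_of_lt_of_lt ((Nat.modEq_and_modEq_iff_modEq_mul h).mp hab) ha hb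
    · rintro ⟨b, c⟩ hbc
      simp only [coe_product, coe_range, Set.mem_prod, Set.mem_Iio] at hbc
      refine ⟨Nat.chineseRemainder h b c, ?_, ?_⟩
      · simpa using Nat.chineseRemainder_lt_mul h b c hm.ne' hn.ne'
      · have h1 := (Nat.chineseRemainder h b c).2
        exact Prod.ext (Eq.trans h1.1 (Nat.mod_eq_of_lt hbc.1))
          (Eq.trans h1.2 (Nat.mod_eq_of_lt hbc.2))
    · intro a _
      simp only [hf, hg]
  simp only [periodMean]
  rw [key, sum_product, Nat.cast_mul, div_mul_div_comm, sum_mul_sum]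

/-- `periodMean_mul` for a finite set of primes. -/
theorem periodMean_prod (P : Finset ℕ) (hP : ∀ p ∈ P, p.Prime) (f : ℕ → ℕ → ℝ)
    (hf : ∀ p ∈ P, ∀ a, f p (a % p) = f p a) :
    periodMean (∏ p ∈ P, p) (fun a => ∏ p ∈ P, f p a) = ∏ p ∈ P, periodMean p (f p) := by
  induction P using Finset.induction_on with
  | empty => simp [periodMean]
  | insert q P hq ih =>
    have hP' : ∀ p ∈ P, p.Prime := fun p hp => hP p (mem_insert_of_mem hp)
    have hqp := hP q (mem_insert_self q P)
    have hf' : ∀ p ∈ P, ∀ a, f p (a % p) = f p a := fun p hp => hf p (mem_insert_of_mem hp)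
    simp only [prod_insert hq]
    rw [periodMean_mul hqp.pos (prod_pos fun p hp => (hP' p hp).pos), ih hP' hf']
    · exact Nat.Coprime.prod_right fun p hp => (Nat.coprime_primes hqp (hP' p hp)).mpr
        fun h => hq (h ▸ hp)
    · exact hf q (mem_insert_self q P)
    · intro a
      refine prod_congr rfl fun p hp => ?_
      rw [← hf' p hp, ← hf' p hp a, Nat.mod_mod_of_dvd _ (dvd_prod_of_mem _ hp)]

/-- The mean over a period is invariant under translation. -/
theorem periodMean_shift (Q : ℕ) (f : ℕ → ℝ) (hf : ∀ a, f (a + Q) = f a) (j : ℕ) :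
    periodMean Q (fun a => f (a + j)) = periodMean Q f := by
  induction j with
  | zero => rfl
  | succ j ih =>
    rw [← ih, periodMean, periodMean]
    congr 1
    have h := sum_range_succ' (fun a => f (a + j)) Q
    rw [sum_range_succ, add_comm Q j, hf j] at h
    simp only [zero_add] at h
    have h3 : ∀ a, f (a + (j + 1)) = f (a + 1 + j) := fun a => by congr 1; ring
    simp only [h3]
    linarith

/-- The value at `p` of the multiplicative function `r ↦ μ²(r) / φ(r) ∑_{d ∣ (r, n)} d μ(d)`. -/
noncomputable def localValue (n p : ℕ) : ℝ := if p ∣ n then -1 else phiInv p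

/-- The mean over `n` modulo `p` of the product of the values at `p` attached to the translates
`n + j i` with `i ∈ S`. -/
noncomputable def localMean {ι : Type*} (p : ℕ) (j : ι → ℕ) (S : Finset ι) : ℝ :=
  periodMean p (fun a => ∏ i ∈ S, localValue (a + j i) p)

theorem localValue_mod (n j p : ℕ) : localValue (n % p + j) p = localValue (n + j) p := by
  have : p ∣ n % p + j ↔ p ∣ n + j := by
    rw [Nat.dvd_iff_mod_eq_zero, Nat.dvd_iff_mod_eq_zero, Nat.mod_add_mod]
  simp only [localValue, this]

theorem sqfMul_eq_prod_primesLE (u : ℕ → ℝ) {r R : ℕ} (hr : r ∈ Ioc 0 R) (hs : Squarefree r) :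
    sqfMul u r = ∏ p ∈ Nat.primesLE R, if p ∣ r then u p else 1 := by
  rw [mem_Ioc] at hr
  rw [sqfMul_apply, if_pos hs, ← prod_filter]
  refine prod_congr ?_ fun _ _ => rfl
  ext p
  simp only [Nat.mem_primeFactors, mem_filter, Nat.mem_primesLE]
  constructor
  · rintro ⟨h1, h2, h3⟩
    exact ⟨⟨(Nat.le_of_dvd hr.1 h2).trans hr.2, h1⟩, h2⟩
  · rintro ⟨⟨h1, h2⟩, h3⟩
    exact ⟨h2, h3, hr.1.ne'⟩

theorem localMean_empty {ι : Type*} {p : ℕ} (hp : p.Prime) (j : ι → ℕ) : localMean p j ∅ = 1 := by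
  simp only [localMean, prod_empty]
  exact periodMean_const hp.ne_zero 1

/-- The mean of a product of translates factors over the primes. -/
theorem periodMean_prod_sqfMul {ι : Type*} [Fintype ι] (R : ℕ) (j r : ι → ℕ)
    (hr : ∀ i, r i ∈ Ioc 0 R) (hs : ∀ i, Squarefree (r i)) :
    periodMean (primorial R) (fun n => ∏ i, sqfMul (localValue (n + j i)) (r i)) =
      ∏ p ∈ Nat.primesLE R, localMean p j {i | p ∣ r i} := by
  rw [primorial_eq_prod_primesLE]
  simp only [localMean]
  rw [← periodMean_prod]
  · refine periodMean_congr fun n => ?_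
    simp only [prod_filter]
    rw [prod_comm]
    exact prod_congr rfl fun i _ => sqfMul_eq_prod_primesLE _ (hr i) (hs i)
  · intro p hp
    exact (Nat.mem_primesLE.mp hp).2
  · intro p _ a
    exact prod_congr rfl fun i _ => localValue_mod a (j i) p

/-- The mean of a function which takes the value `a` on one residue class and `b` on the others. -/
theorem periodMean_dvd_shift {p : ℕ} (hp : 0 < p) (j : ℕ) (a b : ℝ) :
    periodMean p (fun n => if p ∣ n + j then a else b) = (a + (p - 1) * b) / p := by
  rw [periodMean_shift p (fun n => if p ∣ n then a else b) (fun n => by simp) j, periodMean]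
  congr 1
  obtain ⟨q, rfl⟩ := Nat.exists_eq_succ_of_ne_zero hp.ne'
  rw [sum_range_succ']
  have h : ∀ k ∈ range q, (if q.succ ∣ k + 1 then a else b) = b := by
    intro k hk
    rw [mem_range] at hk
    exact if_neg fun h => absurd (Nat.le_of_dvd k.succ_pos h) (by omega)
  rw [sum_congr rfl h]
  simp
  ring

/-- The local mean when all the translates agree. -/
theorem localMean_of_eq {ι : Type*} {p : ℕ} (hp : p.Prime) (j : ι → ℕ) (S : Finset ι) (j₀ : ℕ)
    (h : ∀ i ∈ S, j i = j₀) :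
    localMean p j S = ((-1) ^ #S + (p - 1) * phiInv p ^ #S) / p := by
  rw [localMean, ← periodMean_dvd_shift hp.pos j₀]
  refine periodMean_congr fun n => ?_
  rw [prod_congr rfl fun i hi => by rw [h i hi], prod_const, localValue]
  split_ifs <;> rfl

theorem phiInv_pos {p : ℕ} (hp : p.Prime) : 0 < phiInv p := by
  have := (prime_rpow_facts hp).2
  exact one_div_pos.mpr (by linarith)

theorem phiInv_le_two_div {p : ℕ} (hp : p.Prime) : phiInv p ≤ 2 / p := by
  have := (prime_rpow_facts hp).2
  rw [phiInv, div_le_div_iff₀ (by linarith) (by linarith)]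
  linarith

theorem phiInv_le_one {p : ℕ} (hp : p.Prime) : phiInv p ≤ 1 := by
  have := (prime_rpow_facts hp).2
  rw [phiInv, div_le_one (by linarith)]
  linarith

/-- The values `-1` and `1 / (p - 1)` average to zero; this is the source of all cancellation
between different moduli. -/
theorem localMean_of_card_eq_one {ι : Type*} {p : ℕ} (hp : p.Prime) (j : ι → ℕ) {S : Finset ι}
    (hS : #S = 1) : localMean p j S = 0 := by
  obtain ⟨i, rfl⟩ := card_eq_one.mp hS
  have := (prime_rpow_facts hp).2
  have h1 : (p : ℝ) - 1 ≠ 0 := by linarith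
  rw [localMean_of_eq hp j _ (j i) (by simp), hS, phiInv]
  field_simp
  ring

theorem localMean_of_card_eq_two {ι : Type*} {p : ℕ} (hp : p.Prime) (j : ι → ℕ) {S : Finset ι}
    (j₀ : ℕ) (h : ∀ i ∈ S, j i = j₀) (hS : #S = 2) : localMean p j S = phiInv p := by
  have := (prime_rpow_facts hp).2
  have h1 : (p : ℝ) - 1 ≠ 0 := by linarith
  rw [localMean_of_eq hp j _ j₀ h, hS, phiInv]
  field_simp
  ring

theorem localMean_of_card_eq_three {ι : Type*} {p : ℕ} (hp : p.Prime) (j : ι → ℕ) {S : Finset ι}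
    (j₀ : ℕ) (h : ∀ i ∈ S, j i = j₀) (hS : #S = 3) : localMean p j S = tripleWeight p := by
  have := (prime_rpow_facts hp).2
  have h1 : (p : ℝ) - 1 ≠ 0 := by linarith
  rw [localMean_of_eq hp j _ j₀ h, hS, phiInv, tripleWeight]
  field_simp
  ring

theorem abs_localValue_le_one {p : ℕ} (hp : p.Prime) (n : ℕ) : |localValue n p| ≤ 1 := by
  rw [localValue]
  split_ifs
  · simp
  · rw [abs_of_pos (phiInv_pos hp)]
    exact phiInv_le_one hp

/-- Outside the residue classes where `p` divides one of the translates, all factors are `1 / (p -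
1)`. -/
theorem abs_prod_localValue_le {ι : Type*} {p : ℕ} (hp : p.Prime) (j : ι → ℕ) {S : Finset ι}
    (hS : 2 ≤ #S) (B : ℝ) (hB0 : 0 ≤ B) (a : ℕ)
    (hB : (∃ i ∈ S, p ∣ a + j i) → |∏ i ∈ S, localValue (a + j i) p| ≤ B) :
    |∏ i ∈ S, localValue (a + j i) p| ≤
      B * (∑ i ∈ S, if p ∣ a + j i then (1 : ℝ) else 0) + phiInv p ^ 2 := by
  have hnn : ∀ i ∈ S, (0 : ℝ) ≤ if p ∣ a + j i then (1 : ℝ) else 0 := by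
    intro i _
    split_ifs <;> norm_num
  by_cases h : ∃ i ∈ S, p ∣ a + j i
  · have h1 := hB h
    obtain ⟨i, hi, hpi⟩ := h
    have h2 : (1 : ℝ) ≤ ∑ i ∈ S, if p ∣ a + j i then (1 : ℝ) else 0 := by
      refine le_trans ?_ (single_le_sum hnn hi)
      simp [hpi]
    nlinarith [sq_nonneg (phiInv p)]
  · push Not at h
    rw [prod_congr rfl fun i hi => by rw [localValue, if_neg (h i hi)], prod_const, abs_pow,
      abs_of_pos (phiInv_pos hp)]
    have h1 := pow_le_pow_of_le_one (phiInv_pos hp).le (phiInv_le_one hp) hS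
    have h2 := mul_nonneg hB0 (sum_nonneg hnn)
    linarith

/-- A bound `B` on the classes where `p` divides a translate contributes with their density. -/
theorem abs_localMean_le_of {ι : Type*} {p : ℕ} (hp : p.Prime) (j : ι → ℕ) {S : Finset ι}
    (hS : 2 ≤ #S) (B : ℝ) (hB0 : 0 ≤ B)
    (hB : ∀ a, (∃ i ∈ S, p ∣ a + j i) → |∏ i ∈ S, localValue (a + j i) p| ≤ B) :
    |localMean p j S| ≤ B * (#S / p) + 4 / (p : ℝ) ^ 2 := by
  have h1 : |localMean p j S| ≤ _ :=
    abs_periodMean_le fun a => abs_prod_localValue_le hp j hS B hB0 a (hB a)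
  refine h1.trans ?_
  rw [periodMean_add, periodMean_const_mul, periodMean_sum, periodMean_const hp.ne_zero]
  have h2 : ∀ i ∈ S, periodMean p (fun n => if p ∣ n + j i then (1 : ℝ) else 0) = 1 / p := by
    intro i _
    rw [periodMean_dvd_shift hp.pos]
    simp
  rw [sum_congr rfl h2, sum_const, nsmul_eq_mul, mul_one_div]
  have h3 : phiInv p ^ 2 ≤ (2 / p) ^ 2 := pow_le_pow_left₀ (phiInv_pos hp).le (phiInv_le_two_div hp) 2
  rw [div_pow] at h3
  linarith

/-- The trivial bound for a local mean involving at least two translates. -/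
theorem abs_localMean_le {ι : Type*} {p : ℕ} (hp : p.Prime) (j : ι → ℕ) {S : Finset ι}
    (hS : 2 ≤ #S) : |localMean p j S| ≤ (#S + 4) / p := by
  have h := abs_localMean_le_of hp j hS 1 zero_le_one fun a _ => by
    rw [abs_prod]
    exact prod_le_one (fun _ _ => abs_nonneg _) fun i _ => abs_localValue_le_one hp _
  have hp2 := (prime_rpow_facts hp).2
  have h2 : 4 / (p : ℝ) ^ 2 ≤ 4 / p := by
    apply div_le_div_of_nonneg_left (by norm_num) (by linarith)
    nlinarith
  rw [add_div]
  linarith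

/-- If two of the translates are incongruent modulo `p`, the local mean is quadratically small. -/
theorem abs_localMean_le_of_not_modEq {ι : Type*} {p : ℕ} (hp : p.Prime) (j : ι → ℕ) {S : Finset ι}
    {i₁ i₂ : ι} (h₁ : i₁ ∈ S) (h₂ : i₂ ∈ S) (h : ¬ j i₁ ≡ j i₂ [MOD p]) :
    |localMean p j S| ≤ (2 * #S + 4) / (p : ℝ) ^ 2 := by
  classical
  have hne : i₁ ≠ i₂ := fun h' => h (h' ▸ rfl)
  have hS : 2 ≤ #S := by
    rw [← card_pair hne]
    exact card_le_card (by simp [insert_subset_iff, h₁, h₂])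
  have h := abs_localMean_le_of hp j hS (phiInv p) (phiInv_pos hp).le fun a _ => by
    obtain ⟨i, hi, hpi⟩ : ∃ i ∈ S, ¬ p ∣ a + j i := by
      by_contra! hc
      apply h
      have e1 := (Nat.modEq_zero_iff_dvd.mpr (hc i₁ h₁)).trans
        (Nat.modEq_zero_iff_dvd.mpr (hc i₂ h₂)).symm
      exact Nat.ModEq.add_left_cancel' a e1
    rw [abs_prod, ← mul_prod_erase S _ hi, localValue, if_neg hpi, abs_of_pos (phiInv_pos hp)]
    exact mul_le_of_le_one_right (phiInv_pos hp).le
      (prod_le_one (fun _ _ => abs_nonneg _) fun i _ => abs_localValue_le_one hp _)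
  have hp2 := (prime_rpow_facts hp).2
  refine h.trans ?_
  have h3 : phiInv p * (#S / p) ≤ 2 / p * (#S / p) :=
    mul_le_mul_of_nonneg_right (phiInv_le_two_div hp) (by positivity)
  have h4 : 2 / (p : ℝ) * (#S / p) + 4 / (p : ℝ) ^ 2 = (2 * #S + 4) / (p : ℝ) ^ 2 := by
    field_simp
  linarith

/-! ### Rankin's trick for correlations -/

section Patterns

variable {ι : Type*} [Fintype ι] [DecidableEq ι]

/-- The product of the primes up to `R` at which the tuple `r` has divisibility pattern `S₀`. -/
def patternProd (R : ℕ) (S₀ : Finset ι) (r : ι → ℕ) : ℕ :=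
  ∏ p ∈ Nat.primesLE R with (univ.filter fun i => p ∣ r i) = S₀, p

theorem prime_dvd_patternProd_iff {R p : ℕ} (S₀ : Finset ι) (r : ι → ℕ) (hp : p ∈ Nat.primesLE R) :
    p ∣ patternProd R S₀ r ↔ univ.filter (fun i => p ∣ r i) = S₀ := by
  have hpp := (Nat.mem_primesLE.mp hp).2
  rw [patternProd, Prime.dvd_finsetProd_iff hpp.prime]
  constructor
  · rintro ⟨q, hq, hpq⟩
    rw [mem_filter] at hq
    rw [(Nat.prime_dvd_prime_iff_eq hpp (Nat.mem_primesLE.mp hq.1).2).mp hpq]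
    exact hq.2
  · intro h
    exact ⟨p, mem_filter.mpr ⟨hp, h⟩, dvd_rfl⟩

theorem patternProd_dvd {R : ℕ} {S₀ : Finset ι} {i : ι} (hi : i ∈ S₀) (r : ι → ℕ) :
    patternProd R S₀ r ∣ r i := by
  refine Finset.prod_primes_dvd _ (fun p hp => ?_) fun p hp => ?_
  · exact (Nat.mem_primesLE.mp (mem_filter.mp hp).1).2.prime
  · have h := (mem_filter.mp hp).2
    rw [← h] at hi
    exact (mem_filter.mp hi).2

/-- Sums over tuples of squarefree moduli of functions of the divisibility patterns are bounded by
Euler products; the pattern `S₀` is kept apart, as a sum over the modulus it determines. -/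
theorem sum_prod_pattern_le (R : ℕ) (G : ℕ → Finset ι → ℝ) (hG : ∀ p S, p.Prime → 0 ≤ G p S)
    (hG1 : ∀ p, p.Prime → G p ∅ = 1) {S₀ : Finset ι} {i₁ : ι} (hi₁ : i₁ ∈ S₀) :
    ∑ r ∈ Fintype.piFinset (fun _ : ι => Ioc 0 R) with ∀ i, Squarefree (r i),
      ∏ p ∈ Nat.primesLE R, G p {i | p ∣ r i} ≤
    (∑ x ∈ Ioc 0 R, sqfMul (fun p => G p S₀) x) *
      ∏ p ∈ Nat.primesLE R, ∑ S ∈ univ.erase S₀, G p S := by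
  have hprime : ∀ p ∈ Nat.primesLE R, p.Prime := fun p hp => (Nat.mem_primesLE.mp hp).2
  have hne : (∅ : Finset ι) ≠ S₀ := fun h => by simp [← h] at hi₁
  -- expanding the product on the right gives a sum over pairs of a modulus and a family of patterns
  rw [prod_sum, sum_mul_sum, ← sum_product']
  set φ : (ι → ℕ) → (p : ℕ) → p ∈ Nat.primesLE R → Finset ι := fun r p _ =>
    if univ.filter (fun i => p ∣ r i) = S₀ then ∅ else univ.filter (fun i => p ∣ r i) with hφ
  set s := {r ∈ Fintype.piFinset (fun _ : ι => Ioc 0 R) | ∀ i, Squarefree (r i)} with hs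
  have hmem : ∀ r ∈ s, ∀ i, r i ∈ Ioc 0 R ∧ Squarefree (r i) := by
    intro r hr i
    rw [hs, mem_filter, Fintype.mem_piFinset] at hr
    exact ⟨hr.1 i, hr.2 i⟩
  have hx : ∀ r ∈ s, patternProd R S₀ r ∈ Ioc 0 R ∧ Squarefree (patternProd R S₀ r) := by
    intro r hr
    have h1 := hmem r hr i₁
    have h2 := patternProd_dvd (R := R) hi₁ r
    have h3 := mem_Ioc.mp h1.1
    exact ⟨mem_Ioc.mpr ⟨Nat.pos_of_dvd_of_pos h2 h3.1, (Nat.le_of_dvd h3.1 h2).trans h3.2⟩,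
      h1.2.squarefree_of_dvd h2⟩
  -- the modulus `patternProd R S₀ r` and the patterns other than `S₀` determine `r`
  have hinj : Set.InjOn (fun r => (patternProd R S₀ r, φ r)) s := by
    intro r hr r' hr' h
    simp only [Prod.mk.injEq] at h
    have hpat : ∀ p ∈ Nat.primesLE R, univ.filter (fun i => p ∣ r i) = univ.filter (fun i => p ∣ r' i) := by
      intro p hp
      have h1 := prime_dvd_patternProd_iff S₀ r hp
      have h2 := prime_dvd_patternProd_iff S₀ r' hp
      rw [h.1, h2] at h1
      have h3 := congrFun (congrFun h.2 p) hp
      simp only [hφ] at h3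
      by_cases h4 : univ.filter (fun i => p ∣ r i) = S₀
      · rw [h4, h1.mpr h4]
      · rwa [if_neg h4, if_neg fun h5 => h4 (h1.mp h5)] at h3
    funext i
    have hi := hmem r hr i
    have hi' := hmem r' hr' i
    rw [Nat.Squarefree.ext_iff hi.2 hi'.2]
    intro p hp
    have hle : ∀ m ∈ Ioc 0 R, p ∣ m → p ∈ Nat.primesLE R := by
      intro m hm hpm
      rw [mem_Ioc] at hm
      exact Nat.mem_primesLE.mpr ⟨(Nat.le_of_dvd hm.1 hpm).trans hm.2, hp⟩
    constructor
    · intro hpr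
      have h5 : i ∈ univ.filter (fun i => p ∣ r i) := by simpa using hpr
      rw [hpat p (hle _ hi.1 hpr)] at h5
      simpa using h5
    · intro hpr
      have h5 : i ∈ univ.filter (fun i => p ∣ r' i) := by simpa using hpr
      rw [← hpat p (hle _ hi'.1 hpr)] at h5
      simpa using h5
  have hval : ∀ r ∈ s, ∏ p ∈ Nat.primesLE R, G p {i | p ∣ r i} =
      sqfMul (fun p => G p S₀) (patternProd R S₀ r) *
        ∏ p ∈ (Nat.primesLE R).attach, G p.1 (φ r p.1 p.2) := by
    intro r hr
    rw [sqfMul_eq_prod_primesLE _ (hx r hr).1 (hx r hr).2,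
      ← prod_attach (Nat.primesLE R) (fun p => G p {i | p ∣ r i}),
      ← prod_attach (Nat.primesLE R) (fun p => if p ∣ patternProd R S₀ r then G p S₀ else 1),
      ← prod_mul_distrib]
    refine prod_congr rfl fun p _ => ?_
    have h1 := prime_dvd_patternProd_iff S₀ r p.2
    simp only [hφ]
    by_cases h4 : univ.filter (fun i => p.1 ∣ r i) = S₀
    · rw [if_pos (h1.mpr h4), if_pos h4, hG1 _ (hprime _ p.2), mul_one, h4]
    · rw [if_neg (fun h5 => h4 (h1.mp h5)), if_neg h4, one_mul]
  rw [sum_congr rfl hval]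
  refine le_trans (le_of_eq ?_) (sum_le_sum_of_subset_of_nonneg
    (s := s.image fun r => (patternProd R S₀ r, φ r)) ?_ ?_)
  · rw [sum_image hinj]
  · intro y hy
    obtain ⟨r, hr, rfl⟩ := mem_image.mp hy
    rw [mem_product, mem_pi]
    refine ⟨(hx r hr).1, fun p hp => ?_⟩
    simp only [hφ]
    split_ifs with h4
    · exact mem_erase.mpr ⟨hne, mem_univ _⟩
    · exact mem_erase.mpr ⟨h4, mem_univ _⟩
  · intro y _ _
    exact mul_nonneg (sqfMul_nonneg _ fun p hp => hG p _ hp)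
      (prod_nonneg fun p _ => hG _ _ (hprime _ p.2))

theorem prod_primesLE_one_add_le {C : ℝ} (hC : 0 ≤ C) (R : ℕ) :
    ∏ p ∈ Nat.primesLE R, (1 + C * (p : ℝ) ^ (-(7 / 4) : ℝ)) ≤
      Real.exp (C * ∑' n : ℕ, (n : ℝ) ^ (-(7 / 4) : ℝ)) := by
  have hs := summable_natCast_rpow_neg (a := 7 / 4) (by norm_num)
  calc _ ≤ ∏ p ∈ Nat.primesLE R, Real.exp (C * (p : ℝ) ^ (-(7 / 4) : ℝ)) := by
        refine prod_le_prod (fun p _ => by positivity) fun p _ => ?_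
        rw [add_comm]
        exact Real.add_one_le_exp _
    _ = Real.exp (C * ∑ p ∈ Nat.primesLE R, (p : ℝ) ^ (-(7 / 4) : ℝ)) := by
        rw [← Real.exp_sum, mul_sum]
    _ ≤ _ := by
        gcongr
        exact hs.sum_le_tsum _ fun n _ => by positivity

theorem prod_primesLE_ite_dvd_le {C : ℝ} (hC : 0 ≤ C) (R : ℕ) {k : ℕ} (hk : k ≠ 0) :
    ∏ p ∈ Nat.primesLE R, (if p ∣ k then 1 + C * (p : ℝ) ^ (-(3 / 4) : ℝ) else 1) ≤
      sigmaBound C k := by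
  have hsub : {p ∈ Nat.primesLE R | p ∣ k} ⊆ k.primeFactors := by
    intro p hp
    rw [mem_filter, Nat.mem_primesLE] at hp
    exact Nat.mem_primeFactors.mpr ⟨hp.1.2, hp.2, hk⟩
  have h1 : ∀ p : ℕ, 1 ≤ 1 + C * (p : ℝ) ^ (-(3 / 4) : ℝ) := fun p => by
    have : 0 ≤ C * (p : ℝ) ^ (-(3 / 4) : ℝ) := by positivity
    linarith
  rw [← prod_filter, sigmaBound, ← prod_sdiff hsub]
  exact le_mul_of_one_le_left (prod_nonneg fun p _ => zero_le_one.trans (h1 p))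
    (Finset.one_le_prod fun p _ => h1 p)

variable (ι) in
/-- A bound for the total weight of the patterns involving at least two indices. -/
noncomputable def patternConst : ℝ := 2 ^ Fintype.card ι * (2 * Fintype.card ι + 4)

theorem patternConst_nonneg (ι : Type*) [Fintype ι] : 0 ≤ patternConst ι := by
  unfold patternConst
  positivity

/-- The local factor of the Euler product bounding the sum over the moduli: only the empty pattern
and patterns with at least two indices contribute, and these give `O(p^{-7/4})`, or `O(p^{-3/4})` if
`p` divides `k`. -/
theorem sum_patterns_le {p k : ℕ} (hp : p.Prime) (j : ι → ℕ) (S₀ : Finset ι) (i₀ : ι)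
    (h : ∀ S, S ≠ S₀ → 2 ≤ #S → ¬ p ∣ k → ∃ i ∈ S, ∃ i' ∈ S, ¬ j i ≡ j i' [MOD p]) :
    ∑ S ∈ univ.erase S₀, |localMean p j S| * (if i₀ ∈ S then (p : ℝ) ^ (1 / 4 : ℝ) else 1) ≤
      (1 + patternConst ι * (p : ℝ) ^ (-(7 / 4) : ℝ)) *
        (if p ∣ k then 1 + patternConst ι * (p : ℝ) ^ (-(3 / 4) : ℝ) else 1) := by
  obtain ⟨hp0, hp2⟩ := prime_rpow_facts hp
  set q : ℝ := if p ∣ k then (p : ℝ) ^ (-(3 / 4) : ℝ) else (p : ℝ) ^ (-(7 / 4) : ℝ) with hq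
  have hq0 : 0 ≤ q := by
    rw [hq]
    split_ifs <;> positivity
  have hone : (1 : ℝ) ≤ (p : ℝ) ^ (1 / 4 : ℝ) := Real.one_le_rpow (by linarith) (by norm_num)
  have hpow : ∀ S : Finset ι, (if i₀ ∈ S then (p : ℝ) ^ (1 / 4 : ℝ) else 1) ≤
      (p : ℝ) ^ (1 / 4 : ℝ) := by
    intro S
    split_ifs
    · exact le_rfl
    · exact hone
  have hcard : ∀ S : Finset ι, (#S : ℝ) ≤ Fintype.card ι := fun S => by
    exact_mod_cast card_le_univ S
  have hterm : ∀ S ∈ (univ.erase S₀ : Finset (Finset ι)),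
      |localMean p j S| * (if i₀ ∈ S then (p : ℝ) ^ (1 / 4 : ℝ) else 1) ≤
        (if S = ∅ then 1 else 0) + (2 * Fintype.card ι + 4) * q := by
    intro S hS
    have hS0 := (mem_erase.mp hS).1
    have hnn : (0 : ℝ) ≤ (2 * Fintype.card ι + 4) * q := by positivity
    rcases Nat.lt_trichotomy #S 1 with h1 | h1 | h1
    · have : S = ∅ := card_eq_zero.mp (by omega)
      subst this
      rw [localMean_empty hp]
      simp
      positivity
    · rw [localMean_of_card_eq_one hp j h1]
      simp only [abs_zero, zero_mul]
      split_ifs <;> linarith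
    · have hSe : S ≠ ∅ := by
        rintro rfl
        simp at h1
      rw [if_neg hSe, zero_add]
      by_cases hpk : p ∣ k
      · have h3 := abs_localMean_le hp j (S := S) h1
        rw [hq, if_pos hpk]
        calc _ ≤ ((#S + 4) / (p : ℝ)) * (p : ℝ) ^ (1 / 4 : ℝ) :=
              mul_le_mul h3 (hpow S) (by split_ifs <;> positivity) (by positivity)
          _ = (#S + 4) * (p : ℝ) ^ (-(3 / 4) : ℝ) := by
              rw [show (-(3 / 4) : ℝ) = 1 / 4 - 1 by norm_num, Real.rpow_sub_one hp0.ne']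
              ring
          _ ≤ _ := by
              gcongr
              have := hcard S
              have h0 : (0 : ℝ) ≤ Fintype.card ι := by positivity
              linarith
      · obtain ⟨i, hi, i', hi', hii⟩ := h S hS0 h1 hpk
        have h3 := abs_localMean_le_of_not_modEq hp j hi hi' hii
        have hcS := hcard S
        have hcS0 : (0 : ℝ) ≤ #S := Nat.cast_nonneg _
        generalize (#S : ℝ) = m at h3 hcS hcS0
        rw [hq, if_neg hpk]
        calc _ ≤ ((2 * m + 4) / (p : ℝ) ^ 2) * (p : ℝ) ^ (1 / 4 : ℝ) :=
              mul_le_mul h3 (hpow S) (by split_ifs <;> positivity) (by positivity)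
          _ = (2 * m + 4) * (p : ℝ) ^ (-(7 / 4) : ℝ) := by
              rw [show (-(7 / 4) : ℝ) = 1 / 4 - 1 - 1 by norm_num, Real.rpow_sub_one hp0.ne',
                Real.rpow_sub_one hp0.ne']
              field_simp
          _ ≤ _ := by
              gcongr
  have hsum : ∑ S ∈ univ.erase S₀,
      |localMean p j S| * (if i₀ ∈ S then (p : ℝ) ^ (1 / 4 : ℝ) else 1) ≤
        1 + patternConst ι * q := by
    calc _ ≤ ∑ S ∈ univ.erase S₀, ((if S = ∅ then (1 : ℝ) else 0) +
            (2 * Fintype.card ι + 4) * q) := sum_le_sum hterm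
      _ ≤ ∑ S : Finset ι, ((if S = ∅ then (1 : ℝ) else 0) + (2 * Fintype.card ι + 4) * q) := by
          refine sum_le_sum_of_subset_of_nonneg (erase_subset _ _) fun S _ _ => ?_
          have hnn : (0 : ℝ) ≤ (2 * Fintype.card ι + 4) * q := by positivity
          split_ifs <;> linarith
      _ = _ := by
          rw [sum_add_distrib, sum_ite_eq' univ (∅ : Finset ι) (fun _ => (1 : ℝ)),
            if_pos (mem_univ _), sum_const, card_univ, Fintype.card_finset, patternConst]
          simp
          ring
  refine hsum.trans ?_
  have hc := patternConst_nonneg ι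
  have h7 : 0 ≤ patternConst ι * (p : ℝ) ^ (-(7 / 4) : ℝ) := by positivity
  have h3 : 0 ≤ patternConst ι * (p : ℝ) ^ (-(3 / 4) : ℝ) := by positivity
  rw [hq]
  split_ifs <;> nlinarith

/-- Rankin's trick for correlations: the sum over the moduli, weighted by the fourth root of one of
them, of the absolute means is bounded by an Euler product over the shifts' differences. -/
theorem exists_sum_abs_periodMean_le (ι : Type*) [Fintype ι] [DecidableEq ι] :
    ∃ K : ℝ, 0 ≤ K ∧ ∀ (R k : ℕ) (j : ι → ℕ) (S₀ : Finset ι) (i₀ i₁ : ι), i₁ ∈ S₀ → k ≠ 0 →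
      (∀ p S, p.Prime → S ≠ S₀ → 2 ≤ #S → ¬ p ∣ k → ∃ i ∈ S, ∃ i' ∈ S, ¬ j i ≡ j i' [MOD p]) →
      ∑ r ∈ Fintype.piFinset (fun _ : ι => Ioc 0 R),
        |periodMean (primorial R) (fun n => ∏ i, sqfMul (localValue (n + j i)) (r i))| *
          (r i₀ : ℝ) ^ (1 / 4 : ℝ) ≤
      (∑ x ∈ Ioc 0 R, sqfMul (fun p => |localMean p j S₀| *
        (if i₀ ∈ S₀ then (p : ℝ) ^ (1 / 4 : ℝ) else 1)) x) * (K * sigmaBound (patternConst ι) k) := by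
  have hc := patternConst_nonneg ι
  refine ⟨Real.exp (patternConst ι * ∑' n : ℕ, (n : ℝ) ^ (-(7 / 4) : ℝ)), by positivity, ?_⟩
  intro R k j S₀ i₀ i₁ hi₁ hk h
  set G : ℕ → Finset ι → ℝ := fun p S => |localMean p j S| *
    (if i₀ ∈ S then (p : ℝ) ^ (1 / 4 : ℝ) else 1) with hG
  have hG0 : ∀ p S, 0 ≤ G p S := fun p S =>
    mul_nonneg (abs_nonneg _) (by split_ifs <;> positivity)
  have hmain := sum_prod_pattern_le R G (fun p S _ => hG0 p S) (fun p hp => by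
    simp [hG, localMean_empty hp]) hi₁
  -- the weight `(r i₀)^{1/4}` is multiplicative too, so both factors are products over the primes
  have hL : ∑ r ∈ Fintype.piFinset (fun _ : ι => Ioc 0 R),
        |periodMean (primorial R) (fun n => ∏ i, sqfMul (localValue (n + j i)) (r i))| *
          (r i₀ : ℝ) ^ (1 / 4 : ℝ) =
      ∑ r ∈ Fintype.piFinset (fun _ : ι => Ioc 0 R) with ∀ i, Squarefree (r i),
        ∏ p ∈ Nat.primesLE R, G p {i | p ∣ r i} := by
    rw [sum_filter]
    refine sum_congr rfl fun r hr => ?_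
    rw [Fintype.mem_piFinset] at hr
    split_ifs with hs
    · rw [periodMean_prod_sqfMul R j r hr hs, abs_prod]
      have h1 : (r i₀ : ℝ) ^ (1 / 4 : ℝ) =
          ∏ p ∈ Nat.primesLE R, if p ∣ r i₀ then (p : ℝ) ^ (1 / 4 : ℝ) else 1 := by
        rw [← sqfMul_eq_prod_primesLE (fun p => (p : ℝ) ^ (1 / 4 : ℝ)) (hr i₀) (hs i₀),
          sqfMul_apply, if_pos (hs i₀), Real.finsetProd_rpow _ _ fun p _ => by positivity]
        congr 1
        rw [← Nat.cast_prod, Nat.prod_primeFactors_of_squarefree (hs i₀)]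
      rw [h1, ← prod_mul_distrib]
      refine prod_congr rfl fun p _ => ?_
      simp [hG]
    · push Not at hs
      obtain ⟨i, hi⟩ := hs
      have h0 : ∀ n, ∏ i, sqfMul (localValue (n + j i)) (r i) = 0 := fun n =>
        prod_eq_zero (mem_univ i) (sqfMul_of_not_squarefree _ hi)
      simp [h0, periodMean]
  rw [hL]
  refine hmain.trans ?_
  refine mul_le_mul_of_nonneg_left ?_ (sum_nonneg fun x _ => sqfMul_nonneg x fun p _ => hG0 p S₀)
  calc _ ≤ ∏ p ∈ Nat.primesLE R, ((1 + patternConst ι * (p : ℝ) ^ (-(7 / 4) : ℝ)) *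
        (if p ∣ k then 1 + patternConst ι * (p : ℝ) ^ (-(3 / 4) : ℝ) else 1)) := by
        refine prod_le_prod (fun p _ => sum_nonneg fun S _ => hG0 p S) fun p hp => ?_
        have hpp := (Nat.mem_primesLE.mp hp).2
        exact sum_patterns_le hpp j S₀ i₀ fun S h1 h2 h3 => h p S hpp h1 h2 h3
    _ ≤ _ := by
        rw [prod_mul_distrib]
        refine mul_le_mul (prod_primesLE_one_add_le hc R) (prod_primesLE_ite_dvd_le hc R hk)
          (prod_nonneg fun p _ => by split_ifs <;> positivity) (by positivity)

end Patterns

/-! ### Moments of the short divisor sum at a random integer -/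

/-- The part `∑_{V < r ≤ R} μ²(r) / φ(r) ∑_{d ∣ (r, n)} d μ(d)` of the short divisor sum. -/
noncomputable def truncSum (V R n : ℕ) : ℝ := ∑ r ∈ Ioc V R, sqfMul (localValue n) r

theorem prod_primesLE_eq_zero {R r p : ℕ} (hr : r ∈ Ioc 0 R) (hp : p.Prime) (hpr : p ∣ r)
    {f : ℕ → ℝ} (hf : f p = 0) : ∏ q ∈ Nat.primesLE R, f q = 0 := by
  rw [mem_Ioc] at hr
  exact prod_eq_zero (Nat.mem_primesLE.mpr ⟨(Nat.le_of_dvd hr.1 hpr).trans hr.2, hp⟩) hf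

theorem periodMean_sqfMul {R r : ℕ} (hr : r ∈ Ioc 0 R) (j : ℕ) :
    periodMean (primorial R) (fun n => sqfMul (localValue (n + j)) r) = if r = 1 then 1 else 0 := by
  split_ifs with h1
  · subst h1
    simp only [sqfMul_one]
    exact periodMean_const (primorial_ne_zero R) 1
  · by_cases hs : Squarefree r
    swap
    · simp [sqfMul_of_not_squarefree _ hs, periodMean]
    have h := periodMean_prod_sqfMul R (fun _ : Unit => j) (fun _ => r) (fun _ => hr) (fun _ => hs)
    simp only [Finset.univ_unique, prod_singleton] at h
    rw [h]
    obtain ⟨p, hp, hpr⟩ := Nat.exists_prime_and_dvd h1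
    refine prod_primesLE_eq_zero hr hp hpr ?_
    apply localMean_of_card_eq_one hp
    simp [hpr]

/-- Only the modulus `1` has a nonzero mean. -/
theorem periodMean_truncSum (V R j : ℕ) (hR : 1 ≤ R) :
    periodMean (primorial R) (fun n => truncSum V R (n + j)) = if V = 0 then 1 else 0 := by
  simp only [truncSum]
  rw [periodMean_sum, sum_congr rfl fun r hr => periodMean_sqfMul
    (mem_Ioc.mpr ⟨Nat.zero_lt_of_lt (mem_Ioc.mp hr).1, (mem_Ioc.mp hr).2⟩) j, sum_ite_eq']
  refine if_congr ?_ rfl rfl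
  rw [mem_Ioc]
  omega

/-- If `a ≠ b`, some prime divides exactly one of them, and its local factor vanishes. -/
theorem periodMean_sqfMul_mul {R a b : ℕ} (ha : a ∈ Ioc 0 R) (hb : b ∈ Ioc 0 R) (j : ℕ) :
    periodMean (primorial R)
      (fun n => sqfMul (localValue (n + j)) a * sqfMul (localValue (n + j)) b) =
      if a = b then sqfMul phiInv a else 0 := by
  by_cases hsa : Squarefree a
  swap
  · simp [sqfMul_of_not_squarefree _ hsa, periodMean]
  by_cases hsb : Squarefree b
  swap
  · have : a = b → sqfMul phiInv a = 0 := fun h => sqfMul_of_not_squarefree _ (h ▸ hsb)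
    simp only [sqfMul_of_not_squarefree _ hsb, periodMean]
    split_ifs with h
    · simp [this h]
    · simp
  have h := periodMean_prod_sqfMul R (fun _ : Fin 2 => j) ![a, b]
    (by simp [Fin.forall_fin_two, mem_Ioc.mp ha, mem_Ioc.mp hb]) (by simp [Fin.forall_fin_two, hsa, hsb])
  simp only [Fin.prod_univ_two, Matrix.cons_val_zero, Matrix.cons_val_one] at h
  rw [h]
  have hcard : ∀ p, #{i | p ∣ (![a, b] : Fin 2 → ℕ) i} =
      (if p ∣ a then 1 else 0) + if p ∣ b then 1 else 0 := by
    intro p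
    rw [card_filter, Fin.sum_univ_two]
    rfl
  split_ifs with hab
  · subst hab
    rw [sqfMul_eq_prod_primesLE _ ha hsa]
    refine prod_congr rfl fun p hp => ?_
    have hpp := (Nat.mem_primesLE.mp hp).2
    have hc := hcard p
    split_ifs with hpa
    · rw [if_pos hpa] at hc
      exact localMean_of_card_eq_two hpp _ j (fun _ _ => rfl) hc
    · rw [if_neg hpa] at hc
      rw [card_eq_zero.mp hc, localMean_empty hpp]
  · have : ∃ p, p.Prime ∧ ¬ (p ∣ a ↔ p ∣ b) := by
      by_contra! hc
      exact hab ((Nat.Squarefree.ext_iff hsa hsb).mpr hc)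
    obtain ⟨p, hp, hpab⟩ := this
    have hc : #{i | p ∣ (![a, b] : Fin 2 → ℕ) i} = 1 := by
      rw [hcard]
      split_ifs with h1 h2 h3 <;> tauto
    rcases em (p ∣ a) with h1 | h1
    · exact prod_primesLE_eq_zero ha hp h1 (localMean_of_card_eq_one hp _ hc)
    · exact prod_primesLE_eq_zero hb hp (by tauto) (localMean_of_card_eq_one hp _ hc)

/-- Distinct moduli are orthogonal. -/
theorem periodMean_truncSum_sq (V R j : ℕ) :
    periodMean (primorial R) (fun n => truncSum V R (n + j) ^ 2) =
      ∑ r ∈ Ioc V R, sqfMul phiInv r := by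
  have hsub : ∀ r ∈ Ioc V R, r ∈ Ioc 0 R := fun r hr =>
    mem_Ioc.mpr ⟨Nat.zero_lt_of_lt (mem_Ioc.mp hr).1, (mem_Ioc.mp hr).2⟩
  simp only [truncSum, sq, sum_mul_sum]
  rw [periodMean_sum]
  refine sum_congr rfl fun a ha => ?_
  rw [periodMean_sum, sum_congr rfl fun b hb => periodMean_sqfMul_mul (hsub a ha) (hsub b hb) j,
    sum_ite_eq, if_pos ha]

/-- The quadruples of pairwise coprime squarefree integers parametrizing the triples of squarefree
moduli up to `R` in which no prime divides exactly one modulus. -/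
def ValidQuad (R x y z e : ℕ) : Prop :=
  (x.Coprime y ∧ x.Coprime z ∧ y.Coprime z) ∧ (x.Coprime e ∧ y.Coprime e ∧ z.Coprime e) ∧
    (x * y * e ≤ R ∧ x * z * e ≤ R ∧ y * z * e ≤ R) ∧
    (Squarefree x ∧ Squarefree y ∧ Squarefree z ∧ Squarefree e)

theorem not_dvd_and_dvd_of_coprime {p a b : ℕ} (hp : p.Prime) (h : a.Coprime b) :
    ¬ (p ∣ a ∧ p ∣ b) := fun h2 =>
  hp.one_lt.ne' (Nat.dvd_one.mp (h ▸ Nat.dvd_gcd h2.1 h2.2))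

theorem coprime_of_forall_prime {a b : ℕ} (h : ∀ p, p.Prime → ¬ (p ∣ a ∧ p ∣ b)) : a.Coprime b := by
  by_contra hc
  obtain ⟨p, hp, h1, h2⟩ := Nat.Prime.not_coprime_iff_dvd.mp hc
  exact h p hp ⟨h1, h2⟩

theorem prime_dvd_div_iff_of_squarefree {n d p : ℕ} (hn : Squarefree n) (hd : d ∣ n)
    (hp : p.Prime) : p ∣ n / d ↔ p ∣ n ∧ ¬ p ∣ d := by
  obtain ⟨m, rfl⟩ := hd
  have hd0 : 0 < d := Nat.pos_of_ne_zero fun h => by simp [h] at hn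
  rw [Nat.mul_div_cancel_left _ hd0, hp.dvd_mul]
  have := not_dvd_and_dvd_of_coprime hp (Nat.coprime_of_squarefree_mul hn)
  tauto

theorem squarefree_mul_mul {x y e : ℕ} (hxy : x.Coprime y) (hxe : x.Coprime e) (hye : y.Coprime e)
    (hx : Squarefree x) (hy : Squarefree y) (he : Squarefree e) : Squarefree (x * y * e) := by
  rw [Nat.squarefree_mul (Nat.Coprime.mul_left hxe hye), Nat.squarefree_mul hxy]
  exact ⟨⟨hx, hy⟩, he⟩

theorem card_filter_three (p a b c : ℕ) : #{i | p ∣ (![a, b, c] : Fin 3 → ℕ) i} =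
    (if p ∣ a then 1 else 0) + (if p ∣ b then 1 else 0) + if p ∣ c then 1 else 0 := by
  rw [card_filter, Fin.sum_univ_three]
  rfl

theorem periodMean_sqfMul_mul_mul {R a b c : ℕ} (ha : a ∈ Ioc 0 R) (hb : b ∈ Ioc 0 R)
    (hc : c ∈ Ioc 0 R) (hsa : Squarefree a) (hsb : Squarefree b) (hsc : Squarefree c) (j : ℕ) :
    periodMean (primorial R)
      (fun n => sqfMul (localValue (n + j)) a * sqfMul (localValue (n + j)) b *
        sqfMul (localValue (n + j)) c) =
      ∏ p ∈ Nat.primesLE R, localMean p (fun _ => j) {i | p ∣ (![a, b, c] : Fin 3 → ℕ) i} := by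
  have h := periodMean_prod_sqfMul R (fun _ : Fin 3 => j) ![a, b, c]
    (by simp [Fin.forall_fin_succ, mem_Ioc.mp ha, mem_Ioc.mp hb, mem_Ioc.mp hc])
    (by simp [Fin.forall_fin_succ, hsa, hsb, hsc])
  simpa only [Fin.prod_univ_three, Matrix.cons_val_zero, Matrix.cons_val_one,
    Matrix.cons_val_two, Matrix.tail_cons, Matrix.head_cons, Matrix.cons_val] using h

theorem ValidQuad.prime_dvd {R x y z e p : ℕ} (h : ValidQuad R x y z e) (hp : p.Prime) :
    (¬ (p ∣ x ∧ p ∣ y) ∧ ¬ (p ∣ x ∧ p ∣ z) ∧ ¬ (p ∣ y ∧ p ∣ z)) ∧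
      (¬ (p ∣ x ∧ p ∣ e) ∧ ¬ (p ∣ y ∧ p ∣ e) ∧ ¬ (p ∣ z ∧ p ∣ e)) :=
  ⟨⟨not_dvd_and_dvd_of_coprime hp h.1.1, not_dvd_and_dvd_of_coprime hp h.1.2.1,
    not_dvd_and_dvd_of_coprime hp h.1.2.2⟩, not_dvd_and_dvd_of_coprime hp h.2.1.1,
    not_dvd_and_dvd_of_coprime hp h.2.1.2.1, not_dvd_and_dvd_of_coprime hp h.2.1.2.2⟩

/-- A quadruple is determined by its three moduli. -/
theorem ValidQuad.eq_of_mul_eq {R x y z e x' y' z' e' : ℕ} (h : ValidQuad R x y z e)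
    (h' : ValidQuad R x' y' z' e') (h1 : x * y * e = x' * y' * e') (h2 : x * z * e = x' * z' * e')
    (h3 : y * z * e = y' * z' * e') : x = x' ∧ y = y' ∧ z = z' ∧ e = e' := by
  have key : ∀ p, p.Prime → ((p ∣ x ↔ p ∣ x') ∧ (p ∣ y ↔ p ∣ y') ∧ (p ∣ z ↔ p ∣ z') ∧
      (p ∣ e ↔ p ∣ e')) := by
    intro p hp
    have d := h.prime_dvd hp
    have d' := h'.prime_dvd hp
    have e1 : p ∣ x * y * e ↔ p ∣ x' * y' * e' := by rw [h1]
    have e2 : p ∣ x * z * e ↔ p ∣ x' * z' * e' := by rw [h2]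
    have e3 : p ∣ y * z * e ↔ p ∣ y' * z' * e' := by rw [h3]
    simp only [hp.dvd_mul] at e1 e2 e3
    clear h h' h1 h2 h3
    grind
  obtain ⟨-, -, -, s1, s2, s3, s4⟩ := h
  obtain ⟨-, -, -, s1', s2', s3', s4'⟩ := h'
  exact ⟨(Nat.Squarefree.ext_iff s1 s1').mpr fun p hp => (key p hp).1,
    (Nat.Squarefree.ext_iff s2 s2').mpr fun p hp => (key p hp).2.1,
    (Nat.Squarefree.ext_iff s3 s3').mpr fun p hp => (key p hp).2.2.1,
    (Nat.Squarefree.ext_iff s4 s4').mpr fun p hp => (key p hp).2.2.2⟩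

/-- A prime divides two of the moduli if it divides `x y z`, and all three if it divides `e`. -/
theorem ValidQuad.prod_localMean {R x y z e : ℕ} (h : ValidQuad R x y z e) (hx : x ∈ Ioc 0 R)
    (hy : y ∈ Ioc 0 R) (hz : z ∈ Ioc 0 R) (he : e ∈ Ioc 0 R) (j : ℕ) :
    ∏ p ∈ Nat.primesLE R, localMean p (fun _ => j)
        {i | p ∣ (![x * y * e, x * z * e, y * z * e] : Fin 3 → ℕ) i} =
      sqfMul phiInv x * sqfMul phiInv y * sqfMul phiInv z * sqfMul tripleWeight e := by
  obtain ⟨-, -, -, s1, s2, s3, s4⟩ := id h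
  rw [sqfMul_eq_prod_primesLE _ hx s1, sqfMul_eq_prod_primesLE _ hy s2,
    sqfMul_eq_prod_primesLE _ hz s3, sqfMul_eq_prod_primesLE _ he s4, ← prod_mul_distrib,
    ← prod_mul_distrib, ← prod_mul_distrib]
  refine prod_congr rfl fun p hp => ?_
  have hpp := (Nat.mem_primesLE.mp hp).2
  have hc := card_filter_three p (x * y * e) (x * z * e) (y * z * e)
  have d := h.prime_dvd hpp
  simp only [hpp.dvd_mul] at hc
  by_cases d4 : p ∣ e
  · have d1 : ¬ p ∣ x := by tauto
    have d2 : ¬ p ∣ y := by tauto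
    have d3 : ¬ p ∣ z := by tauto
    simp only [d1, d2, d3, d4, or_true, if_true] at hc
    rw [localMean_of_card_eq_three hpp _ j (fun _ _ => rfl) hc]
    simp [d1, d2, d3, d4]
  by_cases d1 : p ∣ x
  · have d2 : ¬ p ∣ y := by tauto
    have d3 : ¬ p ∣ z := by tauto
    simp only [d1, d2, d3, d4, or_false, if_true, if_false] at hc
    rw [localMean_of_card_eq_two hpp _ j (fun _ _ => rfl) hc]
    simp [d1, d2, d3, d4]
  by_cases d2 : p ∣ y
  · have d3 : ¬ p ∣ z := by tauto
    simp only [d1, d2, d3, d4, or_true, or_false, if_true, if_false] at hc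
    rw [localMean_of_card_eq_two hpp _ j (fun _ _ => rfl) hc]
    simp [d1, d2, d3, d4]
  by_cases d3 : p ∣ z
  · simp only [d1, d2, d3, d4, or_true, or_false, if_true, if_false] at hc
    rw [localMean_of_card_eq_two hpp _ j (fun _ _ => rfl) hc]
    simp [d1, d2, d3, d4]
  · simp only [d1, d2, d3, d4, or_false, if_false, add_zero] at hc
    rw [card_eq_zero.mp hc, localMean_empty hpp]
    simp [d1, d2, d3, d4]

/-- Three squarefree moduli such that no prime divides exactly one of them come from a quadruple. -/
theorem exists_validQuad {R a b c : ℕ} (ha : a ∈ Ioc 0 R) (hb : b ∈ Ioc 0 R)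
    (hc : c ∈ Ioc 0 R) (hsa : Squarefree a) (hsb : Squarefree b) (hsc : Squarefree c)
    (h : ∀ p, p.Prime → #{i | p ∣ (![a, b, c] : Fin 3 → ℕ) i} ≠ 1) :
    ∃ x y z e, ValidQuad R x y z e ∧ x * y * e = a ∧ x * z * e = b ∧ y * z * e = c := by
  set e := Nat.gcd (Nat.gcd a b) c with he
  have e1 : e ∣ Nat.gcd a b := Nat.gcd_dvd_left _ _
  have ec : e ∣ c := Nat.gcd_dvd_right _ _
  have ea : e ∣ a := e1.trans (Nat.gcd_dvd_left _ _)
  have eb : e ∣ b := e1.trans (Nat.gcd_dvd_right _ _)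
  have e2 : e ∣ Nat.gcd a c := Nat.dvd_gcd ea ec
  have e3 : e ∣ Nat.gcd b c := Nat.dvd_gcd eb ec
  have q1 : Squarefree (Nat.gcd a b) := hsa.squarefree_of_dvd (Nat.gcd_dvd_left _ _)
  have q2 : Squarefree (Nat.gcd a c) := hsa.squarefree_of_dvd (Nat.gcd_dvd_left _ _)
  have q3 : Squarefree (Nat.gcd b c) := hsb.squarefree_of_dvd (Nat.gcd_dvd_left _ _)
  have s1 : Squarefree (Nat.gcd a b / e) := q1.squarefree_of_dvd (Nat.div_dvd_of_dvd e1)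
  have s2 : Squarefree (Nat.gcd a c / e) := q2.squarefree_of_dvd (Nat.div_dvd_of_dvd e2)
  have s3 : Squarefree (Nat.gcd b c / e) := q3.squarefree_of_dvd (Nat.div_dvd_of_dvd e3)
  have s4 : Squarefree e := hsa.squarefree_of_dvd ea
  have d1 : ∀ p, p.Prime → (p ∣ Nat.gcd a b / e ↔ (p ∣ a ∧ p ∣ b) ∧ ¬ p ∣ c) := by
    intro p hp
    rw [prime_dvd_div_iff_of_squarefree q1 e1 hp, he]
    simp only [Nat.dvd_gcd_iff]
    clear * -
    tauto
  have d2 : ∀ p, p.Prime → (p ∣ Nat.gcd a c / e ↔ (p ∣ a ∧ p ∣ c) ∧ ¬ p ∣ b) := by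
    intro p hp
    rw [prime_dvd_div_iff_of_squarefree q2 e2 hp, he]
    simp only [Nat.dvd_gcd_iff]
    clear * -
    tauto
  have d3 : ∀ p, p.Prime → (p ∣ Nat.gcd b c / e ↔ (p ∣ b ∧ p ∣ c) ∧ ¬ p ∣ a) := by
    intro p hp
    rw [prime_dvd_div_iff_of_squarefree q3 e3 hp, he]
    simp only [Nat.dvd_gcd_iff]
    clear * -
    tauto
  have d4 : ∀ p, p ∣ e ↔ p ∣ a ∧ p ∣ b ∧ p ∣ c := by
    intro p
    rw [he, Nat.dvd_gcd_iff, Nat.dvd_gcd_iff, and_assoc]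
  generalize Nat.gcd a b / e = x at s1 d1
  generalize Nat.gcd a c / e = y at s2 d2
  generalize Nat.gcd b c / e = z at s3 d3
  clear_value e
  have hxy : x.Coprime y := coprime_of_forall_prime fun p hp => by
    rw [d1 p hp, d2 p hp]; clear * -; tauto
  have hxz : x.Coprime z := coprime_of_forall_prime fun p hp => by
    rw [d1 p hp, d3 p hp]; clear * -; tauto
  have hyz : y.Coprime z := coprime_of_forall_prime fun p hp => by
    rw [d2 p hp, d3 p hp]; clear * -; tauto
  have hxe : x.Coprime e := coprime_of_forall_prime fun p hp => by
    rw [d1 p hp, d4 p]; clear * -; tauto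
  have hye : y.Coprime e := coprime_of_forall_prime fun p hp => by
    rw [d2 p hp, d4 p]; clear * -; tauto
  have hze : z.Coprime e := coprime_of_forall_prime fun p hp => by
    rw [d3 p hp, d4 p]; clear * -; tauto
  have hone : ∀ p, p.Prime → ((p ∣ a → p ∣ b ∨ p ∣ c) ∧ (p ∣ b → p ∣ a ∨ p ∣ c) ∧
      (p ∣ c → p ∣ a ∨ p ∣ b)) := by
    intro p hp
    have h1 := h p hp
    rw [card_filter_three] at h1
    by_cases ha : p ∣ a <;> by_cases hb : p ∣ b <;> by_cases hc : p ∣ c <;>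
      simp_all
  have f1 : x * y * e = a := by
    rw [Nat.Squarefree.ext_iff (squarefree_mul_mul hxy hxe hye s1 s2 s4) hsa]
    intro p hp
    rw [hp.dvd_mul, hp.dvd_mul, d1 p hp, d2 p hp, d4 p]
    have := hone p hp
    clear * - this
    tauto
  have f2 : x * z * e = b := by
    rw [Nat.Squarefree.ext_iff (squarefree_mul_mul hxz hxe hze s1 s3 s4) hsb]
    intro p hp
    rw [hp.dvd_mul, hp.dvd_mul, d1 p hp, d3 p hp, d4 p]
    have := hone p hp
    clear * - this
    tauto
  have f3 : y * z * e = c := by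
    rw [Nat.Squarefree.ext_iff (squarefree_mul_mul hyz hye hze s2 s3 s4) hsc]
    intro p hp
    rw [hp.dvd_mul, hp.dvd_mul, d2 p hp, d3 p hp, d4 p]
    have := hone p hp
    clear * - this
    tauto
  rw [mem_Ioc] at ha hb hc
  exact ⟨x, y, z, e, ⟨⟨hxy, hxz, hyz⟩, ⟨hxe, hye, hze⟩, ⟨f1 ▸ ha.2, f2 ▸ hb.2, f3 ▸ hc.2⟩,
    s1, s2, s3, s4⟩, f1, f2, f3⟩

/-- The squarefreeness conditions of `ValidQuad` may be omitted, as the weights vanish otherwise. -/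
theorem quadTerm_eq_ite (R x y z e : ℕ) [Decidable (ValidQuad R x y z e)] :
    quadTerm R x y z e = if ValidQuad R x y z e then
      sqfMul phiInv x * sqfMul phiInv y * sqfMul phiInv z * sqfMul tripleWeight e else 0 := by
  rw [quadTerm]
  by_cases h : Squarefree x ∧ Squarefree y ∧ Squarefree z ∧ Squarefree e
  · refine if_congr ?_ rfl rfl
    rw [ValidQuad]
    tauto
  · have h0 : sqfMul phiInv x * sqfMul phiInv y * sqfMul phiInv z * sqfMul tripleWeight e = 0 := by
      by_cases h1 : Squarefree x
      swap
      · simp [sqfMul_of_not_squarefree _ h1]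
      by_cases h2 : Squarefree y
      swap
      · simp [sqfMul_of_not_squarefree _ h2]
      by_cases h3 : Squarefree z
      swap
      · simp [sqfMul_of_not_squarefree _ h3]
      have h4 : ¬ Squarefree e := fun h4 => h ⟨h1, h2, h3, h4⟩
      simp [sqfMul_of_not_squarefree _ h4]
    rw [h0, ite_self, ite_self]

/-- The third moment of the short divisor sum is a sum over quadruples. -/
theorem periodMean_truncSum_cube (R j : ℕ) :
    periodMean (primorial R) (fun n => truncSum 0 R (n + j) ^ 3) = quadSum R := by
  classical
  set g : ℕ × ℕ × ℕ → ℝ := fun t => periodMean (primorial R)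
    (fun n => sqfMul (localValue (n + j)) t.1 * sqfMul (localValue (n + j)) t.2.1 *
        sqfMul (localValue (n + j)) t.2.2) with hg
  have h1 : periodMean (primorial R) (fun n => truncSum 0 R (n + j) ^ 3) =
      ∑ t ∈ Ioc 0 R ×ˢ Ioc 0 R ×ˢ Ioc 0 R, g t := by
    rw [hg, ← periodMean_sum]
    refine periodMean_congr fun n => ?_
    rw [sum_product, truncSum, pow_succ, sq, sum_mul_sum, sum_mul]
    refine sum_congr rfl fun a _ => ?_
    rw [sum_product, sum_mul_sum]
  have h2 : quadSum R = ∑ t ∈ Ioc 0 R ×ˢ Ioc 0 R ×ˢ Ioc 0 R ×ˢ Ioc 0 R with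
      ValidQuad R t.1 t.2.1 t.2.2.1 t.2.2.2,
      sqfMul phiInv t.1 * sqfMul phiInv t.2.1 * sqfMul phiInv t.2.2.1 *
        sqfMul tripleWeight t.2.2.2 := by
    rw [quadSum, sum_filter, sum_product]
    refine sum_congr rfl fun x _ => ?_
    rw [sum_product]
    refine sum_congr rfl fun y _ => ?_
    rw [sum_product]
    exact sum_congr rfl fun z _ => sum_congr rfl fun e _ => quadTerm_eq_ite R x y z e
  rw [h1, h2]
  symm
  have hpos : ∀ {x y e : ℕ}, x ∈ Ioc 0 R → y ∈ Ioc 0 R → e ∈ Ioc 0 R → x * y * e ≤ R →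
      x * y * e ∈ Ioc 0 R := by
    intro x y e hx hy he h
    rw [mem_Ioc] at hx hy he ⊢
    exact ⟨Nat.mul_pos (Nat.mul_pos hx.1 hy.1) he.1, h⟩
  refine sum_of_injOn (fun t => (t.1 * t.2.1 * t.2.2.2, t.1 * t.2.2.1 * t.2.2.2,
    t.2.1 * t.2.2.1 * t.2.2.2)) ?_ ?_ ?_ ?_
  · rintro ⟨x, y, z, e⟩ h ⟨x', y', z', e'⟩ h' heq
    simp only [coe_filter, Set.mem_ofPred_eq] at h h'
    simp only [Prod.mk.injEq] at heq
    have := h.2.eq_of_mul_eq h'.2 heq.1 heq.2.1 heq.2.2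
    simp only [Prod.mk.injEq]
    exact this
  · rintro ⟨x, y, z, e⟩ h
    simp only [coe_filter, Set.mem_ofPred_eq, mem_product] at h
    obtain ⟨⟨hx, hy, hz, he⟩, hv⟩ := h
    simp only [coe_product, Set.mem_prod, mem_coe]
    exact ⟨hpos hx hy he hv.2.2.1.1, hpos hx hz he hv.2.2.1.2.1, hpos hy hz he hv.2.2.1.2.2⟩
  · rintro ⟨a, b, c⟩ h hn
    simp only [mem_product] at h
    obtain ⟨ha, hb, hc⟩ := h
    by_contra hne
    simp only [hg] at hne
    have hsa : Squarefree a := by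
      by_contra hs
      simp [sqfMul_of_not_squarefree _ hs, periodMean] at hne
    have hsb : Squarefree b := by
      by_contra hs
      simp [sqfMul_of_not_squarefree _ hs, periodMean] at hne
    have hsc : Squarefree c := by
      by_contra hs
      simp [sqfMul_of_not_squarefree _ hs, periodMean] at hne
    rw [periodMean_sqfMul_mul_mul ha hb hc hsa hsb hsc j] at hne
    -- a nonzero mean forces that no prime divides exactly one of the moduli
    have hone : ∀ p, p.Prime → #{i | p ∣ (![a, b, c] : Fin 3 → ℕ) i} ≠ 1 := by
      intro p hp h1
      have h0 := localMean_of_card_eq_one hp (fun _ => j) h1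
      have h2 := h1
      rw [card_filter_three] at h2
      apply hne
      by_cases pa : p ∣ a
      · exact prod_primesLE_eq_zero ha hp pa h0
      by_cases pb : p ∣ b
      · exact prod_primesLE_eq_zero hb hp pb h0
      by_cases pc : p ∣ c
      · exact prod_primesLE_eq_zero hc hp pc h0
      simp [pa, pb, pc] at h2
    obtain ⟨x, y, z, e, hv, f1, f2, f3⟩ := exists_validQuad ha hb hc hsa hsb hsc hone
    apply hn
    refine ⟨(x, y, z, e), ?_, by simp only [f1, f2, f3]⟩
    have hdvd : ∀ {u v : ℕ}, v ∈ Ioc 0 R → u ∣ v → u ∈ Ioc 0 R := by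
      intro u v hv huv
      rw [mem_Ioc] at hv ⊢
      exact ⟨Nat.pos_of_dvd_of_pos huv hv.1, (Nat.le_of_dvd hv.1 huv).trans hv.2⟩
    simp only [coe_filter, Set.mem_ofPred_eq, mem_product]
    exact ⟨⟨hdvd ha ⟨y * e, by rw [← f1]; ring⟩, hdvd ha ⟨x * e, by rw [← f1]; ring⟩,
      hdvd hb ⟨x * e, by rw [← f2]; ring⟩, hdvd ha ⟨x * y, by rw [← f1]; ring⟩⟩, hv⟩
  · rintro ⟨x, y, z, e⟩ h
    rw [mem_filter] at h
    simp only [mem_product] at h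
    obtain ⟨⟨hx, hy, hz, he⟩, hv⟩ := h
    obtain ⟨⟨c1, c2, c3⟩, ⟨c4, c5, c6⟩, ⟨l1, l2, l3⟩, s1, s2, s3, s4⟩ := id hv
    simp only [hg]
    rw [periodMean_sqfMul_mul_mul (hpos hx hy he l1) (hpos hx hz he l2) (hpos hy hz he l3)
      (squarefree_mul_mul c1 c4 c5 s1 s2 s4) (squarefree_mul_mul c2 c4 c6 s1 s3 s4)
      (squarefree_mul_mul c3 c5 c6 s2 s3 s4) j, hv.prod_localMean hx hy hz he]

/-! ### Moments of window sums of the tail -/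

theorem sigmaBound_mul_le {c : ℝ} (hc : 0 ≤ c) {a b : ℕ} (ha : a ≠ 0) (hb : b ≠ 0) :
    sigmaBound c (a * b) ≤ sigmaBound c a * sigmaBound c b := by
  have h1 : ∀ p : ℕ, 1 ≤ 1 + c * (p : ℝ) ^ (-(3 / 4) : ℝ) := fun p => by
    have : 0 ≤ c * (p : ℝ) ^ (-(3 / 4) : ℝ) := by positivity
    linarith
  rw [sigmaBound, sigmaBound, sigmaBound, Nat.primeFactors_mul ha hb, ← prod_union_inter]
  exact le_mul_of_one_le_right (prod_nonneg fun p _ => zero_le_one.trans (h1 p))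
    (Finset.one_le_prod fun p _ => h1 p)

/-- A power of `sigmaBound` is bounded by the same product with another constant. -/
theorem sigmaBound_pow_three_le {c : ℝ} (hc : 0 ≤ c) (k : ℕ) :
    sigmaBound c k ^ 3 ≤ sigmaBound (3 * c + 3 * c ^ 2 + c ^ 3) k := by
  rw [sigmaBound, sigmaBound, ← prod_pow]
  refine prod_le_prod (fun p _ => by positivity) fun p hp => ?_
  have hp1 : (1 : ℝ) ≤ p := by exact_mod_cast (Nat.prime_of_mem_primeFactors hp).one_le
  have h1 : (p : ℝ) ^ (-(3 / 4) : ℝ) ≤ 1 := Real.rpow_le_one_of_one_le_of_nonpos hp1 (by norm_num)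
  have h0 : (0 : ℝ) ≤ (p : ℝ) ^ (-(3 / 4) : ℝ) := by positivity
  generalize (p : ℝ) ^ (-(3 / 4) : ℝ) = t at h0 h1
  have h2 : t ^ 2 ≤ t := by nlinarith
  have h3 : t ^ 3 ≤ t := by nlinarith
  have e : (1 + c * t) ^ 3 = 1 + 3 * c * t + 3 * c ^ 2 * t ^ 2 + c ^ 3 * t ^ 3 := by ring
  rw [e]
  have h4 := mul_le_mul_of_nonneg_left h2 (by positivity : (0 : ℝ) ≤ 3 * c ^ 2)
  have h5 := mul_le_mul_of_nonneg_left h3 (by positivity : (0 : ℝ) ≤ c ^ 3)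
  linarith

theorem prod_primeFactors_one_add_eq {u : ℕ → ℝ} {n : ℕ} (hn : Squarefree n) :
    ∏ p ∈ n.primeFactors, (1 + u p) = ∑ d ∈ n.divisors, sqfMul u d := by
  rw [← (sqfMul_isMultiplicative u).prodPrimeFactors_one_add_of_squarefree hn]
  exact prod_congr rfl fun p hp => by rw [sqfMul_prime u (Nat.prime_of_mem_primeFactors hp)]

theorem sum_sqfMul_le_prod {u : ℕ → ℝ} (hu : ∀ p, p.Prime → 0 ≤ u p) (N : ℕ) :
    ∑ d ∈ Ioc 0 N, sqfMul u d ≤ ∏ p ∈ Nat.primesLE N, (1 + u p) := by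
  rw [← primeFactors_primorial, prod_primeFactors_one_add_eq (squarefree_primorial N)]
  have h : ∑ d ∈ Ioc 0 N, sqfMul u d = ∑ d ∈ Ioc 0 N with Squarefree d, sqfMul u d := by
    rw [sum_filter]
    refine sum_congr rfl fun d _ => ?_
    split_ifs with h
    · rfl
    · exact sqfMul_of_not_squarefree u h
  rw [h]
  refine sum_le_sum_of_subset_of_nonneg ?_ fun d _ _ => sqfMul_nonneg d hu
  intro d hd
  rw [mem_filter, mem_Ioc] at hd
  exact Nat.mem_divisors.mpr ⟨(hd.2.dvd_primorial).trans (primorial_dvd_primorial hd.1.2),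
    primorial_ne_zero N⟩

theorem sigmaBound_le_sum_divisors {c : ℝ} (hc : 0 ≤ c) {k : ℕ} (hk : k ≠ 0) :
    sigmaBound c k ≤ ∑ d ∈ k.divisors, sqfMul (fun p => c * (p : ℝ) ^ (-(3 / 4) : ℝ)) d := by
  rw [sigmaBound, ← Nat.primeFactors_radical, prod_primeFactors_one_add_eq
    UniqueFactorizationMonoid.squarefree_radical]
  refine sum_le_sum_of_subset_of_nonneg ?_ fun d _ _ => sqfMul_nonneg d fun p _ => by positivity
  exact Nat.divisors_subset_of_dvd hk UniqueFactorizationMonoid.radical_dvd_self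

/-- The products `sigmaBound c k` are bounded on average. -/
theorem exists_sum_sigmaBound_le {c : ℝ} (hc : 0 ≤ c) :
    ∃ K : ℝ, 0 ≤ K ∧ ∀ H : ℕ, ∑ k ∈ Ioc 0 H, sigmaBound c k ≤ K * H := by
  refine ⟨Real.exp (c * ∑' n : ℕ, (n : ℝ) ^ (-(7 / 4) : ℝ)), by positivity, fun H => ?_⟩
  set f := sqfMul (fun p => c * (p : ℝ) ^ (-(3 / 4) : ℝ)) with hf
  have hf0 : ∀ d, 0 ≤ f d := fun d => sqfMul_nonneg d fun p _ => by positivity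
  calc _ ≤ ∑ k ∈ Ioc 0 H, ∑ x ∈ k.divisorsAntidiagonal, f x.1 := by
        refine sum_le_sum fun k hk => ?_
        rw [Nat.sum_divisorsAntidiagonal (f := fun a _ => f a)]
        exact sigmaBound_le_sum_divisors hc (mem_Ioc.mp hk).1.ne'
    _ = ∑ d ∈ Ioc 0 H, ∑ k ∈ Ioc 0 (H / d), f d :=
        sum_Ioc_sum_divisorsAntidiagonal (fun d _ => f d) H
    _ ≤ ∑ d ∈ Ioc 0 H, sqfMul (fun p => c * (p : ℝ) ^ (-(7 / 4) : ℝ)) d * H := by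
        refine sum_le_sum fun d hd => ?_
        rw [sum_const, Nat.card_Ioc, Nat.sub_zero, nsmul_eq_mul]
        have h1 : sqfMul (fun p => c * (p : ℝ) ^ (-(7 / 4) : ℝ)) d = f d * (1 / d) := by
          by_cases hs : Squarefree d
          · have h2 : (1 : ℝ) / d = sqfMul (fun p => 1 / (p : ℝ)) d := by
              rw [sqfMul_apply, if_pos hs, prod_div_distrib, prod_const_one, ← Nat.cast_prod,
                Nat.prod_primeFactors_of_squarefree hs]
            rw [h2, hf, ← sqfMul_mul_fun]
            refine sqfMul_congr d fun p hp _ => ?_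
            have hp0 := (prime_rpow_facts hp).1
            rw [show (-(7 / 4) : ℝ) = -(3 / 4) - 1 by norm_num, Real.rpow_sub_one hp0.ne']
            ring
          · rw [sqfMul_of_not_squarefree _ hs, hf, sqfMul_of_not_squarefree _ hs, zero_mul]
        rw [h1, mul_comm, mul_assoc]
        refine mul_le_mul_of_nonneg_left ?_ (hf0 d)
        rw [one_div_mul_eq_div]
        exact Nat.cast_div_le
    _ ≤ _ := by
        rw [← sum_mul]
        refine mul_le_mul_of_nonneg_right ?_ (by positivity)
        exact (sum_sqfMul_le_prod (fun p _ => by positivity) H).trans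
          (prod_primesLE_one_add_le hc H)

theorem sum_comp_le {f : ℕ → ℝ} (hf : ∀ k, 0 ≤ f k) {s t : Finset ℕ} (e : ℕ → ℕ)
    (hinj : Set.InjOn e s) (hmap : ∀ x ∈ s, e x ∈ t) : ∑ x ∈ s, f (e x) ≤ ∑ k ∈ t, f k := by
  rw [← sum_image hinj]
  exact sum_le_sum_of_subset_of_nonneg (image_subset_iff.mpr hmap) fun k _ _ => hf k

theorem sum_lt_left_le {f : ℕ → ℝ} (hf : ∀ k, 0 ≤ f k) (H x : ℕ) (hx : x ∈ Ioc 0 H) :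
    (∑ y ∈ Ioc 0 H, if y < x then f (x - y) else 0) ≤ ∑ k ∈ Ioc 0 H, f k := by
  rw [← sum_filter]
  refine sum_comp_le hf (fun y => x - y) ?_ ?_
  · intro y hy y' hy' h
    simp only [coe_filter, mem_Ioc, Set.mem_ofPred_eq] at hy hy' h
    omega
  · intro y hy
    simp only [mem_filter, mem_Ioc] at hy hx ⊢
    omega

theorem sum_sum_lt_le {f : ℕ → ℝ} (hf : ∀ k, 0 ≤ f k) (H : ℕ) :
    (∑ x ∈ Ioc 0 H, ∑ y ∈ Ioc 0 H, if y < x then f (x - y) else 0) ≤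
      H * ∑ k ∈ Ioc 0 H, f k := by
  refine (sum_le_sum fun x hx => sum_lt_left_le hf H x hx).trans (le_of_eq ?_)
  rw [sum_const, Nat.card_Ioc, Nat.sub_zero, nsmul_eq_mul]

/-- Restricting all moduli to exceed `V` gains a power of `V`. -/
theorem abs_periodMean_prod_truncSum_le {ι : Type*} [Fintype ι] [DecidableEq ι] {V R : ℕ}
    (hV : 1 ≤ V) (j : ι → ℕ) (i₀ : ι) :
    |periodMean (primorial R) (fun n => ∏ i, truncSum V R (n + j i))| ≤
      (V : ℝ) ^ (-(1 / 4) : ℝ) * ∑ r ∈ Fintype.piFinset (fun _ : ι => Ioc 0 R),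
        |periodMean (primorial R) (fun n => ∏ i, sqfMul (localValue (n + j i)) (r i))| *
          (r i₀ : ℝ) ^ (1 / 4 : ℝ) := by
  have hV0 : (0 : ℝ) < V := by exact_mod_cast hV
  have h1 : ∀ n, ∏ i, truncSum V R (n + j i) =
      ∑ r ∈ Fintype.piFinset (fun _ : ι => Ioc V R), ∏ i, sqfMul (localValue (n + j i)) (r i) :=
    fun n => prod_univ_sum (fun _ => Ioc V R) fun i r => sqfMul (localValue (n + j i)) r
  simp only [h1]
  rw [periodMean_sum, mul_sum]
  refine (abs_sum_le_sum_abs _ _).trans ?_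
  have hsub : Fintype.piFinset (fun _ : ι => Ioc V R) ⊆ Fintype.piFinset (fun _ : ι => Ioc 0 R) :=
    Fintype.piFinset_subset _ _ fun _ => Ioc_subset_Ioc_left (Nat.zero_le V)
  refine le_trans (sum_le_sum fun r hr => ?_) (sum_le_sum_of_subset_of_nonneg hsub
    fun r _ _ => by positivity)
  have hr0 : V ≤ r i₀ := (mem_Ioc.mp (Fintype.mem_piFinset.mp hr i₀)).1.le
  have h2 : (1 : ℝ) ≤ (V : ℝ) ^ (-(1 / 4) : ℝ) * (r i₀ : ℝ) ^ (1 / 4 : ℝ) := by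
    rw [Real.rpow_neg hV0.le, inv_mul_eq_div, one_le_div (by positivity)]
    exact Real.rpow_le_rpow hV0.le (by exact_mod_cast hr0) (by norm_num)
  calc _ ≤ |periodMean (primorial R) fun n => ∏ i, sqfMul (localValue (n + j i)) (r i)| *
        ((V : ℝ) ^ (-(1 / 4) : ℝ) * (r i₀ : ℝ) ^ (1 / 4 : ℝ)) :=
        le_mul_of_one_le_right (abs_nonneg _) h2
    _ = _ := by ring

/-- A pattern with one index has zero local mean, so that only the modulus `1` contributes. -/
theorem sum_sqfMul_localMean_singleton_le {ι : Type*} [DecidableEq ι] (j : ι → ℕ) (i : ι) (R : ℕ)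
    (g : ℕ → ℝ) : ∑ x ∈ Ioc 0 R, sqfMul (fun p => |localMean p j {i}| * g p) x ≤ 1 := by
  have h : ∀ x ∈ Ioc 0 R, sqfMul (fun p => |localMean p j {i}| * g p) x = if x = 1 then 1 else 0 := by
    intro x _
    split_ifs with h1
    · rw [h1, sqfMul_one]
    · rw [sqfMul_apply]
      split_ifs
      · obtain ⟨p, hp, hpx⟩ := Nat.exists_prime_and_dvd h1
        refine prod_eq_zero (i := p) (Nat.mem_primeFactors.mpr ⟨hp, hpx, by grind⟩) ?_
        simp [localMean_of_card_eq_one hp j (card_singleton i)]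
      · rfl
  rw [sum_congr rfl h, sum_ite_eq']
  split_ifs <;> norm_num

theorem dvd_sub_of_modEq {p x y : ℕ} (h : x ≡ y [MOD p]) : p ∣ x - y := by
  rcases le_total x y with h1 | h1
  · simp [Nat.sub_eq_zero_of_le h1]
  · exact (Nat.modEq_iff_dvd' h1).mp h.symm

/-- Correlations of two distinct translates. -/
theorem exists_abs_periodMean_pair_le :
    ∃ K c : ℝ, 0 ≤ K ∧ 0 ≤ c ∧ ∀ V R x y : ℕ, 1 ≤ V → y < x →
      |periodMean (primorial R) (fun n => truncSum V R (n + x) * truncSum V R (n + y))| ≤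
        (V : ℝ) ^ (-(1 / 4) : ℝ) * (K * sigmaBound c (x - y)) := by
  obtain ⟨K, hK0, hK⟩ := exists_sum_abs_periodMean_le (Fin 2)
  have hc := patternConst_nonneg (Fin 2)
  refine ⟨K, patternConst (Fin 2), hK0, hc, fun V R x y hV hyx => ?_⟩
  have h1 := abs_periodMean_prod_truncSum_le (R := R) hV ![x, y] 0
  have h2 := hK R (x - y) ![x, y] {0} 0 0 (mem_singleton_self _) (by omega) fun p S _ _ hS hp => by
    have hS' : ∀ S : Finset (Fin 2), 2 ≤ #S → 0 ∈ S ∧ 1 ∈ S := by decide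
    exact ⟨0, (hS' S hS).1, 1, (hS' S hS).2, fun h => hp (dvd_sub_of_modEq h)⟩
  simp only [Fin.prod_univ_two, Matrix.cons_val_zero, Matrix.cons_val_one] at h1 h2
  refine h1.trans (mul_le_mul_of_nonneg_left (h2.trans ?_) (by positivity))
  exact mul_le_of_le_one_left (mul_nonneg hK0 (zero_le_one.trans (one_le_sigmaBound hc _)))
    (sum_sqfMul_localMean_singleton_le _ _ _ _)

/-- Correlations of three distinct translates. -/
theorem exists_abs_periodMean_triple_le :
    ∃ K c : ℝ, 0 ≤ K ∧ 0 ≤ c ∧ ∀ V R x y z : ℕ, 1 ≤ V → z < y → y < x →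
      |periodMean (primorial R)
          (fun n => truncSum V R (n + x) * truncSum V R (n + y) * truncSum V R (n + z))| ≤
        (V : ℝ) ^ (-(1 / 4) : ℝ) * (K * sigmaBound c ((x - y) * (x - z) * (y - z))) := by
  obtain ⟨K, hK0, hK⟩ := exists_sum_abs_periodMean_le (Fin 3)
  have hc := patternConst_nonneg (Fin 3)
  refine ⟨K, patternConst (Fin 3), hK0, hc, fun V R x y z hV hzy hyx => ?_⟩
  have h1 := abs_periodMean_prod_truncSum_le (R := R) hV ![x, y, z] 0
  have hne : (x - y) * (x - z) * (y - z) ≠ 0 := by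
    refine Nat.mul_ne_zero (Nat.mul_ne_zero ?_ ?_) ?_ <;> omega
  have h2 := hK R ((x - y) * (x - z) * (y - z)) ![x, y, z] {0} 0 0 (mem_singleton_self _) hne
    fun p S _ _ hS hp => by
      have hS' : ∀ S : Finset (Fin 3), 2 ≤ #S →
          (0 ∈ S ∧ 1 ∈ S) ∨ (0 ∈ S ∧ 2 ∈ S) ∨ (1 ∈ S ∧ 2 ∈ S) := by decide
      rcases hS' S hS with h | h | h
      · exact ⟨0, h.1, 1, h.2, fun h => hp (((dvd_sub_of_modEq h).mul_right _).mul_right _)⟩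
      · exact ⟨0, h.1, 2, h.2, fun h => hp (((dvd_sub_of_modEq h).mul_left _).mul_right _)⟩
      · exact ⟨1, h.1, 2, h.2, fun h => hp ((dvd_sub_of_modEq h).mul_left _)⟩
  simp only [Fin.prod_univ_three, Matrix.cons_val_zero, Matrix.cons_val_one, Matrix.cons_val] at h1 h2
  refine h1.trans (mul_le_mul_of_nonneg_left (h2.trans ?_) (by positivity))
  exact mul_le_of_le_one_left (mul_nonneg hK0 (zero_le_one.trans (one_le_sigmaBound hc _)))
    (sum_sqfMul_localMean_singleton_le _ _ _ _)

/-- Correlations with a repeated translate. The local means of the pattern formed by the two equal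
translates are `1 / (p - 1)` for all `p`, so that this pattern is kept apart and contributes the
factor `∑ μ²(r) / φ(r)` of size `log R`. -/
theorem exists_abs_periodMean_repeated_le :
    ∃ K c : ℝ, 0 ≤ K ∧ 0 ≤ c ∧ ∀ V R x y : ℕ, 1 ≤ V → x ≠ y →
      |periodMean (primorial R)
          (fun n => truncSum V R (n + y) * truncSum V R (n + y) * truncSum V R (n + x))| ≤
        (V : ℝ) ^ (-(1 / 4) : ℝ) * ((∑ r ∈ Ioc 0 R, sqfMul phiInv r) *
          (K * sigmaBound c ((x - y) + (y - x)))) := by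
  obtain ⟨K, hK0, hK⟩ := exists_sum_abs_periodMean_le (Fin 3)
  have hc := patternConst_nonneg (Fin 3)
  refine ⟨K, patternConst (Fin 3), hK0, hc, fun V R x y hV hxy => ?_⟩
  have h1 := abs_periodMean_prod_truncSum_le (R := R) hV ![y, y, x] 2
  have h2 := hK R ((x - y) + (y - x)) ![y, y, x] {0, 1} 2 0 (by simp) (by omega)
    fun p S _ hS0 hS hp => by
      have hS' : ∀ S : Finset (Fin 3), S ≠ {0, 1} → 2 ≤ #S →
          2 ∈ S ∧ (0 ∈ S ∨ 1 ∈ S) := by decide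
      have hxy' : ¬ y ≡ x [MOD p] := fun h =>
        hp (dvd_add (dvd_sub_of_modEq h.symm) (dvd_sub_of_modEq h))
      obtain ⟨h, h' | h'⟩ := hS' S hS0 hS
      · exact ⟨0, h', 2, h, hxy'⟩
      · exact ⟨1, h', 2, h, hxy'⟩
  have h3 : ∀ r ∈ Ioc 0 R, sqfMul (fun p => |localMean p ![y, y, x] {0, 1}| *
      (if (2 : Fin 3) ∈ ({0, 1} : Finset (Fin 3)) then (p : ℝ) ^ (1 / 4 : ℝ) else 1)) r =
      sqfMul phiInv r := by
    intro r _
    refine sqfMul_congr r fun p hp _ => ?_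
    rw [if_neg (by decide), mul_one, localMean_of_card_eq_two hp _ y (by simp) (by decide),
      abs_of_pos (phiInv_pos hp)]
  rw [sum_congr rfl h3] at h2
  simp only [Fin.prod_univ_three, Matrix.cons_val_zero, Matrix.cons_val_one, Matrix.cons_val] at h1 h2
  exact h1.trans (mul_le_mul_of_nonneg_left h2 (by positivity))

/-- The sum of `truncSum V R` over the window `n + 1, …, n + H`. -/
noncomputable def windowSum (V R H n : ℕ) : ℝ := ∑ j ∈ Ioc 0 H, truncSum V R (n + j)

/-- The second moment of the tail sums is diagonal up to a small error. -/
theorem exists_abs_periodMean_windowSum_sq_sub_le :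
    ∃ K : ℝ, 0 ≤ K ∧ ∀ V R H : ℕ, 1 ≤ V →
      |periodMean (primorial R) (fun n => windowSum V R H n ^ 2) -
        H * ∑ r ∈ Ioc V R, sqfMul phiInv r| ≤ K * ((V : ℝ) ^ (-(1 / 4) : ℝ) * (H : ℝ) ^ 2) := by
  obtain ⟨K, c, hK0, hc0, hK⟩ := exists_abs_periodMean_pair_le
  obtain ⟨K', hK'0, hK'⟩ := exists_sum_sigmaBound_le hc0
  refine ⟨2 * (K * K'), by positivity, fun V R H hV => ?_⟩
  set A : ℕ → ℕ → ℝ := fun x y =>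
    periodMean (primorial R) (fun n => truncSum V R (n + x) * truncSum V R (n + y)) with hA
  have hsymm : ∀ x y, A x y = A y x := fun x y => periodMean_congr fun n => mul_comm _ _
  have h1 : periodMean (primorial R) (fun n => windowSum V R H n ^ 2) =
      ∑ x ∈ Ioc 0 H, ∑ y ∈ Ioc 0 H, A x y := by
    simp only [windowSum, sq, sum_mul_sum, periodMean_sum, hA]
  have h2 : ∑ x ∈ Ioc 0 H, ∑ y ∈ Ioc 0 H, A x y =
      2 * (∑ x ∈ Ioc 0 H, ∑ y ∈ Ioc 0 H, if y < x then A x y else 0) + ∑ x ∈ Ioc 0 H, A x x := by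
    have e1 : ∀ x y, A x y = (if y < x then A x y else 0) + (if x < y then A y x else 0) +
        if x = y then A x x else 0 := by
      intro x y
      rcases lt_trichotomy x y with h | h | h
      · simp [h, h.not_gt, h.ne, hsymm x y]
      · simp [h]
      · simp [h, h.not_gt, h.ne']
    calc _ = ∑ x ∈ Ioc 0 H, ∑ y ∈ Ioc 0 H, ((if y < x then A x y else 0) +
          (if x < y then A y x else 0) + if x = y then A x x else 0) :=
          sum_congr rfl fun x _ => sum_congr rfl fun y _ => e1 x y
      _ = _ := by
          simp only [sum_add_distrib]
          rw [sum_comm (f := fun x y => if x < y then A y x else 0)]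
          have e2 : ∑ x ∈ Ioc 0 H, ∑ y ∈ Ioc 0 H, (if x = y then A x x else 0) =
              ∑ x ∈ Ioc 0 H, A x x := by
            refine sum_congr rfl fun x hx => ?_
            rw [sum_ite_eq, if_pos hx]
          rw [e2]
          ring
  have h3 : ∑ x ∈ Ioc 0 H, A x x = H * ∑ r ∈ Ioc V R, sqfMul phiInv r := by
    have : ∀ x ∈ Ioc 0 H, A x x = ∑ r ∈ Ioc V R, sqfMul phiInv r := fun x _ => by
      rw [← periodMean_truncSum_sq V R x]
      exact periodMean_congr fun n => (sq _).symm
    rw [sum_congr rfl this, sum_const, Nat.card_Ioc, Nat.sub_zero, nsmul_eq_mul]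
  rw [h1, h2, h3, add_sub_cancel_right, abs_mul, abs_two]
  have h4 : |∑ x ∈ Ioc 0 H, ∑ y ∈ Ioc 0 H, if y < x then A x y else 0| ≤
      ∑ x ∈ Ioc 0 H, ∑ y ∈ Ioc 0 H, if y < x then
        (V : ℝ) ^ (-(1 / 4) : ℝ) * (K * sigmaBound c (x - y)) else 0 := by
    refine (abs_sum_le_sum_abs _ _).trans (sum_le_sum fun x _ => ?_)
    refine (abs_sum_le_sum_abs _ _).trans (sum_le_sum fun y _ => ?_)
    split_ifs with h
    · exact hK V R x y hV h
    · simp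
  have hs0 : ∀ k, 0 ≤ sigmaBound c k := fun k => zero_le_one.trans (one_le_sigmaBound hc0 k)
  have h5 := sum_sum_lt_le (f := fun k => (V : ℝ) ^ (-(1 / 4) : ℝ) * (K * sigmaBound c k))
    (fun k => mul_nonneg (by positivity) (mul_nonneg hK0 (hs0 k))) H
  rw [← mul_sum, ← mul_sum] at h5
  have h6 : (H : ℝ) * ((V : ℝ) ^ (-(1 / 4) : ℝ) * (K * ∑ k ∈ Ioc 0 H, sigmaBound c k)) ≤
      H * ((V : ℝ) ^ (-(1 / 4) : ℝ) * (K * (K' * H))) := by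
    gcongr
    exact hK' H
  have h7 := h4.trans (h5.trans h6)
  calc _ ≤ 2 * (H * ((V : ℝ) ^ (-(1 / 4) : ℝ) * (K * (K' * H)))) := by linarith
    _ = _ := by ring

theorem mul_mul_le_pow_three_add {a b c : ℝ} (ha : 0 ≤ a) (hb : 0 ≤ b) (hc : 0 ≤ c) :
    a * b * c ≤ a ^ 3 + b ^ 3 + c ^ 3 := by
  nlinarith [mul_nonneg (add_nonneg (add_nonneg ha hb) hc)
    (add_nonneg (add_nonneg (sq_nonneg (a - b)) (sq_nonneg (b - c))) (sq_nonneg (a - c))),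
    pow_nonneg ha 3, pow_nonneg hb 3, pow_nonneg hc 3]

/-- By the inequality between arithmetic and geometric means, the three differences are treated
separately. -/
theorem exists_sum_sigmaBound_triple_le {c : ℝ} (hc : 0 ≤ c) :
    ∃ K : ℝ, 0 ≤ K ∧ ∀ H : ℕ,
      (∑ x ∈ Ioc 0 H, ∑ y ∈ Ioc 0 H, ∑ z ∈ Ioc 0 H, if z < y ∧ y < x then
        sigmaBound c ((x - y) * (x - z) * (y - z)) else 0) ≤ K * (H : ℝ) ^ 3 := by
  set c' := 3 * c + 3 * c ^ 2 + c ^ 3 with hc'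
  have hc'0 : 0 ≤ c' := by positivity
  obtain ⟨K, hK0, hK⟩ := exists_sum_sigmaBound_le hc'0
  refine ⟨3 * K, by positivity, fun H => ?_⟩
  set f := sigmaBound c' with hf
  have hf0 : ∀ k, 0 ≤ f k := fun k => zero_le_one.trans (one_le_sigmaBound hc'0 k)
  have hs0 : ∀ k, 0 ≤ sigmaBound c k := fun k => zero_le_one.trans (one_le_sigmaBound hc k)
  have hterm : ∀ x y z, (if z < y ∧ y < x then
      sigmaBound c ((x - y) * (x - z) * (y - z)) else 0) ≤
      (if y < x then f (x - y) else 0) + (if z < x then f (x - z) else 0) +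
        if z < y then f (y - z) else 0 := by
    intro x y z
    by_cases h : z < y ∧ y < x
    · rw [if_pos h, if_pos h.2, if_pos (h.1.trans h.2), if_pos h.1]
      have h1 : x - y ≠ 0 := by omega
      have h2 : x - z ≠ 0 := by omega
      have h3 : y - z ≠ 0 := by omega
      calc _ ≤ sigmaBound c (x - y) * sigmaBound c (x - z) * sigmaBound c (y - z) :=
            (sigmaBound_mul_le hc (Nat.mul_ne_zero h1 h2) h3).trans
              (mul_le_mul_of_nonneg_right (sigmaBound_mul_le hc h1 h2) (hs0 _))
        _ ≤ _ := mul_mul_le_pow_three_add (hs0 _) (hs0 _) (hs0 _)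
        _ ≤ _ := add_le_add (add_le_add (sigmaBound_pow_three_le hc _)
            (sigmaBound_pow_three_le hc _)) (sigmaBound_pow_three_le hc _)
    · rw [if_neg h]
      have hite : ∀ (q : Prop) [Decidable q] (k : ℕ), 0 ≤ if q then f k else 0 := by
        intro q _ k
        split_ifs
        · exact hf0 k
        · exact le_rfl
      exact add_nonneg (add_nonneg (hite _ _) (hite _ _)) (hite _ _)
  have hpair := sum_sum_lt_le hf0 H
  have hKH := hK H
  calc _ ≤ ∑ x ∈ Ioc 0 H, ∑ y ∈ Ioc 0 H, ∑ z ∈ Ioc 0 H,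
        ((if y < x then f (x - y) else 0) + (if z < x then f (x - z) else 0) +
          if z < y then f (y - z) else 0) :=
        sum_le_sum fun x _ => sum_le_sum fun y _ => sum_le_sum fun z _ => hterm x y z
    _ = 3 * (H * ∑ x ∈ Ioc 0 H, ∑ y ∈ Ioc 0 H, if y < x then f (x - y) else 0) := by
        simp only [sum_add_distrib, sum_const, Nat.card_Ioc, Nat.sub_zero, nsmul_eq_mul, ← mul_sum]
        ring
    _ ≤ 3 * (H * (H * (K * H))) := by
        gcongr
        exact hpair.trans (mul_le_mul_of_nonneg_left hKH (by positivity))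
    _ = _ := by ring

/-- The third moment of the tail sums is diagonal up to a small error. -/
theorem exists_abs_periodMean_windowSum_cube_sub_le :
    ∃ K : ℝ, 0 ≤ K ∧ ∀ V R H : ℕ, 1 ≤ V →
      |periodMean (primorial R) (fun n => windowSum V R H n ^ 3) -
        ∑ x ∈ Ioc 0 H, periodMean (primorial R) (fun n => truncSum V R (n + x) ^ 3)| ≤
      K * ((V : ℝ) ^ (-(1 / 4) : ℝ) *
        ((H : ℝ) ^ 3 + (H : ℝ) ^ 2 * ∑ r ∈ Ioc 0 R, sqfMul phiInv r)) := by
  obtain ⟨K1, c1, hK10, hc10, hK1⟩ := exists_abs_periodMean_triple_le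
  obtain ⟨K2, c2, hK20, hc20, hK2⟩ := exists_abs_periodMean_repeated_le
  obtain ⟨K3, hK30, hK3⟩ := exists_sum_sigmaBound_triple_le hc10
  obtain ⟨K4, hK40, hK4⟩ := exists_sum_sigmaBound_le hc20
  refine ⟨6 * (K1 * K3) + 6 * (K2 * K4), by positivity, fun V R H hV => ?_⟩
  set A : ℕ → ℕ → ℕ → ℝ := fun x y z => periodMean (primorial R)
    (fun n => truncSum V R (n + x) * truncSum V R (n + y) * truncSum V R (n + z)) with hA
  set L := ∑ r ∈ Ioc 0 R, sqfMul phiInv r with hL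
  have hL0 : 0 ≤ L := sum_nonneg fun r _ => sqfMul_nonneg r fun p hp => (phiInv_pos hp).le
  set v := (V : ℝ) ^ (-(1 / 4) : ℝ) with hv
  have hv0 : 0 ≤ v := by positivity
  have h1 : periodMean (primorial R) (fun n => windowSum V R H n ^ 3) =
      ∑ x ∈ Ioc 0 H, ∑ y ∈ Ioc 0 H, ∑ z ∈ Ioc 0 H, A x y z := by
    rw [hA]
    simp only [← periodMean_sum]
    refine periodMean_congr fun n => ?_
    rw [windowSum, pow_succ, sq, sum_mul_sum, sum_mul]
    refine sum_congr rfl fun x _ => ?_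
    rw [sum_mul]
    refine sum_congr rfl fun y _ => ?_
    rw [mul_sum]
  have h2 := sum_symmetric_eq (Ioc 0 H) A
    (fun x y z => periodMean_congr fun n => by ring) fun x y z => periodMean_congr fun n => by ring
  have h3 : ∑ x ∈ Ioc 0 H, A x x x =
      ∑ x ∈ Ioc 0 H, periodMean (primorial R) (fun n => truncSum V R (n + x) ^ 3) :=
    sum_congr rfl fun x _ => periodMean_congr fun n => by ring
  rw [h1, h2, h3, add_sub_cancel_right]
  have b1 : |∑ x ∈ Ioc 0 H, ∑ y ∈ Ioc 0 H, ∑ z ∈ Ioc 0 H, if z < y ∧ y < x then A x y z else 0| ≤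
      v * (K1 * (K3 * (H : ℝ) ^ 3)) := by
    calc _ ≤ ∑ x ∈ Ioc 0 H, ∑ y ∈ Ioc 0 H, ∑ z ∈ Ioc 0 H, v * (K1 * if z < y ∧ y < x then
          sigmaBound c1 ((x - y) * (x - z) * (y - z)) else 0) := by
          refine (abs_sum_le_sum_abs _ _).trans (sum_le_sum fun x _ => ?_)
          refine (abs_sum_le_sum_abs _ _).trans (sum_le_sum fun y _ => ?_)
          refine (abs_sum_le_sum_abs _ _).trans (sum_le_sum fun z _ => ?_)
          split_ifs with h
          · exact hK1 V R x y z hV h.1 h.2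
          · simp
      _ ≤ _ := by
          simp only [← mul_sum]
          gcongr
          exact hK3 H
  have hs0 : ∀ k, 0 ≤ sigmaBound c2 k := fun k => zero_le_one.trans (one_le_sigmaBound hc20 k)
  have b2 : |∑ x ∈ Ioc 0 H, ∑ y ∈ Ioc 0 H, if x ≠ y then A x y y else 0| ≤
      v * (L * (K2 * (2 * (H * (K4 * H))))) := by
    calc _ ≤ ∑ x ∈ Ioc 0 H, ∑ y ∈ Ioc 0 H, v * (L * (K2 *
          ((if y < x then sigmaBound c2 (x - y) else 0) +
            if x < y then sigmaBound c2 (y - x) else 0))) := by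
          refine (abs_sum_le_sum_abs _ _).trans (sum_le_sum fun x _ => ?_)
          refine (abs_sum_le_sum_abs _ _).trans (sum_le_sum fun y _ => ?_)
          have e : A x y y = periodMean (primorial R)
              (fun n => truncSum V R (n + y) * truncSum V R (n + y) * truncSum V R (n + x)) :=
            periodMean_congr fun n => by ring
          rcases lt_trichotomy x y with h | h | h
          · rw [if_pos h.ne, if_neg h.not_gt, if_pos h, zero_add, e]
            have := hK2 V R x y hV h.ne
            rwa [Nat.sub_eq_zero_of_le h.le, zero_add] at this
          · simp [h]
          · rw [if_pos h.ne', if_neg h.not_gt, if_pos h, add_zero, e]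
            have := hK2 V R x y hV h.ne'
            rwa [Nat.sub_eq_zero_of_le h.le, add_zero] at this
      _ = v * (L * (K2 * (2 * ∑ x ∈ Ioc 0 H, ∑ y ∈ Ioc 0 H,
            if y < x then sigmaBound c2 (x - y) else 0))) := by
          simp only [← mul_sum, sum_add_distrib]
          rw [sum_comm (f := fun x y => if x < y then sigmaBound c2 (y - x) else 0)]
          ring
      _ ≤ _ := by
          gcongr
          exact (sum_sum_lt_le hs0 H).trans (mul_le_mul_of_nonneg_left (hK4 H) (by positivity))
  calc _ ≤ 6 * (v * (K1 * (K3 * (H : ℝ) ^ 3))) + 3 * (v * (L * (K2 * (2 * (H * (K4 * H)))))) := by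
        refine (abs_add_le _ _).trans ?_
        rw [abs_mul, abs_mul, abs_of_pos (by norm_num : (0 : ℝ) < 6),
          abs_of_pos (by norm_num : (0 : ℝ) < 3)]
        linarith
    _ ≤ _ := by
        have m1 : 0 ≤ v * (K1 * (K3 * ((H : ℝ) ^ 2 * L))) := by positivity
        have m2 : 0 ≤ v * (K2 * (K4 * (H : ℝ) ^ 3)) := by positivity
        nlinarith

/-! ### Bounded perturbations and the main part -/

/-- The identity `∏_{p ∣ (r, n)} (1 - p) = ∑_{d ∣ (r, n)} d μ(d)` in terms of divisibility
indicators. -/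
theorem sqfMul_localValue_eq_sum_divisors (n r : ℕ) :
    sqfMul (localValue n) r =
      ∑ d ∈ r.divisors, if d ∣ n then sqfMul phiInv r * ((moebius d : ℝ) * d) else 0 := by
  by_cases hs : Squarefree r
  swap
  · simp [sqfMul_of_not_squarefree _ hs]
  have hr : r ≠ 0 := hs.ne_zero
  have hg : Squarefree (r.gcd n) := hs.squarefree_of_dvd (Nat.gcd_dvd_left r n)
  have hdiv : r.divisors.filter (· ∣ n) = (r.gcd n).divisors := by
    ext d
    simp only [mem_filter, Nat.mem_divisors, Nat.dvd_gcd_iff]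
    have := hg.ne_zero
    tauto
  rw [← sum_filter, hdiv, ← mul_sum]
  have h1 := IsMultiplicative.prodPrimeFactors_one_sub_of_squarefree (R := ℝ)
    (f := ((ArithmeticFunction.id : ArithmeticFunction ℕ) : ArithmeticFunction ℝ))
    isMultiplicative_id.natCast hg
  simp only [natCoe_apply, id_apply] at h1
  rw [← h1]
  have h2 : (r.gcd n).primeFactors = r.primeFactors.filter (· ∣ n) := by
    ext p
    simp only [mem_filter, Nat.mem_primeFactors, Nat.dvd_gcd_iff]
    have := hg.ne_zero
    tauto
  rw [h2, prod_filter, sqfMul_apply, sqfMul_apply, if_pos hs, if_pos hs, ← prod_mul_distrib]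
  refine prod_congr rfl fun p hp => ?_
  have hp2 := (prime_rpow_facts (Nat.prime_of_mem_primeFactors hp)).2
  have : (p : ℝ) - 1 ≠ 0 := by linarith
  rw [localValue, phiInv]
  split_ifs
  · field_simp
    ring
  · simp

/-- A residue class modulo `D` has `N / D + O(1)` elements in `{1, …, N}`. -/
theorem abs_card_modEq_sub_le {D : ℕ} (hD : 0 < D) (N v : ℕ) :
    |(#{j ∈ Ioc 0 N | j ≡ v [MOD D]} : ℝ) - N / D| ≤ 1 := by
  have hD' : (0 : ℚ) < D := by exact_mod_cast hD
  have h := Nat.Ioc_filter_modEq_card 0 N hD v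
  have h1 : |(#{j ∈ Ioc 0 N | j ≡ v [MOD D]} : ℚ) - N / D| ≤ 1 := by
    have e : (#{j ∈ Ioc 0 N | j ≡ v [MOD D]} : ℚ) =
        ((#{j ∈ Ioc 0 N | j ≡ v [MOD D]} : ℤ) : ℚ) := by norm_cast
    have hle : ⌊(((0 : ℕ) : ℚ) - v) / D⌋ ≤ ⌊((N : ℚ) - v) / D⌋ := by
      apply Int.floor_le_floor
      gcongr
      simp
    rw [e, h, max_eq_left (sub_nonneg.mpr hle)]
    have a1 := Int.floor_le (((N : ℚ) - v) / D)
    have a2 := Int.lt_floor_add_one (((N : ℚ) - v) / D)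
    have b1 := Int.floor_le ((((0 : ℕ) : ℚ) - v) / D)
    have b2 := Int.lt_floor_add_one ((((0 : ℕ) : ℚ) - v) / D)
    have e2 : (N : ℚ) / D = ((N : ℚ) - v) / D - (((0 : ℕ) : ℚ) - v) / D := by
      field_simp
      simp
    rw [e2, abs_le]
    push_cast at *
    constructor <;> linarith
  have h2 := (Rat.cast_le (K := ℝ)).mpr h1
  push_cast at h2
  exact h2

theorem dvd_add_iff_modEq {d : ℕ} (hd : 0 < d) (n j : ℕ) :
    d ∣ n + j ↔ j ≡ n * (d - 1) [MOD d] := by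
  have h : n + n * (d - 1) = n * d := by
    obtain ⟨e, rfl⟩ := Nat.exists_eq_succ_of_ne_zero hd.ne'
    simp [Nat.mul_succ, add_comm]
  constructor
  · intro h1
    refine Nat.ModEq.add_left_cancel' n ?_
    rw [h]
    exact (Nat.modEq_zero_iff_dvd.mpr h1).trans (Nat.modEq_zero_iff_dvd.mpr (Dvd.intro_left n rfl)).symm
  · intro h1
    have h2 := Nat.ModEq.add_left n h1
    rw [h] at h2
    exact Nat.modEq_zero_iff_dvd.mp (h2.trans (Nat.modEq_zero_iff_dvd.mpr (Dvd.intro_left n rfl)))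

/-- Short sums of `sqfMul (localValue n) r` cancel, unless `r = 1`. -/
theorem abs_sum_sqfMul_localValue_sub_le (r n H : ℕ) :
    |(∑ j ∈ Ioc 0 H, sqfMul (localValue (n + j)) r) - (if r = 1 then (H : ℝ) else 0)| ≤
      sqfMul phiInv r * ∑ d ∈ r.divisors, (d : ℝ) := by
  have hw : 0 ≤ sqfMul phiInv r := sqfMul_nonneg r fun p hp => (phiInv_pos hp).le
  have h1 : ∑ j ∈ Ioc 0 H, sqfMul (localValue (n + j)) r = ∑ d ∈ r.divisors,
      sqfMul phiInv r * ((moebius d : ℝ) * d) *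
        #{j ∈ Ioc 0 H | j ≡ n * (d - 1) [MOD d]} := by
    simp only [sqfMul_localValue_eq_sum_divisors]
    rw [sum_comm]
    refine sum_congr rfl fun d hd => ?_
    have hd0 := Nat.pos_of_mem_divisors hd
    rw [← sum_filter, sum_const, nsmul_eq_mul, mul_comm]
    simp only [dvd_add_iff_modEq hd0]
  have h2 : (if r = 1 then (H : ℝ) else 0) =
      ∑ d ∈ r.divisors, sqfMul phiInv r * ((moebius d : ℝ) * d) * (H / d) := by
    have e : ∀ d ∈ r.divisors, sqfMul phiInv r * ((moebius d : ℝ) * d) * (H / d) =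
        sqfMul phiInv r * H * moebius d := by
      intro d hd
      have : (d : ℝ) ≠ 0 := by exact_mod_cast (Nat.pos_of_mem_divisors hd).ne'
      field_simp
    rw [sum_congr rfl e, ← mul_sum]
    have h3 := congrArg (fun f : ArithmeticFunction ℝ => f r) (coe_moebius_mul_coe_zeta (R := ℝ))
    simp only [coe_mul_zeta_apply, intCoe_apply, one_apply] at h3
    rw [h3]
    split_ifs with hr1
    · rw [hr1, sqfMul_one]
      ring
    · ring
  rw [h1, h2, ← sum_sub_distrib, mul_sum]
  refine (abs_sum_le_sum_abs _ _).trans (sum_le_sum fun d hd => ?_)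
  rw [← mul_sub, abs_mul, abs_mul, abs_of_nonneg hw, abs_mul, Nat.abs_cast]
  have hmu : |(moebius d : ℝ)| ≤ 1 := by exact_mod_cast abs_moebius_le_one (n := d)
  have hc := abs_card_modEq_sub_le (Nat.pos_of_mem_divisors hd) H (n * (d - 1))
  calc _ ≤ sqfMul phiInv r * (1 * d) * 1 := by gcongr
    _ = _ := by ring

/-- The part of the window sum with small moduli is `H` up to a bounded error. -/
theorem abs_windowSum_zero_sub_le {V : ℕ} (hV : 1 ≤ V) (H n : ℕ) :
    |windowSum 0 V H n - H| ≤ ∑ r ∈ Ioc 0 V, sqfMul phiInv r * ∑ d ∈ r.divisors, (d : ℝ) := by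
  have h1 : (H : ℝ) = ∑ r ∈ Ioc 0 V, if r = 1 then (H : ℝ) else 0 := by
    rw [sum_ite_eq', if_pos (mem_Ioc.mpr ⟨one_pos, hV⟩)]
  conv_lhs => rw [h1]
  simp only [windowSum, truncSum]
  rw [sum_comm, ← sum_sub_distrib]
  exact (abs_sum_le_sum_abs _ _).trans (sum_le_sum fun r _ =>
    abs_sum_sqfMul_localValue_sub_le r n H)

theorem abs_truncSum_zero_le (V n : ℕ) : |truncSum 0 V n| ≤ V := by
  refine (abs_sum_le_sum_abs _ _).trans ?_
  have : ∀ r ∈ Ioc 0 V, |sqfMul (localValue n) r| ≤ 1 := by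
    intro r _
    rw [sqfMul_apply]
    split_ifs
    · rw [abs_prod]
      exact prod_le_one (fun _ _ => abs_nonneg _) fun p hp =>
        abs_localValue_le_one (Nat.prime_of_mem_primeFactors hp) n
    · simp
  refine (sum_le_sum this).trans (by simp)

theorem truncSum_add {V R : ℕ} (hVR : V ≤ R) (n : ℕ) :
    truncSum 0 V n + truncSum V R n = truncSum 0 R n :=
  sum_Ioc_consecutive _ (Nat.zero_le V) hVR

theorem windowSum_add {V R : ℕ} (hVR : V ≤ R) (H n : ℕ) :
    windowSum 0 V H n + windowSum V R H n = windowSum 0 R H n := by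
  rw [windowSum, windowSum, windowSum, ← sum_add_distrib]
  exact sum_congr rfl fun j _ => truncSum_add hVR _

theorem periodMean_windowSum (V R H : ℕ) (hR : 1 ≤ R) :
    periodMean (primorial R) (windowSum V R H) = if V = 0 then (H : ℝ) else 0 := by
  have : windowSum V R H = fun n => ∑ j ∈ Ioc 0 H, truncSum V R (n + j) := rfl
  rw [this, periodMean_sum, sum_congr rfl fun j _ => periodMean_truncSum V R j hR, sum_const,
    Nat.card_Ioc, Nat.sub_zero, nsmul_eq_mul]
  split_ifs <;> simp

theorem periodMean_sub (Q : ℕ) (f g : ℕ → ℝ) :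
    periodMean Q (fun n => f n - g n) = periodMean Q f - periodMean Q g := by
  simp only [periodMean, sum_sub_distrib, sub_div]

/-- A bounded perturbation changes the second moment little. -/
theorem abs_periodMean_sq_sub_le {Q : ℕ} (hQ : Q ≠ 0) {f g : ℕ → ℝ} {D η : ℝ} (hη : 0 < η)
    (h : ∀ n, |f n - g n| ≤ D) :
    |periodMean Q (fun n => f n ^ 2) - periodMean Q (fun n => g n ^ 2)| ≤
      η * periodMean Q (fun n => g n ^ 2) + (D ^ 2 / η + D ^ 2) := by
  rw [← periodMean_sub, ← periodMean_const_mul, ← periodMean_const hQ (D ^ 2 / η + D ^ 2),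
    ← periodMean_add]
  refine abs_periodMean_le fun n => ?_
  have hD := (abs_nonneg _).trans (h n)
  have h1 : f n ^ 2 - g n ^ 2 = 2 * (f n - g n) * g n + (f n - g n) ^ 2 := by ring
  have h2 : |f n ^ 2 - g n ^ 2| ≤ 2 * D * |g n| + D ^ 2 := by
    rw [h1]
    refine (abs_add_le _ _).trans ?_
    rw [abs_mul, abs_mul, abs_two, abs_pow]
    gcongr <;> exact h n
  -- the cross term is split by the inequality `2 a b ≤ η a² + b² / η`
  have h3 : 2 * D * |g n| ≤ η * g n ^ 2 + D ^ 2 / η := by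
    have h4 : η * g n ^ 2 + D ^ 2 / η - 2 * D * |g n| = (η * |g n| - D) ^ 2 / η := by
      rw [← sq_abs (g n)]
      field_simp
      ring
    have h5 : 0 ≤ (η * |g n| - D) ^ 2 / η := by positivity
    linarith
  linarith

/-- A bounded perturbation changes the third moment by a multiple of the second moment. -/
theorem abs_periodMean_cube_sub_le {Q : ℕ} (hQ : Q ≠ 0) {f g : ℕ → ℝ} {D : ℝ}
    (h : ∀ n, |f n - g n| ≤ D) :
    |periodMean Q (fun n => f n ^ 3) - periodMean Q (fun n => g n ^ 3)| ≤
      (3 * D + 3 * D ^ 2) * periodMean Q (fun n => g n ^ 2) + (3 * D ^ 2 + D ^ 3) := by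
  rw [← periodMean_sub, ← periodMean_const_mul, ← periodMean_const hQ (3 * D ^ 2 + D ^ 3),
    ← periodMean_add]
  refine abs_periodMean_le fun n => ?_
  have hD := (abs_nonneg _).trans (h n)
  have h1 : f n ^ 3 - g n ^ 3 =
      3 * (f n - g n) * g n ^ 2 + 3 * (f n - g n) ^ 2 * g n + (f n - g n) ^ 3 := by ring
  have h2 : |f n ^ 3 - g n ^ 3| ≤ 3 * D * g n ^ 2 + 3 * D ^ 2 * |g n| + D ^ 3 := by
    rw [h1]
    refine (abs_add_three _ _ _).trans ?_
    rw [abs_mul, abs_mul, abs_mul, abs_mul, abs_pow, abs_pow, abs_pow, sq_abs,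
      abs_of_pos (by norm_num : (0 : ℝ) < 3)]
    gcongr <;> exact h n
  have h3 : |g n| ≤ 1 + g n ^ 2 := by
    rw [← sq_abs (g n)]
    nlinarith [sq_nonneg (|g n| - 1), abs_nonneg (g n)]
  have h4 := mul_le_mul_of_nonneg_left h3 (by positivity : (0 : ℝ) ≤ 3 * D ^ 2)
  linarith

/-- `∑_{r ≤ R} μ²(r) / φ(r) = log R + O(1)`. -/
theorem exists_abs_sum_phiInv_sub_log_le :
    ∃ K : ℝ, 0 ≤ K ∧ ∀ R : ℕ, 1 ≤ R →
      |∑ r ∈ Ioc 0 R, sqfMul phiInv r - Real.log R| ≤ K := by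
  obtain ⟨K, hK0, hK⟩ : ∃ K : ℝ, 0 ≤ K ∧ _ :=
    exists_abs_sum_sqfMul_sub_le (C := 2) (by norm_num) nearInv_phiInv
  have hs := one_le_sigmaBound (c := 3) (by norm_num) 1
  refine ⟨1 + K * sigmaBound 3 1, by positivity, fun N hN => ?_⟩
  have h := hK 1 one_ne_zero 1 N one_pos (by exact_mod_cast hN)
  rw [Nat.floor_one, Nat.floor_natCast, Real.one_rpow, mul_one, div_one, posConst_phiInv_one,
    one_mul] at h
  have hsplit := sum_Ioc_consecutive (fun n => sqfMul phiInv n) (Nat.zero_le 1) hN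
  have h1 : ∑ n ∈ Ioc 0 1, sqfMul phiInv n = 1 := by simp [sqfMul_one]
  have h2 : ∑ n ∈ Ioc 1 N, sqfMul (awayFrom 1 phiInv) n = ∑ n ∈ Ioc 1 N, sqfMul phiInv n :=
    sum_congr rfl fun n _ => by rw [sqfMul_awayFrom, if_pos (Nat.coprime_one_right n)]
  rw [h2] at h
  rw [abs_le] at h ⊢
  constructor <;> linarith

/-- For every `ε > 0`, the third moment `quadSum R` is within `ε log² R` of `(3 / 4) log² R`
for large `R`. -/
theorem exists_abs_quadSum_sub_le_of_pos {ε : ℝ} (hε : 0 < ε) :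
    ∃ l₀ : ℝ, ∀ R : ℕ, l₀ ≤ Real.log R →
      |quadSum R - 3 / 4 * Real.log R ^ 2| ≤ ε * Real.log R ^ 2 := by
  obtain ⟨K, hK0, hK⟩ := exists_abs_quadSum_sub_le
  -- the factor `4` accounts for `(1 + log R)² ≤ 4 log² R`
  obtain ⟨Z, hZ1, hZ⟩ : ∃ Z : ℕ, 1 ≤ Z ∧ K * ((Z : ℝ) ^ (-(1 / 8) : ℝ) * 4) ≤ ε / 2 := by
    have h1 : Filter.Tendsto (fun Z : ℕ => K * ((Z : ℝ) ^ (-(1 / 8) : ℝ) * 4)) Filter.atTop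
        (nhds (K * (0 * 4))) :=
      (((tendsto_rpow_neg_atTop (by norm_num : (0 : ℝ) < 1 / 8)).comp
        tendsto_natCast_atTop_atTop).mul_const 4).const_mul K
    rw [zero_mul, mul_zero] at h1
    obtain ⟨Z, h2, h3⟩ := ((h1.eventually (gt_mem_nhds (half_pos hε))).and
      (Filter.eventually_ge_atTop 1)).exists
    exact ⟨Z, h3, h2.le⟩
  set z := Real.log Z with hz
  have hz0 : 0 ≤ z := Real.log_natCast_nonneg Z
  set B := K * (2 * (1 + z)) + 3 * z + 3 * z ^ 2 with hB
  have hB0 : 0 ≤ B := by positivity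
  refine ⟨1 + 2 * z + 2 * B / ε, fun R hR => ?_⟩
  set l := Real.log R with hl
  have hBε : 0 ≤ 2 * B / ε := by positivity
  have hl1 : 1 ≤ l := by linarith
  have hR0 : (0 : ℝ) < R := by
    rcases Nat.eq_zero_or_pos R with h0 | h0
    · rw [hl, h0] at hl1
      norm_num at hl1
    · exact_mod_cast h0
  have hZ0 : (0 : ℝ) < Z := by exact_mod_cast hZ1
  have hZR : Z * Z ≤ R := by
    have h1 : Real.log ((Z : ℝ) * Z) ≤ Real.log R := by
      rw [Real.log_mul hZ0.ne' hZ0.ne']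
      linarith
    exact_mod_cast (Real.log_le_log_iff (by positivity) hR0).mp h1
  have h := hK Z R hZ1 hZR
  rw [Real.log_div hR0.ne' (by positivity), Real.log_mul hZ0.ne' hZ0.ne'] at h
  have hBl : B ≤ ε / 2 * l := by
    have h1 : 2 * B / ε ≤ l := by linarith
    rw [div_le_iff₀ hε] at h1
    linarith
  have hv : K * ((Z : ℝ) ^ (-(1 / 8) : ℝ) * (1 + l) ^ 2) ≤ ε / 2 * l ^ 2 := by
    have h1 : (1 + l) ^ 2 ≤ 4 * l ^ 2 := by nlinarith
    calc _ ≤ K * ((Z : ℝ) ^ (-(1 / 8) : ℝ) * (4 * l ^ 2)) := by gcongr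
      _ = K * ((Z : ℝ) ^ (-(1 / 8) : ℝ) * 4) * l ^ 2 := by ring
      _ ≤ _ := by gcongr
  have hm : K * ((1 + l) * (1 + z)) ≤ K * (2 * (1 + z)) * l := by
    have h1 : K * ((1 + l) * (1 + z)) ≤ K * ((2 * l) * (1 + z)) := by
      gcongr
      linarith
    linarith
  have hmain : |3 / 4 * (l - (z + z)) ^ 2 - 3 / 4 * l ^ 2| ≤ (3 * z + 3 * z ^ 2) * l := by
    have e : 3 / 4 * (l - (z + z)) ^ 2 - 3 / 4 * l ^ 2 = - (3 * z * l) + 3 * z ^ 2 := by ring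
    have h1 : 3 * z ^ 2 ≤ 3 * z ^ 2 * l := le_mul_of_one_le_right (by positivity) hl1
    have h2 : 0 ≤ 3 * z * l := by positivity
    have h3 : 0 ≤ 3 * z ^ 2 := by positivity
    rw [e, abs_le]
    constructor <;> linarith
  have hBl2 : B * l ≤ ε / 2 * l * l := mul_le_mul_of_nonneg_right hBl (by linarith)
  have hfin : K * ((1 + l) * (1 + z) + (Z : ℝ) ^ (-(1 / 8) : ℝ) * (1 + l) ^ 2) +
      (3 * z + 3 * z ^ 2) * l ≤ ε * l ^ 2 := by
    have e : B * l = K * (2 * (1 + z)) * l + (3 * z + 3 * z ^ 2) * l := by rw [hB]; ring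
    nlinarith
  calc _ ≤ |quadSum R - 3 / 4 * (l - (z + z)) ^ 2| +
        |3 / 4 * (l - (z + z)) ^ 2 - 3 / 4 * l ^ 2| := abs_sub_le _ _ _
    _ ≤ _ := by linarith

/-! ### Second and third moments over a period -/

theorem exists_rpow_neg_quarter_le (K : ℝ) {ε : ℝ} (hε : 0 < ε) :
    ∃ V : ℕ, 1 ≤ V ∧ K * (V : ℝ) ^ (-(1 / 4) : ℝ) ≤ ε := by
  have h1 : Filter.Tendsto (fun Z : ℕ => K * (Z : ℝ) ^ (-(1 / 4) : ℝ)) Filter.atTop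
      (nhds (K * 0)) :=
    ((tendsto_rpow_neg_atTop (by norm_num : (0 : ℝ) < 1 / 4)).comp
      tendsto_natCast_atTop_atTop).const_mul K
  rw [mul_zero] at h1
  obtain ⟨V, h2, h3⟩ := ((h1.eventually (gt_mem_nhds hε)).and
    (Filter.eventually_ge_atTop 1)).exists
  exact ⟨V, h3, h2.le⟩

theorem le_of_log_le {V R : ℕ} {x : ℝ} (hV : 1 ≤ V) (hx : Real.log V + 1 ≤ x)
    (h : x ≤ Real.log R) : V ≤ R ∧ 1 ≤ R := by
  have hV0 : (0 : ℝ) < V := by exact_mod_cast hV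
  have hlV := Real.log_natCast_nonneg V
  have hR0 : (0 : ℝ) < R := by
    rcases Nat.eq_zero_or_pos R with h0 | h0
    · rw [h0, Nat.cast_zero, Real.log_zero] at h
      linarith
    · exact_mod_cast h0
  have : (V : ℝ) ≤ R := (Real.log_le_log_iff hV0 hR0).mp (by linarith)
  exact ⟨by exact_mod_cast this, by exact_mod_cast hR0⟩

/-- The first two moments of the window sums of the tail, in terms of `log R`. -/
theorem exists_windowSum_tail_bounds :
    ∃ K : ℝ, 0 ≤ K ∧ ∀ V : ℕ, 1 ≤ V → ∃ B : ℝ, 0 ≤ B ∧ ∀ R H : ℕ, V ≤ R →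
      |periodMean (primorial R) (fun n => windowSum V R H n ^ 2) - H * Real.log R| ≤
        K * ((V : ℝ) ^ (-(1 / 4) : ℝ) * (H : ℝ) ^ 2) + B * H := by
  obtain ⟨K, hK0, hK⟩ := exists_abs_periodMean_windowSum_sq_sub_le
  obtain ⟨K1, hK10, hK1⟩ := exists_abs_sum_phiInv_sub_log_le
  refine ⟨K, hK0, fun V hV => ?_⟩
  have hL : 0 ≤ ∑ r ∈ Ioc 0 V, sqfMul phiInv r :=
    sum_nonneg fun r _ => sqfMul_nonneg r fun p hp => (phiInv_pos hp).le
  refine ⟨K1 + ∑ r ∈ Ioc 0 V, sqfMul phiInv r, by positivity, fun R H hVR => ?_⟩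
  have h := hK V R H hV
  have h1 := hK1 R (hV.trans hVR)
  have h2 := sum_Ioc_consecutive (fun r => sqfMul phiInv r) (Nat.zero_le V) hVR
  set LV := ∑ r ∈ Ioc 0 V, sqfMul phiInv r
  set LR := ∑ r ∈ Ioc 0 R, sqfMul phiInv r
  have h3 : ∑ r ∈ Ioc V R, sqfMul phiInv r = LR - LV := by linarith
  rw [h3] at h
  have h4 : |(H : ℝ) * (LR - LV) - H * Real.log R| ≤ (K1 + LV) * H := by
    rw [← mul_sub, abs_mul, Nat.abs_cast, mul_comm]
    refine mul_le_mul_of_nonneg_right ?_ (Nat.cast_nonneg H)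
    rw [abs_le] at h1 ⊢
    constructor <;> linarith
  exact (abs_sub_le _ _ _).trans (add_le_add h h4)

/-- Splitting the window sum at `V`: up to a bounded error it is `H` plus a centred variable. -/
theorem periodMean_add_windowSum_sq {V R : ℕ} (hV : 1 ≤ V) (hR : 1 ≤ R) (H : ℕ) :
    periodMean (primorial R) (fun n => ((H : ℝ) + windowSum V R H n) ^ 2) =
      (H : ℝ) ^ 2 + periodMean (primorial R) (fun n => windowSum V R H n ^ 2) := by
  have h0 : periodMean (primorial R) (windowSum V R H) = 0 := by
    rw [periodMean_windowSum V R H hR, if_neg (by omega)]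
  have h1 : ∀ n, ((H : ℝ) + windowSum V R H n) ^ 2 =
      (H : ℝ) ^ 2 + (2 * H * windowSum V R H n + windowSum V R H n ^ 2) := fun n => by ring
  rw [periodMean_congr h1, periodMean_add, periodMean_add, periodMean_const_mul,
    periodMean_const (primorial_ne_zero R), h0]
  ring

theorem periodMean_add_windowSum_cube {V R : ℕ} (hV : 1 ≤ V) (hR : 1 ≤ R) (H : ℕ) :
    periodMean (primorial R) (fun n => ((H : ℝ) + windowSum V R H n) ^ 3) =
      (H : ℝ) ^ 3 + 3 * H * periodMean (primorial R) (fun n => windowSum V R H n ^ 2) +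
        periodMean (primorial R) (fun n => windowSum V R H n ^ 3) := by
  have h0 : periodMean (primorial R) (windowSum V R H) = 0 := by
    rw [periodMean_windowSum V R H hR, if_neg (by omega)]
  have h1 : ∀ n, ((H : ℝ) + windowSum V R H n) ^ 3 =
      (H : ℝ) ^ 3 + (3 * (H : ℝ) ^ 2 * windowSum V R H n + (3 * H * windowSum V R H n ^ 2 +
        windowSum V R H n ^ 3)) := fun n => by ring
  rw [periodMean_congr h1, periodMean_add, periodMean_add, periodMean_add, periodMean_const_mul,
    periodMean_const_mul, periodMean_const (primorial_ne_zero R), h0]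
  ring

/-- The window sum is `H` plus its tail, up to an error which depends only on `V`. -/
theorem exists_abs_windowSum_sub_le {V : ℕ} (hV : 1 ≤ V) :
    ∃ D : ℝ, 0 ≤ D ∧ ∀ R H n : ℕ, V ≤ R →
      |windowSum 0 R H n - (H + windowSum V R H n)| ≤ D := by
  refine ⟨∑ r ∈ Ioc 0 V, sqfMul phiInv r * ∑ d ∈ r.divisors, (d : ℝ),
    sum_nonneg fun r _ => mul_nonneg (sqfMul_nonneg r fun p hp => (phiInv_pos hp).le)
      (sum_nonneg fun _ _ => Nat.cast_nonneg _), fun R H n hVR => ?_⟩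
  have h := abs_windowSum_zero_sub_le hV H n
  rw [← windowSum_add hVR H n]
  convert h using 2
  ring

/-- The second moment of the window sums of the short divisor sum. -/
theorem exists_abs_periodMean_windowSum_sq_le {C ε : ℝ} (hC : 0 ≤ C) (hε : 0 < ε) :
    ∃ l₀ : ℝ, ∀ R H : ℕ, l₀ ≤ Real.log R → 1 ≤ H → (H : ℝ) ≤ C * Real.log R →
      |periodMean (primorial R) (fun n => windowSum 0 R H n ^ 2) -
        ((H : ℝ) ^ 2 + H * Real.log R)| ≤ ε * (H * Real.log R) := by
  obtain ⟨K, hK0, hK⟩ := exists_windowSum_tail_bounds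
  obtain ⟨V, hV1, hV⟩ := exists_rpow_neg_quarter_le (K * C) (by positivity : 0 < ε / 4)
  obtain ⟨B, hB0, hB⟩ := hK V hV1
  obtain ⟨D, hD0, hD⟩ := exists_abs_windowSum_sub_le hV1
  -- `η` times the second moment `≤ (C + 1 + ε + B) H log R` is to be at most `(ε / 4) H log R`
  set η := ε / (4 * (C + 1 + ε + B)) with hη
  have hη0 : 0 < η := by positivity
  -- `E` collects the errors of order `H`, which are small compared with `H log R` for large `R`
  set E := B + D ^ 2 / η + D ^ 2 with hE
  have hE0 : 0 ≤ E := by positivity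
  refine ⟨Real.log V + 1 + 2 * E / ε, fun R H hl hH hHC => ?_⟩
  have hEε : 0 ≤ 2 * E / ε := by positivity
  have hlV := Real.log_natCast_nonneg V
  obtain ⟨hVR, hR1⟩ := le_of_log_le hV1 (by linarith) hl
  have hW := hB R H hVR
  have hF := abs_periodMean_sq_sub_le (primorial_ne_zero R) hη0 fun n => hD R H n hVR
  rw [periodMean_add_windowSum_sq hV1 hR1 H] at hF
  have hl1 : 1 ≤ Real.log R := by linarith
  have hEl : E ≤ ε / 2 * Real.log R := by
    have h1 : 2 * E / ε ≤ Real.log R := by linarith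
    rw [div_le_iff₀ hε] at h1
    linarith
  set l := Real.log R
  set v := (V : ℝ) ^ (-(1 / 4) : ℝ)
  set W := periodMean (primorial R) (fun n => windowSum V R H n ^ 2)
  have hH1 : (1 : ℝ) ≤ H := by exact_mod_cast hH
  generalize (H : ℝ) = h at *
  have hh2 : h ^ 2 ≤ C * (h * l) := by
    have := mul_le_mul_of_nonneg_left hHC (by linarith : 0 ≤ h)
    linarith
  have hv0 : 0 ≤ v := by positivity
  have hKv : K * (v * h ^ 2) ≤ ε / 4 * (h * l) := by
    calc K * (v * h ^ 2) ≤ K * (v * (C * (h * l))) := by gcongr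
      _ = K * C * v * (h * l) := by ring
      _ ≤ _ := mul_le_mul_of_nonneg_right hV (by positivity)
  have hhl : h ≤ h * l := le_mul_of_one_le_right (by linarith) hl1
  have hBh : B * h ≤ B * (h * l) := mul_le_mul_of_nonneg_left hhl hB0
  have hη2 : η * (h ^ 2 + W) ≤ ε / 4 * (h * l) := by
    have h1 : h ^ 2 + W ≤ (C + 1 + ε + B) * (h * l) := by
      have h2 := (abs_le.mp hW).2
      have h3 : 0 ≤ ε * (h * l) := by positivity
      linarith
    calc η * (h ^ 2 + W) ≤ η * ((C + 1 + ε + B) * (h * l)) := by gcongr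
      _ = _ := by
          rw [hη]
          field_simp
  have hfin : (B * h + (D ^ 2 / η + D ^ 2)) ≤ ε / 2 * (h * l) := by
    have h1 : D ^ 2 / η + D ^ 2 ≤ (D ^ 2 / η + D ^ 2) * h :=
      le_mul_of_one_le_right (by positivity) hH1
    calc _ ≤ E * h := by rw [hE]; linarith
      _ ≤ ε / 2 * l * h := mul_le_mul_of_nonneg_right hEl (by linarith)
      _ = _ := by ring
  rw [abs_le] at hF hW ⊢
  constructor <;> linarith

/-- The third moment of a single term of the tail, in terms of `log R`. -/
theorem exists_abs_periodMean_truncSum_cube_sub_le {V : ℕ} :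
    ∃ B : ℝ, 0 ≤ B ∧ ∀ R x : ℕ, V ≤ R → 1 ≤ Real.log R →
      |periodMean (primorial R) (fun n => truncSum V R (n + x) ^ 3) - quadSum R| ≤
        B * Real.log R := by
  obtain ⟨K1, hK10, hK1⟩ := exists_abs_sum_phiInv_sub_log_le
  set D : ℝ := (V : ℝ) with hD
  have hD0 : 0 ≤ D := Nat.cast_nonneg V
  refine ⟨(3 * D + 3 * D ^ 2) * (1 + K1) + (3 * D ^ 2 + D ^ 3), by positivity,
    fun R x hVR hl => ?_⟩
  have hR1 : 1 ≤ R := by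
    rcases Nat.eq_zero_or_pos R with h0 | h0
    · rw [h0, Nat.cast_zero, Real.log_zero] at hl
      linarith
    · exact h0
  have h := abs_periodMean_cube_sub_le (primorial_ne_zero R)
    (f := fun n => truncSum V R (n + x)) (g := fun n => truncSum 0 R (n + x)) (D := D) fun n => by
      rw [← truncSum_add hVR, sub_add_cancel_right, abs_neg]
      exact abs_truncSum_zero_le V _
  rw [periodMean_truncSum_cube, periodMean_truncSum_sq] at h
  refine h.trans ?_
  have h1 := (abs_le.mp (hK1 R hR1)).2
  have h2 : ∑ r ∈ Ioc 0 R, sqfMul phiInv r ≤ (1 + K1) * Real.log R := by nlinarith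
  have h3 : 3 * D ^ 2 + D ^ 3 ≤ (3 * D ^ 2 + D ^ 3) * Real.log R :=
    le_mul_of_one_le_right (by positivity) hl
  have h4 := mul_le_mul_of_nonneg_left h2 (by positivity : 0 ≤ 3 * D + 3 * D ^ 2)
  linarith

/-- The third moment of the window sums of the short divisor sum. -/
theorem exists_abs_periodMean_windowSum_cube_le {C ε : ℝ} (hC : 0 ≤ C) (hε : 0 < ε) :
    ∃ l₀ : ℝ, ∀ R H : ℕ, l₀ ≤ Real.log R → 1 ≤ H → (H : ℝ) ≤ C * Real.log R →
      |periodMean (primorial R) (fun n => windowSum 0 R H n ^ 3) -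
        ((H : ℝ) ^ 3 + 3 * (H : ℝ) ^ 2 * Real.log R + 3 / 4 * (H * Real.log R ^ 2))| ≤
          ε * (H * Real.log R ^ 2) := by
  obtain ⟨K, hK0, hK⟩ := exists_windowSum_tail_bounds
  obtain ⟨K3, hK30, hK3⟩ := exists_abs_periodMean_windowSum_cube_sub_le
  obtain ⟨K1, hK10, hK1⟩ := exists_abs_sum_phiInv_sub_log_le
  obtain ⟨l1, hquad⟩ := exists_abs_quadSum_sub_le_of_pos (by positivity : 0 < ε / 4)
  -- the constant collects the off-diagonal errors of the second and of the third moment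
  obtain ⟨V, hV1, hV⟩ := exists_rpow_neg_quarter_le
    (3 * K * C ^ 2 + K3 * (C ^ 2 + C * (1 + K1))) (by positivity : 0 < ε / 4)
  obtain ⟨B, hB0, hB⟩ := hK V hV1
  obtain ⟨B3, hB30, hB3⟩ := exists_abs_periodMean_truncSum_cube_sub_le (V := V)
  obtain ⟨D, hD0, hD⟩ := exists_abs_windowSum_sub_le hV1
  set v := (V : ℝ) ^ (-(1 / 4) : ℝ) with hv
  have hv0 : 0 ≤ v := by positivity
  -- `E` collects the errors of order `H log R`
  set E := (3 * D + 3 * D ^ 2) * (C + 1 + K * (v * C) + B) + (3 * D ^ 2 + D ^ 3) +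
    3 * B * C + B3 with hE
  have hE0 : 0 ≤ E := by positivity
  refine ⟨Real.log V + 1 + 2 * E / ε + |l1|, fun R H hl hH hHC => ?_⟩
  have hEε : 0 ≤ 2 * E / ε := by positivity
  have hlV := Real.log_natCast_nonneg V
  have hl1a := abs_nonneg l1
  obtain ⟨hVR, hR1⟩ := le_of_log_le hV1 (by linarith) hl
  have hl1 : 1 ≤ Real.log R := by linarith
  have hW := hB R H hVR
  have hF := abs_periodMean_cube_sub_le (primorial_ne_zero R) fun n => hD R H n hVR
  rw [periodMean_add_windowSum_sq hV1 hR1 H, periodMean_add_windowSum_cube hV1 hR1 H] at hF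
  have hW3 := hK3 V R H hV1
  have hq := hquad R (by linarith [le_abs_self l1])
  have hL := (abs_le.mp (hK1 R hR1)).2
  have hL0 : 0 ≤ ∑ r ∈ Ioc 0 R, sqfMul phiInv r :=
    sum_nonneg fun r _ => sqfMul_nonneg r fun p hp => (phiInv_pos hp).le
  have hG : |∑ x ∈ Ioc 0 H, periodMean (primorial R) (fun n => truncSum V R (n + x) ^ 3) -
      H * quadSum R| ≤ H * (B3 * Real.log R) := by
    have e : (H : ℝ) * quadSum R = ∑ x ∈ Ioc 0 H, quadSum R := by
      rw [sum_const, Nat.card_Ioc, Nat.sub_zero, nsmul_eq_mul]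
    have e2 : (H : ℝ) * (B3 * Real.log R) = ∑ x ∈ Ioc 0 H, B3 * Real.log R := by
      rw [sum_const, Nat.card_Ioc, Nat.sub_zero, nsmul_eq_mul]
    rw [e, e2, ← sum_sub_distrib]
    exact (abs_sum_le_sum_abs _ _).trans (sum_le_sum fun x _ => hB3 R x hVR hl1)
  have hEl : E ≤ ε / 2 * Real.log R := by
    have h1 : 2 * E / ε ≤ Real.log R := by linarith
    rw [div_le_iff₀ hε] at h1
    linarith
  set l := Real.log R
  set L := ∑ r ∈ Ioc 0 R, sqfMul phiInv r
  set W := periodMean (primorial R) (fun n => windowSum V R H n ^ 2)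
  set W3 := periodMean (primorial R) (fun n => windowSum V R H n ^ 3)
  set S3 := ∑ x ∈ Ioc 0 H, periodMean (primorial R) (fun n => truncSum V R (n + x) ^ 3)
  set q := quadSum R
  have hH1 : (1 : ℝ) ≤ H := by exact_mod_cast hH
  generalize (H : ℝ) = h at *
  have hh0 : 0 ≤ h := by linarith
  have hl0 : 0 ≤ l := by linarith
  have hhl : h ≤ h * l := le_mul_of_one_le_right hh0 hl1
  have hh2 : h ^ 2 ≤ C * (h * l) := by
    have := mul_le_mul_of_nonneg_left hHC (by linarith : 0 ≤ h)
    linarith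
  have hh3 : h ^ 3 ≤ C ^ 2 * (h * l ^ 2) := by
    calc h ^ 3 = h ^ 2 * h := by ring
      _ ≤ C * (h * l) * (C * l) := by gcongr
      _ = _ := by ring
  have hL' : L ≤ (1 + K1) * l := by
    have := le_mul_of_one_le_right hK10 hl1
    linarith
  -- the second moment of the tail, multiplied by `3 h`
  have c2 : 3 * h * |W - h * l| ≤ 3 * K * C ^ 2 * v * (h * l ^ 2) + 3 * B * C * (h * l) := by
    calc 3 * h * |W - h * l| ≤ 3 * h * (K * (v * h ^ 2) + B * h) := by gcongr
      _ = 3 * K * v * h ^ 3 + 3 * B * h ^ 2 := by ring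
      _ ≤ 3 * K * v * (C ^ 2 * (h * l ^ 2)) + 3 * B * (C * (h * l)) := by gcongr
      _ = _ := by ring
  have c3 : |W3 - S3| ≤ K3 * (C ^ 2 + C * (1 + K1)) * v * (h * l ^ 2) := by
    calc |W3 - S3| ≤ K3 * (v * (h ^ 3 + h ^ 2 * L)) := hW3
      _ ≤ K3 * (v * (C ^ 2 * (h * l ^ 2) + C * (h * l) * ((1 + K1) * l))) := by gcongr
      _ = _ := by ring
  have c4 : h * |q - 3 / 4 * l ^ 2| ≤ ε / 4 * (h * l ^ 2) := by
    calc _ ≤ h * (ε / 4 * l ^ 2) := by gcongr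
      _ = _ := by ring
  have c5 : (3 * D + 3 * D ^ 2) * (h ^ 2 + W) + (3 * D ^ 2 + D ^ 3) ≤
      (3 * D + 3 * D ^ 2) * (C + 1 + K * (v * C) + B) * (h * l) +
        (3 * D ^ 2 + D ^ 3) * (h * l) := by
    have h1 : h ^ 2 + W ≤ (C + 1 + K * (v * C) + B) * (h * l) := by
      have h2 := (abs_le.mp hW).2
      have h3 : K * (v * h ^ 2) ≤ K * (v * (C * (h * l))) := by gcongr
      have h4 := mul_le_mul_of_nonneg_left hhl hB0
      linarith
    have h2 : 3 * D ^ 2 + D ^ 3 ≤ (3 * D ^ 2 + D ^ 3) * (h * l) :=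
      le_mul_of_one_le_right (by positivity) (hH1.trans hhl)
    have h3 := mul_le_mul_of_nonneg_left h1 (by positivity : 0 ≤ 3 * D + 3 * D ^ 2)
    linarith
  have hfin : E * (h * l) ≤ ε / 2 * (h * l ^ 2) := by
    calc E * (h * l) ≤ ε / 2 * l * (h * l) := by gcongr
      _ = _ := by ring
  have hVfin := mul_le_mul_of_nonneg_right hV (by positivity : 0 ≤ h * l ^ 2)
  have t2 : |3 * h * W - 3 * h ^ 2 * l| = 3 * h * |W - h * l| := by
    rw [← abs_of_nonneg (by positivity : 0 ≤ 3 * h), ← abs_mul, abs_of_nonneg (by positivity : 0 ≤ 3 * h)]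
    congr 1
    ring
  have t4 : |h * q - 3 / 4 * (h * l ^ 2)| = h * |q - 3 / 4 * l ^ 2| := by
    rw [← abs_of_nonneg hh0, ← abs_mul, abs_of_nonneg hh0]
    congr 1
    ring
  rw [← t2] at c2
  rw [← t4] at c4
  have hEe : E * (h * l) = (3 * D + 3 * D ^ 2) * (C + 1 + K * (v * C) + B) * (h * l) +
      (3 * D ^ 2 + D ^ 3) * (h * l) + 3 * B * C * (h * l) + h * (B3 * l) := by
    rw [hE]
    ring
  have c1 := hF.trans c5
  rw [abs_le] at c1 c2 c3 c4 hG ⊢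
  constructor <;> linarith

/-! ### Passage to the integers up to `N` -/

theorem periodMean_modEq {D Q : ℕ} (hQ : 0 < Q) (hD : D ∣ Q) (m : ℕ) :
    periodMean Q (fun n => if n ≡ m [MOD D] then (1 : ℝ) else 0) = 1 / D := by
  have hD0 := Nat.pos_of_dvd_of_pos hD hQ
  have h := Nat.count_modEq_card Q hD0 m
  rw [Nat.mod_eq_zero_of_dvd hD, if_neg (Nat.not_lt_zero _), add_zero,
    Nat.count_eq_card_filter_range] at h
  have hDr : (D : ℝ) ≠ 0 := by exact_mod_cast hD0.ne'
  have hQr : (Q : ℝ) ≠ 0 := by exact_mod_cast hQ.ne'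
  rw [periodMean, sum_boole, h, Nat.cast_div hD hDr]
  field_simp

/-- The integers up to `N` satisfying finitely many divisibility conditions are counted by `N` times
their density, with an error at most `1`. -/
theorem abs_card_forall_dvd_sub_le {k Q : ℕ} (hQ : 0 < Q) (d j : Fin k → ℕ)
    (hd : ∀ i, d i ∣ Q) (N : ℕ) :
    |(∑ n ∈ Ioc 0 N, if ∀ i, d i ∣ n + j i then (1 : ℝ) else 0) -
      N * periodMean Q (fun n => if ∀ i, d i ∣ n + j i then (1 : ℝ) else 0)| ≤ 1 := by
  by_cases hex : ∃ m, ∀ i, d i ∣ m + j i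
  · obtain ⟨m, hm⟩ := hex
    have hD : univ.lcm d ∣ Q := Finset.lcm_dvd fun i _ => hd i
    have key : ∀ n, (∀ i, d i ∣ n + j i) ↔ n ≡ m [MOD univ.lcm d] := by
      intro n
      have h1 : (∀ i, d i ∣ n + j i) ↔ ∀ i, n ≡ m [MOD d i] := by
        refine forall_congr' fun i => ⟨fun h => ?_, fun h => ?_⟩
        · exact Nat.ModEq.add_right_cancel' (j i) ((Nat.modEq_zero_iff_dvd.mpr h).trans
            (Nat.modEq_zero_iff_dvd.mpr (hm i)).symm)
        · exact Nat.modEq_zero_iff_dvd.mp ((h.add_right (j i)).trans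
            (Nat.modEq_zero_iff_dvd.mpr (hm i)))
      rw [h1]
      constructor
      · intro h
        rw [Nat.modEq_iff_dvd, Int.natCast_dvd]
        refine Finset.lcm_dvd fun i _ => ?_
        have := h i
        rwa [Nat.modEq_iff_dvd, Int.natCast_dvd] at this
      · intro h i
        exact h.of_dvd (Finset.dvd_lcm (mem_univ i))
    simp only [key]
    rw [periodMean_modEq hQ hD, sum_boole, mul_one_div]
    exact abs_card_modEq_sub_le (Nat.pos_of_dvd_of_pos hD hQ) N m
  · push Not at hex
    have h0 : ∀ n, ¬ ∀ i, d i ∣ n + j i := fun n h => by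
      obtain ⟨i, hi⟩ := hex n
      exact hi (h i)
    simp [h0, periodMean]

/-- Moments of a linear combination of divisibility indicators over `{1, …, N}` are approximated by
the means over a common period of the indicators. -/
theorem abs_sum_pow_sub_le {α : Type*} (A : Finset α) (c : α → ℝ) (d j : α → ℕ) {Q : ℕ}
    (hQ : 0 < Q) (hd : ∀ a ∈ A, c a ≠ 0 → d a ∣ Q) (k N : ℕ) :
    |(∑ n ∈ Ioc 0 N, (∑ a ∈ A, if d a ∣ n + j a then c a else 0) ^ k) -
      N * periodMean Q (fun n => (∑ a ∈ A, if d a ∣ n + j a then c a else 0) ^ k)| ≤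
    (∑ a ∈ A, |c a|) ^ k := by
  have hexp : ∀ n, (∑ a ∈ A, if d a ∣ n + j a then c a else 0) ^ k =
      ∑ a ∈ Fintype.piFinset (fun _ : Fin k => A),
        (∏ i, c (a i)) * (if ∀ i, d (a i) ∣ n + j (a i) then 1 else 0) := by
    intro n
    have h1 := prod_univ_sum (fun _ : Fin k => A) fun _ a => if d a ∣ n + j a then c a else 0
    rw [prod_const, card_univ, Fintype.card_fin] at h1
    rw [h1]
    refine sum_congr rfl fun a _ => ?_
    rw [prod_ite_zero]
    simp
  have hR : (∑ a ∈ A, |c a|) ^ k =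
      ∑ a ∈ Fintype.piFinset (fun _ : Fin k => A), ∏ i, |c (a i)| := by
    have h1 := prod_univ_sum (fun _ : Fin k => A) fun _ a => |c a|
    rwa [prod_const, card_univ, Fintype.card_fin] at h1
  simp only [hexp]
  rw [sum_comm, periodMean_sum, mul_sum, ← sum_sub_distrib, hR]
  refine (abs_sum_le_sum_abs _ _).trans (sum_le_sum fun a ha => ?_)
  rw [← mul_sum, periodMean_const_mul, mul_left_comm, ← mul_sub, abs_mul, abs_prod]
  by_cases h0 : ∃ i, c (a i) = 0
  · obtain ⟨i, hi⟩ := h0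
    rw [prod_eq_zero (mem_univ i) (by rw [hi, abs_zero]), zero_mul]
  · push Not at h0
    rw [Fintype.mem_piFinset] at ha
    exact mul_le_of_le_one_right (prod_nonneg fun _ _ => abs_nonneg _)
      (abs_card_forall_dvd_sub_le hQ (fun i => d (a i)) (fun i => j (a i))
        (fun i => hd _ (ha i) (h0 i)) N)

/-- The moments of window sums over `{1, …, N}` are given by the means over a period, with an error
independent of `N`. -/
theorem abs_sum_windowSum_pow_sub_le (k N R H : ℕ) :
    |(∑ n ∈ Ioc 0 N, windowSum 0 R H n ^ k) -
      N * periodMean (primorial R) (fun n => windowSum 0 R H n ^ k)| ≤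
    (H * ∑ r ∈ Ioc 0 R, sqfMul phiInv r * ∑ d ∈ r.divisors, (d : ℝ)) ^ k := by
  set A : Finset (ℕ × (Σ _ : ℕ, ℕ)) := Ioc 0 H ×ˢ (Ioc 0 R).sigma fun r => r.divisors with hA
  set c : ℕ × (Σ _ : ℕ, ℕ) → ℝ := fun a => sqfMul phiInv a.2.1 * ((moebius a.2.2 : ℝ) * a.2.2)
    with hc
  have hexp : ∀ n, windowSum 0 R H n =
      ∑ a ∈ A, if a.2.2 ∣ n + a.1 then c a else 0 := by
    intro n
    rw [hA, sum_product, windowSum]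
    refine sum_congr rfl fun j _ => ?_
    rw [sum_sigma, truncSum]
    exact sum_congr rfl fun r _ => sqfMul_localValue_eq_sum_divisors _ r
  have h := abs_sum_pow_sub_le A c (fun a => a.2.2) (fun a => a.1) (primorial_pos R)
    (fun a ha h0 => by
      rw [hA, mem_product, mem_sigma, mem_Ioc, mem_Ioc] at ha
      have hsq : Squarefree a.2.2 := by
        by_contra hs
        simp [hc, moebius_eq_zero_of_not_squarefree hs] at h0
      exact hsq.dvd_primorial.trans (primorial_dvd_primorial
        ((Nat.divisor_le ha.2.2).trans ha.2.1.2))) k N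
  simp only [← hexp] at h
  refine h.trans (pow_le_pow_left₀ (sum_nonneg fun _ _ => abs_nonneg _) ?_ k)
  have hH : ∀ b : ℝ, (H : ℝ) * b = ∑ _j ∈ Ioc 0 H, b := fun b => by
    rw [sum_const, Nat.card_Ioc, Nat.sub_zero, nsmul_eq_mul]
  rw [hA, sum_product, hH]
  refine sum_le_sum fun j _ => ?_
  rw [sum_sigma]
  refine sum_le_sum fun r _ => ?_
  rw [mul_sum]
  refine sum_le_sum fun d _ => ?_
  have hw : 0 ≤ sqfMul phiInv r := sqfMul_nonneg r fun p hp => (phiInv_pos hp).le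
  have hmu : |(moebius d : ℝ)| ≤ 1 := by exact_mod_cast abs_moebius_le_one (n := d)
  simp only [hc]
  rw [abs_mul, abs_of_nonneg hw, abs_mul, Nat.abs_cast]
  exact mul_le_mul_of_nonneg_left (mul_le_of_le_one_left (Nat.cast_nonneg d) hmu) hw

/-- `σ(r) / φ(r) ≤ (r / φ(r))²` for squarefree `r`, and `r / φ(r) = ∑_{d ∣ r} μ²(d) / φ(d)`. -/
theorem sqfMul_phiInv_mul_sum_divisors_le {r R : ℕ} (hr : r ∈ Ioc 0 R) :
    sqfMul phiInv r * ∑ d ∈ r.divisors, (d : ℝ) ≤ (∑ d ∈ Ioc 0 R, sqfMul phiInv d) ^ 2 := by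
  by_cases hs : Squarefree r
  swap
  · rw [sqfMul_of_not_squarefree _ hs, zero_mul]
    positivity
  rw [mem_Ioc] at hr
  have h1 : ∑ d ∈ r.divisors, (d : ℝ) = ∏ p ∈ r.primeFactors, (1 + (p : ℝ)) := by
    rw [prod_primeFactors_one_add_eq hs]
    refine sum_congr rfl fun d hd => ?_
    have hds := hs.squarefree_of_dvd (Nat.dvd_of_mem_divisors hd)
    rw [sqfMul_apply, if_pos hds, ← Nat.cast_prod, Nat.prod_primeFactors_of_squarefree hds]
  have h2 : ∏ p ∈ r.primeFactors, (1 + phiInv p) ≤ ∑ d ∈ Ioc 0 R, sqfMul phiInv d := by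
    rw [prod_primeFactors_one_add_eq hs]
    refine sum_le_sum_of_subset_of_nonneg ?_ fun d _ _ =>
      sqfMul_nonneg d fun p hp => (phiInv_pos hp).le
    intro d hd
    rw [mem_Ioc]
    exact ⟨Nat.pos_of_mem_divisors hd, (Nat.divisor_le hd).trans hr.2⟩
  have h0 : ∀ p ∈ r.primeFactors, 0 ≤ 1 + phiInv p := fun p hp => by
    have := phiInv_pos (Nat.prime_of_mem_primeFactors hp)
    linarith
  refine le_trans ?_ (pow_le_pow_left₀ (prod_nonneg h0) h2 2)
  rw [h1, sqfMul_apply, if_pos hs, ← prod_mul_distrib, ← prod_pow]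
  refine prod_le_prod (fun p hp => ?_) fun p hp => ?_
  · have := phiInv_pos (Nat.prime_of_mem_primeFactors hp)
    positivity
  · have hp2 := (prime_rpow_facts (Nat.prime_of_mem_primeFactors hp)).2
    have h3 : 0 < (p : ℝ) - 1 := by linarith
    have h4 : (1 + phiInv p) ^ 2 - phiInv p * (1 + p) = 1 / ((p : ℝ) - 1) ^ 2 := by
      rw [phiInv]
      field_simp
      ring
    have h5 : 0 ≤ 1 / ((p : ℝ) - 1) ^ 2 := by positivity
    linarith

theorem sum_sqfMul_phiInv_mul_sum_divisors_le (R : ℕ) :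
    ∑ r ∈ Ioc 0 R, sqfMul phiInv r * ∑ d ∈ r.divisors, (d : ℝ) ≤
      R * (∑ d ∈ Ioc 0 R, sqfMul phiInv d) ^ 2 := by
  refine (sum_le_sum fun r hr => sqfMul_phiInv_mul_sum_divisors_le hr).trans ?_
  rw [sum_const, Nat.card_Ioc, Nat.sub_zero, nsmul_eq_mul]

/-- `sqfMul phiInv` is the weight `μ²(r) / φ(r)` of `lambdaR`. -/
theorem sqfMul_phiInv_eq (r : ℕ) :
    sqfMul phiInv r = (moebius r : ℝ) ^ 2 / (Nat.totient r : ℝ) := by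
  rw [sqfMul_apply]
  split_ifs with hs
  · have h1 : (moebius r : ℝ) ^ 2 = 1 := by
      have := moebius_sq_eq_one_of_squarefree hs
      exact_mod_cast this
    have h2 : (Nat.totient r : ℝ) = ∏ p ∈ r.primeFactors, ((p : ℝ) - 1) := by
      have h3 := Nat.totient_eq_div_primeFactors_mul r
      rw [Nat.prod_primeFactors_of_squarefree hs, Nat.div_self (Nat.pos_of_ne_zero hs.ne_zero),
        one_mul] at h3
      rw [h3, Nat.cast_prod]
      exact prod_congr rfl fun p hp => by
        rw [Nat.cast_sub (Nat.prime_of_mem_primeFactors hp).one_le, Nat.cast_one]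
    rw [h1, h2]
    simp only [phiInv]
    rw [prod_div_distrib, prod_const_one]
  · rw [moebius_eq_zero_of_not_squarefree hs]
    simp

/-- At `n = 0` the two sides differ, since `lambdaR R 0 = 0`; window sums only involve positive
integers. -/
theorem lambdaR_eq_truncSum (R : ℝ) {n : ℕ} (hn : n ≠ 0) :
    lambdaR R n = truncSum 0 ⌊R⌋₊ n := by
  rw [lambdaR, if_neg hn, truncSum]
  have : Icc 1 ⌊R⌋₊ = Ioc 0 ⌊R⌋₊ := rfl
  rw [this]
  refine sum_congr rfl fun r hr => ?_
  rw [sqfMul_localValue_eq_sum_divisors, ← sqfMul_phiInv_eq, ← sum_filter, mul_sum]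
  have hdiv : r.divisors.filter (· ∣ n) = (r.gcd n).divisors := by
    ext d
    simp only [mem_filter, Nat.mem_divisors, Nat.dvd_gcd_iff]
    have h1 : r.gcd n ≠ 0 := fun h => hn (Nat.gcd_eq_zero_iff.mp h).2
    have h2 := (mem_Ioc.mp hr).1.ne'
    tauto
  rw [hdiv]
  exact sum_congr rfl fun d _ => by ring

/-- The moments in terms of the integer parts of the parameters. -/
theorem shortIntervalMoment_psiR_eq (k N : ℕ) {h : ℝ} (hh : 0 ≤ h) (R : ℝ) :
    shortIntervalMoment k N h (psiR R) = ∑ n ∈ Ioc 0 N, windowSum 0 ⌊R⌋₊ ⌊h⌋₊ n ^ k := by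
  rw [shortIntervalMoment]
  have : Icc 1 N = Ioc 0 N := rfl
  rw [this]
  refine sum_congr rfl fun n _ => ?_
  congr 1
  have hI : ∀ m, Icc 1 m = Ioc 0 m := fun m => rfl
  rw [psiR, psiR, Nat.floor_natCast, add_comm (n : ℝ), Nat.floor_add_natCast hh, hI, hI, windowSum]
  have h1 := sum_Ioc_consecutive (fun m => lambdaR R m) (Nat.zero_le n)
    (Nat.le_add_left n ⌊h⌋₊)
  have h2 : ∑ m ∈ Ioc n (⌊h⌋₊ + n), lambdaR R m =
      ∑ j ∈ Ioc 0 ⌊h⌋₊, truncSum 0 ⌊R⌋₊ (n + j) := by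
    refine (sum_nbij (fun j => n + j) ?_ ?_ ?_ ?_).symm
    · intro j hj
      rw [mem_Ioc] at hj ⊢
      omega
    · intro a _ b _ hab
      exact Nat.add_left_cancel hab
    · intro m hm
      simp only [coe_Ioc, Set.mem_Ioc] at hm
      exact ⟨m - n, by simp only [coe_Ioc, Set.mem_Ioc]; omega, by simp only; omega⟩
    · intro j hj
      rw [lambdaR_eq_truncSum]
      have := (mem_Ioc.mp hj).1
      omega
  linarith

/-! ### Asymptotics -/

section Asymptotic

open Filter Topology Asymptotics

theorem tendsto_log_natCast_atTop : Tendsto (fun N : ℕ => Real.log (N : ℝ)) atTop atTop :=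
  Real.tendsto_log_atTop.comp tendsto_natCast_atTop_atTop

theorem log_floor_le {x : ℝ} (hx : 1 ≤ x) : Real.log (⌊x⌋₊ : ℝ) ≤ Real.log x := by
  have h1 : (1 : ℝ) ≤ ⌊x⌋₊ := by exact_mod_cast Nat.one_le_floor_iff x |>.mpr hx
  exact Real.log_le_log (by linarith) (Nat.floor_le (by linarith))

/-- The logarithm of the level `⌊N ^ θ⌋` is asymptotic to `θ log N`. -/
theorem tendsto_log_floor_rpow_div {θ : ℝ} (hθ : 0 < θ) :
    Tendsto (fun N : ℕ => Real.log (⌊(N : ℝ) ^ θ⌋₊ : ℝ) / Real.log N) atTop (𝓝 θ) := by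
  have hpow : Tendsto (fun N : ℕ => (N : ℝ) ^ θ) atTop atTop :=
    (tendsto_rpow_atTop hθ).comp tendsto_natCast_atTop_atTop
  have hlow : Tendsto (fun N : ℕ => θ - Real.log 2 / Real.log (N : ℝ)) atTop (𝓝 (θ - 0)) :=
    tendsto_const_nhds.sub (tendsto_log_natCast_atTop.const_div_atTop _)
  rw [sub_zero] at hlow
  refine tendsto_of_tendsto_of_tendsto_of_le_of_le' hlow tendsto_const_nhds ?_ ?_
  · filter_upwards [hpow.eventually_ge_atTop 2, tendsto_log_natCast_atTop.eventually_gt_atTop 0,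
      eventually_gt_atTop 0] with N h2 hl hN
    have hN0 : (0 : ℝ) < N := by exact_mod_cast hN
    have h1 : (N : ℝ) ^ θ / 2 ≤ ⌊(N : ℝ) ^ θ⌋₊ := by
      have := Nat.lt_floor_add_one ((N : ℝ) ^ θ)
      linarith
    have h3 := Real.log_le_log (by positivity) h1
    rw [Real.log_div (by positivity) two_ne_zero, Real.log_rpow hN0] at h3
    rw [le_div_iff₀ hl, sub_mul, div_mul_cancel₀ _ hl.ne']
    exact h3
  · filter_upwards [hpow.eventually_ge_atTop 1, tendsto_log_natCast_atTop.eventually_gt_atTop 0,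
      eventually_gt_atTop 0] with N h1 hl hN
    have hN0 : (0 : ℝ) < N := by exact_mod_cast hN
    rw [div_le_iff₀ hl, ← Real.log_rpow hN0]
    exact log_floor_le h1

theorem tendsto_rpow_neg_mul_log_pow {a : ℝ} (ha : 0 < a) (k : ℕ) :
    Tendsto (fun N : ℕ => (N : ℝ) ^ (-a) * Real.log N ^ k) atTop (𝓝 0) := by
  have h := ((isLittleO_log_rpow_rpow_atTop (k : ℝ) ha).tendsto_div_nhds_zero).comp
    tendsto_natCast_atTop_atTop
  refine h.congr fun N => ?_
  simp only [Function.comp]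
  rw [Real.rpow_natCast, Real.rpow_neg (Nat.cast_nonneg N), div_eq_inv_mul]

/-- Replacing the mean over the integers up to `N` by the mean over a period is harmless as long as
`R^k` is smaller than `N` by a power of `N`, where `R = N^θ`. -/
theorem tendsto_moment_sub_div {k : ℕ} (hk : 1 ≤ k) {θ : ℝ} (hθ : 0 < θ) (hkθ : k * θ < 1)
    {C : ℝ} (H : ℕ → ℕ) (hH1 : ∀ᶠ N in atTop, 1 ≤ H N)
    (hHC : ∀ᶠ N : ℕ in atTop, (H N : ℝ) ≤ C * Real.log (⌊(N : ℝ) ^ θ⌋₊ : ℝ)) :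
    Tendsto (fun N : ℕ => ((∑ n ∈ Ioc 0 N, windowSum 0 ⌊(N : ℝ) ^ θ⌋₊ (H N) n ^ k) -
        N * periodMean (primorial ⌊(N : ℝ) ^ θ⌋₊)
          (fun n => windowSum 0 ⌊(N : ℝ) ^ θ⌋₊ (H N) n ^ k)) /
      (N * (H N * Real.log (⌊(N : ℝ) ^ θ⌋₊ : ℝ) ^ (k - 1)))) atTop (𝓝 0) := by
  obtain ⟨K, hK0, hK⟩ := exists_abs_sum_phiInv_sub_log_le
  have hpow : Tendsto (fun N : ℕ => (N : ℝ) ^ θ) atTop atTop :=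
    (tendsto_rpow_atTop hθ).comp tendsto_natCast_atTop_atTop
  have hlogR : Tendsto (fun N : ℕ => Real.log (⌊(N : ℝ) ^ θ⌋₊ : ℝ)) atTop atTop :=
    tendsto_log_natCast_atTop.comp (tendsto_nat_floor_atTop.comp hpow)
  have hθ1 : θ < 1 := by
    have : (1 : ℝ) ≤ k := by exact_mod_cast hk
    nlinarith
  have hlim := (tendsto_rpow_neg_mul_log_pow (sub_pos.mpr hkθ) (3 * k)).const_mul ((4 * C) ^ k)
  rw [mul_zero] at hlim
  refine squeeze_zero_norm' ?_ hlim
  filter_upwards [hH1, hHC, hlogR.eventually_ge_atTop (1 + K), hpow.eventually_ge_atTop 1,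
    eventually_gt_atTop 0] with N h1 hC hl hNθ hN
  have hN0 : (0 : ℝ) < N := by exact_mod_cast hN
  have hN1 : (1 : ℝ) ≤ N := by exact_mod_cast hN
  set R := ⌊(N : ℝ) ^ θ⌋₊ with hR
  have hR1 : 1 ≤ R := (Nat.one_le_floor_iff _).mpr hNθ
  have hRN : (R : ℝ) ≤ (N : ℝ) ^ θ := Nat.floor_le (by linarith)
  have hlN : Real.log R ≤ Real.log N := by
    refine (log_floor_le hNθ).trans ?_
    rw [Real.log_rpow hN0]
    have := Real.log_nonneg hN1
    nlinarith
  have herr := abs_sum_windowSum_pow_sub_le k N R (H N)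
  have hL := (abs_le.mp (hK R hR1)).2
  have hsum := sum_sqfMul_phiInv_mul_sum_divisors_le R
  have hL0 : 0 ≤ ∑ r ∈ Ioc 0 R, sqfMul phiInv r :=
    sum_nonneg fun r _ => sqfMul_nonneg r fun p hp => (phiInv_pos hp).le
  have hS0 : 0 ≤ ∑ r ∈ Ioc 0 R, sqfMul phiInv r * ∑ d ∈ r.divisors, (d : ℝ) :=
    sum_nonneg fun r _ => mul_nonneg (sqfMul_nonneg r fun p hp => (phiInv_pos hp).le)
      (sum_nonneg fun _ _ => Nat.cast_nonneg _)
  have hH1 : (1 : ℝ) ≤ H N := by exact_mod_cast h1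
  set l := Real.log R
  have hl1 : 1 ≤ l := by linarith
  have hC0 : 0 ≤ C := by
    by_contra hneg
    push Not at hneg
    have : C * l < 0 := mul_neg_of_neg_of_pos hneg (by linarith)
    linarith
  have hbase : (H N : ℝ) * (∑ r ∈ Ioc 0 R, sqfMul phiInv r * ∑ d ∈ r.divisors, (d : ℝ)) ≤
      4 * C * (N : ℝ) ^ θ * Real.log N ^ 3 := by
    calc _ ≤ C * l * (R * (∑ d ∈ Ioc 0 R, sqfMul phiInv d) ^ 2) :=
          mul_le_mul hC hsum hS0 (by positivity)
      _ ≤ C * l * ((N : ℝ) ^ θ * (2 * l) ^ 2) := by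
          gcongr
          linarith
      _ = 4 * C * (N : ℝ) ^ θ * l ^ 3 := by ring
      _ ≤ _ := by gcongr
  have hden : (N : ℝ) ≤ N * (H N * l ^ (k - 1)) := by
    refine le_mul_of_one_le_right hN0.le ?_
    exact one_le_mul_of_one_le_of_one_le hH1 (one_le_pow₀ hl1)
  rw [Real.norm_eq_abs, abs_div, abs_of_nonneg (hN0.le.trans hden)]
  calc _ ≤ (4 * C * (N : ℝ) ^ θ * Real.log N ^ 3) ^ k / N := by
        refine div_le_div₀ ?_ (herr.trans (pow_le_pow_left₀ (by positivity) hbase k)) hN0 hden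
        have := Real.log_nonneg hN1
        positivity
    _ = _ := by
        have e : (N : ℝ) ^ (-(1 - k * θ)) = ((N : ℝ) ^ θ) ^ k / N := by
          rw [show -(1 - (k : ℝ) * θ) = θ * k - 1 by ring, Real.rpow_sub_one hN0.ne',
            Real.rpow_mul hN0.le, Real.rpow_natCast]
        rw [e, mul_pow, mul_pow, ← pow_mul]
        ring

/-- A quadratic polynomial is uniformly continuous on bounded sets. -/
theorem tendsto_quadratic_sub {a b : ℕ → ℝ} (hab : Tendsto (fun N => a N - b N) atTop (𝓝 0))
    (hb : b =O[atTop] fun _ => (1 : ℝ)) (c₂ c₁ c₀ : ℝ) :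
    Tendsto (fun N => (c₂ * a N ^ 2 + c₁ * a N + c₀) - (c₂ * b N ^ 2 + c₁ * b N + c₀)) atTop
      (𝓝 0) := by
  have h1 : (fun N => a N - b N) =o[atTop] fun _ => (1 : ℝ) := (isLittleO_one_iff ℝ).mpr hab
  have h2 : (fun N => c₂ * ((a N - b N) + 2 * b N) + c₁) =O[atTop] fun _ => (1 : ℝ) :=
    (((h1.isBigO.add (hb.const_mul_left 2)).const_mul_left c₂)).add (isBigO_const_const _ one_ne_zero _)
  have h3 := h1.mul_isBigO h2
  simp only [mul_one] at h3
  refine ((isLittleO_one_iff ℝ).mp h3).congr fun N => ?_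
  ring

/-- The passage from the mean over a period to the moments: if the `k`-th mean of the window sums is
asymptotic to `H log^{k-1} R` times a quadratic polynomial in `H / log R` with positive values, the
moments have the corresponding asymptotics. -/
theorem isEquivalent_shortIntervalMoment
    {lam h : ℕ → ℝ}
    (hlam : lam =O[atTop] fun _ : ℕ => (1 : ℝ))
    (hh : h ~[atTop] fun N : ℕ => lam N * Real.log (N : ℝ))
    (h_inf : Tendsto h atTop atTop) {k : ℕ} (hk : 1 ≤ k) {θ : ℝ} (hθ : 0 < θ) (hkθ : k * θ < 1)
    {c₂ c₁ c₀ : ℝ} (hc₂ : 0 ≤ c₂) (hc₁ : 0 ≤ c₁) (hc₀ : 0 < c₀)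
    (hE : ∀ C ε : ℝ, 0 ≤ C → 0 < ε → ∃ l₀ : ℝ, ∀ R H : ℕ, l₀ ≤ Real.log R → 1 ≤ H →
      (H : ℝ) ≤ C * Real.log R →
      |periodMean (primorial R) (fun n => windowSum 0 R H n ^ k) - H * Real.log R ^ (k - 1) *
        (c₂ * (H / Real.log R) ^ 2 + c₁ * (H / Real.log R) + c₀)| ≤
          ε * (H * Real.log R ^ (k - 1))) :
    (fun N : ℕ => shortIntervalMoment k N (h N) (psiR ((N : ℝ) ^ θ))) ~[atTop]
      fun N : ℕ => lam N * Real.log N * (θ * Real.log N) ^ (k - 1) * N *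
        (c₂ * (lam N / θ) ^ 2 + c₁ * (lam N / θ) + c₀) := by
  set H : ℕ → ℕ := fun N => ⌊h N⌋₊ with hHdef
  set R : ℕ → ℕ := fun N => ⌊(N : ℝ) ^ θ⌋₊ with hRdef
  set l : ℕ → ℝ := fun N => Real.log (R N) with hldef
  have hlogN := tendsto_log_natCast_atTop
  have hpow : Tendsto (fun N : ℕ => (N : ℝ) ^ θ) atTop atTop :=
    (tendsto_rpow_atTop hθ).comp tendsto_natCast_atTop_atTop
  have hl : Tendsto l atTop atTop :=
    tendsto_log_natCast_atTop.comp (tendsto_nat_floor_atTop.comp hpow)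
  have hlθ : Tendsto (fun N : ℕ => l N / Real.log N) atTop (𝓝 θ) := tendsto_log_floor_rpow_div hθ
  have hHequiv : (fun N => (H N : ℝ)) ~[atTop] fun N : ℕ => lam N * Real.log (N : ℝ) :=
    IsEquivalent.trans (v := h) ((isEquivalent_nat_floor (R := ℝ)).comp_tendsto h_inf) hh
  have hlamlog : Tendsto (fun N : ℕ => lam N * Real.log (N : ℝ)) atTop atTop :=
    hh.tendsto_atTop h_inf
  have hlampos : ∀ᶠ N in atTop, 0 < lam N := by
    filter_upwards [hlamlog.eventually_gt_atTop 0, hlogN.eventually_gt_atTop 0] with N h1 h2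
    exact (pos_iff_pos_of_mul_pos h1).mpr h2
  have hρ : Tendsto (fun N : ℕ => (H N : ℝ) / (lam N * Real.log N)) atTop (𝓝 1) :=
    (isEquivalent_iff_tendsto_one (hlamlog.eventually_gt_atTop 0 |>.mono fun N h => h.ne')).mp hHequiv
  have hH1 : ∀ᶠ N in atTop, 1 ≤ H N :=
    (tendsto_nat_floor_atTop.comp h_inf).eventually_ge_atTop 1
  -- the ratio `H / log R` stays close to the bounded quantity `lam / θ`
  have hdiff0 : Tendsto (fun N : ℕ => (H N : ℝ) / Real.log N - lam N) atTop (𝓝 0) := by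
    have h1 : (fun N : ℕ => (H N : ℝ) - lam N * Real.log N) =o[atTop] fun N : ℕ => Real.log N := by
      refine hHequiv.isLittleO.trans_isBigO ?_
      simpa using hlam.mul (isBigO_refl (fun N : ℕ => Real.log (N : ℝ)) atTop)
    refine h1.tendsto_div_nhds_zero.congr' ?_
    filter_upwards [hlogN.eventually_gt_atTop 0] with N hN
    field_simp
  have hdiff : Tendsto (fun N : ℕ => (H N : ℝ) / l N - lam N / θ) atTop (𝓝 0) := by
    have hinv : Tendsto (fun N : ℕ => Real.log N / l N) atTop (𝓝 θ⁻¹) := by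
      refine (hlθ.inv₀ hθ.ne').congr fun N => ?_
      rw [inv_div]
    have h1 := hdiff0.mul hinv
    have h2 : Tendsto (fun N : ℕ => lam N * (Real.log N / l N - θ⁻¹)) atTop (𝓝 0) := by
      have h3 : (fun N : ℕ => Real.log N / l N - θ⁻¹) =o[atTop] fun _ => (1 : ℝ) := by
        rw [isLittleO_one_iff, ← sub_self θ⁻¹]
        exact hinv.sub_const _
      have h4 := hlam.mul_isLittleO h3
      simp only [mul_one] at h4
      exact (isLittleO_one_iff ℝ).mp h4
    have h3 := h1.add h2
    rw [zero_mul, zero_add] at h3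
    refine h3.congr' ?_
    filter_upwards [hlogN.eventually_gt_atTop 0, hl.eventually_gt_atTop 0] with N hN hlN
    field_simp
    ring
  have hbound : (fun N : ℕ => lam N / θ) =O[atTop] fun _ => (1 : ℝ) := by
    simpa only [div_eq_inv_mul] using hlam.const_mul_left θ⁻¹
  obtain ⟨C, hC0, hHC⟩ : ∃ C : ℝ, 0 ≤ C ∧ ∀ᶠ N in atTop, (H N : ℝ) ≤ C * l N := by
    obtain ⟨C, hC⟩ := hbound.bound
    refine ⟨|C| + 1, by positivity, ?_⟩
    filter_upwards [hC, hdiff.eventually (gt_mem_nhds one_pos), hl.eventually_gt_atTop 0]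
      with N h1 h2 h3
    rw [norm_one, mul_one, Real.norm_eq_abs] at h1
    rw [← div_le_iff₀ h3]
    have := le_abs_self (lam N / θ)
    have := le_abs_self C
    linarith
  set p : ℝ → ℝ := fun x => c₂ * x ^ 2 + c₁ * x + c₀ with hp
  set M : ℕ → ℝ := fun N => shortIntervalMoment k N (h N) (psiR ((N : ℝ) ^ θ)) with hM
  set G : ℕ → ℝ := fun N => N * (H N * l N ^ (k - 1)) with hG
  set E : ℕ → ℝ := fun N => periodMean (primorial (R N)) (fun n => windowSum 0 (R N) (H N) n ^ k)
    with hEdef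
  have hGpos : ∀ᶠ N in atTop, 0 < G N := by
    filter_upwards [hH1, hl.eventually_gt_atTop 0, eventually_gt_atTop 0] with N h1 h2 h3
    have h4 : (0 : ℝ) < H N := by exact_mod_cast h1
    have h5 : (0 : ℝ) < N := by exact_mod_cast h3
    simp only [hG]
    positivity
  have t1 : Tendsto (fun N => (M N - N * E N) / G N) atTop (𝓝 0) := by
    refine (tendsto_moment_sub_div hk hθ hkθ H hH1 hHC).congr' ?_
    filter_upwards [h_inf.eventually_ge_atTop 0] with N hN
    simp only [hM]
    rw [shortIntervalMoment_psiR_eq k N hN]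
  have t2 : Tendsto (fun N => N * E N / G N - p (H N / l N)) atTop (𝓝 0) := by
    rw [Metric.tendsto_nhds]
    intro ε hε
    obtain ⟨l₀, hl₀⟩ := hE C (ε / 2) hC0 (half_pos hε)
    filter_upwards [hl.eventually_ge_atTop l₀, hH1, hHC, hl.eventually_gt_atTop 0,
      eventually_gt_atTop 0] with N h1 h2 h3 h4 h5
    have h6 := hl₀ (R N) (H N) h1 h2 h3
    have hH0 : (0 : ℝ) < H N := by exact_mod_cast h2
    have hN0 : (0 : ℝ) < N := by exact_mod_cast h5
    have hd : 0 < (H N : ℝ) * l N ^ (k - 1) := by positivity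
    have e : N * E N / G N - p (H N / l N) =
        (E N - H N * l N ^ (k - 1) * p (H N / l N)) / (H N * l N ^ (k - 1)) := by
      simp only [hG]
      field_simp
    rw [Real.dist_eq, sub_zero, e, abs_div, abs_of_pos hd, div_lt_iff₀ hd]
    calc _ ≤ ε / 2 * (H N * l N ^ (k - 1)) := h6
      _ < _ := mul_lt_mul_of_pos_right (half_lt_self hε) hd
  have t3 : Tendsto (fun N => p (H N / l N) - p (lam N / θ)) atTop (𝓝 0) :=
    tendsto_quadratic_sub hdiff hbound c₂ c₁ c₀
  have t4 : Tendsto (fun N => M N / G N - p (lam N / θ)) atTop (𝓝 0) := by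
    have := (t1.add t2).add t3
    rw [add_zero, add_zero] at this
    refine this.congr fun N => ?_
    ring
  have hpge : ∀ᶠ N in atTop, c₀ ≤ p (lam N / θ) := by
    filter_upwards [hlampos] with N h1
    have h2 : 0 ≤ lam N / θ := by positivity
    have h3 : 0 ≤ c₂ * (lam N / θ) ^ 2 + c₁ * (lam N / θ) := by positivity
    simp only [hp]
    linarith
  -- as `p` is bounded below by `c₀ > 0`, the difference may be replaced by the quotient
  have t5 : Tendsto (fun N => (M N / G N) / p (lam N / θ)) atTop (𝓝 1) := by
    have h1 : Tendsto (fun N => (M N / G N - p (lam N / θ)) / p (lam N / θ)) atTop (𝓝 0) := by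
      have h2 := t4.norm.mul_const c₀⁻¹
      rw [norm_zero, zero_mul] at h2
      refine squeeze_zero_norm' ?_ h2
      filter_upwards [hpge] with N h3
      rw [norm_div, div_eq_mul_inv, Real.norm_eq_abs (p _), abs_of_pos (hc₀.trans_le h3)]
      gcongr
    have h2 := h1.add_const 1
    rw [zero_add] at h2
    refine h2.congr' ?_
    filter_upwards [hpge] with N h3
    have := (hc₀.trans_le h3).ne'
    field_simp
    ring
  have t6 : Tendsto (fun N : ℕ => ((H N : ℝ) / (lam N * Real.log N)) *
      (l N / Real.log N / θ) ^ (k - 1)) atTop (𝓝 1) := by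
    have h1 := hρ.mul ((hlθ.div_const θ).pow (k - 1))
    rwa [div_self hθ.ne', one_pow, one_mul] at h1
  refine isEquivalent_of_tendsto_one ?_
  have t7 := t5.mul t6
  rw [one_mul] at t7
  refine t7.congr' ?_
  filter_upwards [hpge, hGpos, hlampos, hlogN.eventually_gt_atTop 0, eventually_gt_atTop 0,
    hl.eventually_gt_atTop 0, hH1] with N h1 h2 h3 h4 h5 h6 h7
  have hN0 : (0 : ℝ) < N := by exact_mod_cast h5
  have hH0 : (0 : ℝ) < H N := by exact_mod_cast h7
  have hp0 : 0 < p (lam N / θ) := hc₀.trans_le h1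
  simp only [Pi.div_apply]
  change M N / G N / p (lam N / θ) * _ =
    M N / (lam N * Real.log N * (θ * Real.log N) ^ (k - 1) * N * p (lam N / θ))
  simp only [hG]
  rw [div_div, div_pow, mul_pow, div_pow]
  field_simp

end Asymptotic

end

theorem corollary1
    (lam h : ℕ → ℝ)
    (hlam : Asymptotics.IsBigO Filter.atTop lam (fun _ : ℕ => (1 : ℝ)))
    (hh : Asymptotics.IsEquivalent Filter.atTop h (fun N : ℕ => lam N * Real.log (N : ℝ)))
    (h_inf : Filter.Tendsto h Filter.atTop Filter.atTop)
    (θ₁ θ₂ θ₃ : ℝ)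
    (hθ₁ : 0 < θ₁ ∧ θ₁ < 1)
    (hθ₂ : 0 < θ₂ ∧ θ₂ < 1 / 2)
    (hθ₃ : 0 < θ₃ ∧ θ₃ < 1 / 3) :
    Asymptotics.IsEquivalent Filter.atTop
      (fun N : ℕ => shortIntervalMoment 1 N (h N) (psiR ((N : ℝ) ^ θ₁)))
      (fun N : ℕ => lam N * (N : ℝ) * Real.log (N : ℝ)) ∧
    Asymptotics.IsEquivalent Filter.atTop
      (fun N : ℕ => shortIntervalMoment 2 N (h N) (psiR ((N : ℝ) ^ θ₂)))
      (fun N : ℕ => (θ₂ * lam N + lam N ^ 2) * (N : ℝ) * Real.log (N : ℝ) ^ 2) ∧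
    Asymptotics.IsEquivalent Filter.atTop
      (fun N : ℕ => shortIntervalMoment 3 N (h N) (psiR ((N : ℝ) ^ θ₃)))
      (fun N : ℕ =>
        (3 / 4 * θ₃ ^ 2 * lam N + 3 * θ₃ * lam N ^ 2 + lam N ^ 3) *
          (N : ℝ) * Real.log (N : ℝ) ^ 3) := by
  -- `isEquivalent_shortIntervalMoment` is applied to the polynomials `1`, `x + 1` and
  -- `x² + 3 x + 3 / 4` in `x = H / log R`
  obtain ⟨hθ₁0, hθ₁1⟩ := hθ₁
  obtain ⟨hθ₂0, hθ₂1⟩ := hθ₂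
  obtain ⟨hθ₃0, hθ₃1⟩ := hθ₃
  have hlogpos : ∀ {R : ℕ} {l₀ : ℝ}, max l₀ 1 ≤ Real.log R → l₀ ≤ Real.log R ∧ 0 < Real.log R :=
    fun hl => ⟨(le_max_left _ _).trans hl, one_pos.trans_le ((le_max_right _ _).trans hl)⟩
  refine ⟨?_, ?_, ?_⟩
  · have h1 := isEquivalent_shortIntervalMoment hlam hh h_inf (k := 1) le_rfl hθ₁0
      (by push_cast; linarith) (c₂ := 0) (c₁ := 0) (c₀ := 1) le_rfl le_rfl one_pos ?_
    · convert h1 using 2 with N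
      ring
    · intro C ε _ hε
      refine ⟨1, fun R H hl hH _ => ?_⟩
      have hR : 1 ≤ R := by
        rcases Nat.eq_zero_or_pos R with h0 | h0
        · rw [h0, Nat.cast_zero, Real.log_zero] at hl
          linarith
        · exact h0
      have hm := periodMean_windowSum 0 R H hR
      rw [if_pos rfl] at hm
      have hm' : periodMean (primorial R) (fun n => windowSum 0 R H n ^ 1) = H := by
        rw [← hm]
        exact periodMean_congr fun n => pow_one _
      rw [hm']
      simp only [Nat.sub_self, pow_zero, zero_mul, zero_add, mul_one, sub_self, abs_zero]
      positivity
  · have h2 := isEquivalent_shortIntervalMoment hlam hh h_inf (k := 2) (by norm_num) hθ₂0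
      (by push_cast; linarith) (c₂ := 0) (c₁ := 1) (c₀ := 1) le_rfl zero_le_one one_pos ?_
    · convert h2 using 2 with N
      field_simp
      ring
    · intro C ε hC hε
      obtain ⟨l₀, hl₀⟩ := exists_abs_periodMean_windowSum_sq_le hC hε
      refine ⟨max l₀ 1, fun R H hl hH hHC => ?_⟩
      obtain ⟨h3, h4⟩ := hlogpos hl
      have h5 := hl₀ R H h3 hH hHC
      have e : (H : ℝ) * Real.log R ^ (2 - 1) * (0 * (H / Real.log R) ^ 2 + 1 * (H / Real.log R) +
          1) = (H : ℝ) ^ 2 + H * Real.log R := by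
        rw [show 2 - 1 = 1 from rfl]
        field_simp
        ring
      rw [e, show 2 - 1 = 1 from rfl, pow_one]
      exact h5
  · have h3 := isEquivalent_shortIntervalMoment hlam hh h_inf (k := 3) (by norm_num) hθ₃0
      (by push_cast; linarith) (c₂ := 1) (c₁ := 3) (c₀ := 3 / 4) zero_le_one (by norm_num)
      (by norm_num) ?_
    · convert h3 using 2 with N
      field_simp
      ring
    · intro C ε hC hε
      obtain ⟨l₀, hl₀⟩ := exists_abs_periodMean_windowSum_cube_le hC hε
      refine ⟨max l₀ 1, fun R H hl hH hHC => ?_⟩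
      obtain ⟨h3, h4⟩ := hlogpos hl
      have h5 := hl₀ R H h3 hH hHC
      have e : (H : ℝ) * Real.log R ^ (3 - 1) * (1 * (H / Real.log R) ^ 2 + 3 * (H / Real.log R) +
          3 / 4) = (H : ℝ) ^ 3 + 3 * (H : ℝ) ^ 2 * Real.log R +
            3 / 4 * (H * Real.log R ^ 2) := by
        rw [show 3 - 1 = 2 from rfl]
        field_simp
      rw [e, show 3 - 1 = 2 from rfl]
      exact h5
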